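/- Let $\mathcal C$ be a braided monoidal category (written as if strict) with braiding $\Psi$ and unit object $\mathbf 1$ in which idempotents split, and let $H$ be a Hopf algebra in $\mathcal C$ whose antipode is an isomorphism. Write $m,\eta,\Delta,\varepsilon$ for multiplications, units, comultiplications and counits, $\mu$ for actions and $\nu$ for coactions. *Crossed modules.* A right crossed module over $H$ is a right $H$-module and right $H$-comodule $B$ with $$(\mu_r\otimes m_H)(\mathrm{id}\otimes\Psi_{H,H}\otimes \mathrm{id})(\nu_r\otimes\Delta_H)=(\mathrm{id}\otimes m_H)(\Psi_{H,B}\otimes\mathrm{id})(\mathrm{id}_H\otimes\nu_r\mu_r)(\Psi_{B,H}\otimes\mathrm{id})(\mathrm{id}\otimes\Delta_H);$$ left crossed modules are the mirror images. They form braided monoidal categories with the diagonal (co)actions on tensor products and, in the right-handed case, with the braiding $\Psi^{\mathcal{DY}}_{B,B'}=(\mathrm{id}_{B'}\otimes\mu^{B}_r)(\Psi_{B,B'}\otimes\mathrm{id}_H)(\mathrm{id}_B\otimes\nu^{B'}_r)$. Let $B$ be a bialgebra in the category of right crossed modules and $C$ a bialgebra in the category of left crossed modules over $H$. *Hopf bimodules.*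 $H$-Hopf bimodules are $H$-bimodules and $H$-bicomodules whose actions are bicomodule morphisms for the diagonal coactions. Their tensor product $X\otimes_HY$ is the tensor product over $H$ of the underlying modules and the cotensor product over $H$ of the underlying comodules, with canonical Hopf bimodule morphisms $\lambda_{X,Y}\colon X\otimes Y\to X\otimes_HY$ (induced actions and diagonal coactions on $X\otimes Y$) and $\rho_{X,Y}\colon X\otimes_HY\to X\otimes Y$ (diagonal actions and induced coactions on $X\otimes Y$) such that $\rho_{X,Y}\lambda_{X,Y}=(\mu_r^X\otimes\mu_l^Y)(\mathrm{id}\otimes\Psi_{H,H}\otimes\mathrm{id})(\nu^X_r\otimes\nu^Y_l)$; the unit object is $H$. The braiding ${}^H\Psi_{X,Y}\colon X\otimes_HY\to Y\otimes_HX$ is the unique morphism with $\rho_{Y,X}\,{}^H\Psi_{X,Y}\,\lambda_{X,Y}=(\mu^Y_l\otimes\mu^X_r)(\mathrm{id}\otimes\Psi_{X,Y}\otimes\mathrm{id})(\nu_l^X\otimes\nu_r^Y)$. Let $X=H\ltimes B$ be the Hopf bimodule $H\otimes B$ with induced left and diagonal right (co)actions, and $Y=C\rtimes H$ the Hopf bimodule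 $C\otimes H$ with diagonal left and induced right (co)actions. **(0)** $X$ and $Y$ are Hopf bimodules, and $Y\otimes_HX$ is realized on $C\otimes H\otimes B$ with $\lambda_{Y,X}=\mathrm{id}_C\otimes m_H\otimes\mathrm{id}_B$ and $\rho_{Y,X}=\mathrm{id}_C\otimes\Delta_H\otimes\mathrm{id}_B$; here the left (co)action is diagonal on $C\otimes H$ and the right (co)action is diagonal on $H\otimes B$. Also $X\otimes_HY$, ${}^H\Psi_{X,Y}$ and ${}^H\Psi_{Y,X}$ exist. Assume from now on that ${}^H\Psi_{X,Y}\circ{}^H\Psi_{Y,X}=\mathrm{id}_{Y\otimes_HX}$. **(1)** $X$ and $Y$ are bialgebras in the category of Hopf bimodules with units $\underline\eta_X=\mathrm{id}_H\otimes\eta_B$, $\underline\eta_Y=\eta_C\otimes\mathrm{id}_H$ and counits $\underline\varepsilon_X=\mathrm{id}_H\otimes\varepsilon_B$, $\underline\varepsilon_Y=\varepsilon_C\otimes\mathrm{id}_H$, and with multiplications and comultiplications such that $\underline m\lambda$ and $\rho\underline\Delta$ are the multiplications and comultiplications of the biproduct bialgebras $H\ltimes B$ and $C\rtimes H$ in $\mathcal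 C$. Their tensor product $\underline Z=Y\otimes_HX$, with $$\underline m_Z=(\underline m_Y\otimes_H\underline m_X)(\mathrm{id}\otimes_H{}^H\Psi_{X,Y}\otimes_H\mathrm{id}),\qquad \underline\Delta_Z=(\mathrm{id}\otimes_H{}^H\Psi_{Y,X}\otimes_H\mathrm{id})(\underline\Delta_Y\otimes_H\underline\Delta_X),$$ unit $\underline\eta_Y\otimes_H\underline\eta_X$ and counit $\underline\varepsilon_Y\otimes_H\underline\varepsilon_X$, is a bialgebra in the category of Hopf bimodules. The morphisms $m_Z=\underline m_Z\lambda_{Z,Z}$, $\eta_Z=\underline\eta_Z\eta_H$, $\Delta_Z=\rho_{Z,Z}\underline\Delta_Z$, $\varepsilon_Z=\varepsilon_H\underline\varepsilon_Z$ make $Z=C\otimes H\otimes B$ a bialgebra in $\mathcal C$, with $\eta_Z=\eta_C\otimes\eta_H\otimes\eta_B$, $\varepsilon_Z=\varepsilon_C\otimes\varepsilon_H\otimes\varepsilon_B$, $$m_Z=(m_C\otimes\mathrm{id}_H\otimes m_B)(\mathrm{id}_C\otimes\mu_l^C\otimes m_H\otimes\mu^B_r\otimes\mathrm{id}_B)(\mathrm{id}_{C\otimes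 H}\otimes\Psi_{H,C}\otimes\Psi_{B,H}\otimes\mathrm{id}_{H\otimes B})(\mathrm{id}_{C\otimes H\otimes H}\otimes\Psi_{B,C}\otimes\mathrm{id}_{H\otimes H\otimes B})(\mathrm{id}_C\otimes\Delta_H\otimes\mathrm{id}_{B\otimes C}\otimes\Delta_H\otimes\mathrm{id}_B),$$ $$\Delta_Z=(\mathrm{id}_C\otimes m_H\otimes\Psi_{C,B}\otimes m_H\otimes\mathrm{id}_B)(\mathrm{id}_{C\otimes H}\otimes\Psi_{C,H}\otimes\Psi_{H,B}\otimes\mathrm{id}_{H\otimes B})(\mathrm{id}_C\otimes\nu_l^C\otimes\Delta_H\otimes\nu_r^B\otimes\mathrm{id}_B)(\Delta_C\otimes\mathrm{id}_H\otimes\Delta_B).$$ The morphisms $\mathrm{id}_{C\otimes H}\otimes\eta_B\colon C\rtimes H\to Z$ and $\eta_C\otimes\mathrm{id}_{H\otimes B}\colon H\ltimes B\to Z$ are bialgebra monomorphisms, $\mathrm{id}_{C\otimes H}\otimes\varepsilon_B\colon Z\to C\rtimes H$ and $\varepsilon_C\otimes\mathrm{id}_{H\otimes B}\colon Z\to H\ltimes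 B$ are bialgebra epimorphisms, $\mathrm{id}_C\otimes\eta_H\otimes\mathrm{id}_B\colon C\otimes B\to Z$ is an algebra monomorphism and $\mathrm{id}_C\otimes\varepsilon_H\otimes\mathrm{id}_B\colon Z\to C\otimes B$ is a coalgebra epimorphism, where $C\otimes B$ carries the canonical algebra and coalgebra structures. **(2)** Let $\rho\colon B\otimes C\to\mathbf 1$ satisfy, with $\rho^{(2)}=\rho(\mathrm{id}_B\otimes\rho\otimes\mathrm{id}_C)$, $$\rho(\mu_r^B\otimes\mathrm{id}_C)=\rho(\mathrm{id}_B\otimes\mu_l^C),\quad \rho(\mathrm{id}_B\otimes m_C)=\rho^{(2)}(\Psi_{B,B}^{-1}\Delta_B\otimes\mathrm{id}_{C\otimes C}),\quad \rho(m_B\otimes\mathrm{id}_C)=\rho^{(2)}(\Psi^{\mathcal{DY}}_{B,B}\otimes\Psi_{C,C}^{-1}\Delta_C),$$ and put $\hat\rho=\varepsilon_C\otimes\varepsilon_H\otimes\rho\otimes\varepsilon_H\otimes\varepsilon_B\colon Z\otimes Z\to\mathbf 1$. Then $\hat\rho(\mathrm{id}_Z\otimes\hat\rho.m_Z)=\hat\rho(\hat\rho.m_Z\otimes\mathrm{id}_Z)$,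 where $\chi.f=(\chi\otimes f)\Delta$ and $f.\chi=(f\otimes\chi)\Delta$. If moreover $\rho(\eta_B\otimes\mathrm{id}_C)=\varepsilon_C$ and $\rho(\mathrm{id}_B\otimes\eta_C)=\varepsilon_B$, then $\hat\rho$ is a $2$-cocycle of $Z$, i.e. also $\hat\rho(\eta_Z\otimes\mathrm{id}_Z)=\varepsilon_Z=\hat\rho(\mathrm{id}_Z\otimes\eta_Z)$. **(3)** Let $\rho$ be as in the first sentence of (2), and suppose that it is convolution invertible, with inverse $\rho^-$ (with respect to the canonical coalgebra $B\otimes C$ in $\mathcal C$). Then $\hat\rho$ is a $2$-cocycle of $Z$, convolution invertible with inverse $\hat\rho^-=\varepsilon_C\otimes\varepsilon_H\otimes\rho^-\otimes\varepsilon_H\otimes\varepsilon_B$. With the twisted multiplication $m_Z^{\hat\rho}=\hat\rho.m_Z.\hat\rho^-$ and unchanged $\eta_Z,\Delta_Z,\varepsilon_Z$ the object $C\otimes H\otimes B$ is a bialgebra in $\mathcal C$ (the double biproduct), and $m_Z^{\hat\rho}$ is the following composite $(C\otimes H\otimes B)\otimes(C\otimes H\otimes B)\to C\otimes H\otimes B$,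 the morphisms being applied from top to bottom: $$\begin{aligned} &\mathrm{id}_C\otimes\Delta_H\otimes\Delta_B\otimes\Delta_C\otimes\Delta_H\otimes\mathrm{id}_B,\\ &\mathrm{id}_{C\otimes H\otimes H\otimes B}\otimes\Psi_{B,C}\otimes\mathrm{id}_{C\otimes H\otimes H\otimes B},\\ &\mathrm{id}_{C\otimes H\otimes H}\otimes\nu_r^B\otimes\Delta_C\otimes\Delta_B\otimes\nu_l^C\otimes\mathrm{id}_{H\otimes H\otimes B},\\ &\mathrm{id}_{C\otimes H\otimes H\otimes B}\otimes\Psi_{H,C}\otimes\mathrm{id}_{C\otimes B}\otimes\Psi_{B,H}\otimes\mathrm{id}_{C\otimes H\otimes H\otimes B},\\ &\mathrm{id}_{C\otimes H\otimes H}\otimes\rho\otimes\Delta_H\otimes\mathrm{id}_{C\otimes B}\otimes\Delta_H\otimes\rho^-\otimes\mathrm{id}_{H\otimes H\otimes B},\\ &\mathrm{id}_{C\otimes H\otimes H\otimes H}\otimes\Psi_{H,C}\otimes\Psi_{B,H}\otimes\mathrm{id}_{H\otimes H\otimes H\otimes B},\\ &\mathrm{id}_{C\otimes H\otimes H}\otimes\mu_l^C\otimes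 m_H\otimes\mu_r^B\otimes\mathrm{id}_{H\otimes H\otimes B},\\ &\mathrm{id}_{C\otimes H}\otimes\Psi_{H,C}\otimes\mathrm{id}_H\otimes\Psi_{B,H}\otimes\mathrm{id}_{H\otimes B},\\ &\mathrm{id}_C\otimes\mu_l^C\otimes m_H\otimes\mathrm{id}_H\otimes\mu_r^B\otimes\mathrm{id}_B,\\ &m_C\otimes m_H\otimes m_B. \end{aligned}$$ -/

import Mathlib

open CategoryTheory MonoidalCategory
open scoped MonObj ComonObj HopfObj

namespace CrossProd

universe v u

variable {𝒞 : Type u} [Category.{v} 𝒞] [MonoidalCategory.{v} 𝒞] [BraidedCategory 𝒞]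

/-! ### Objects with the structure morphisms of a bialgebra in a braided category -/

/-- Candidate structure morphisms of a bialgebra on an object `A` (no axioms). -/
structure BialgData (A : 𝒞) where
  mul : A ⊗ A ⟶ A
  one : 𝟙_ 𝒞 ⟶ A
  comul : A ⟶ A ⊗ A
  counit : A ⟶ 𝟙_ 𝒞

namespace BialgData

variable {A A' : 𝒞}

/-- The structure morphisms are those of a bialgebra (bimonoid) in `𝒞`. -/
def IsBialgebra (D : BialgData A) : Prop :=
  ∃ _ : BimonObj A, μ[A] = D.mul ∧ η[A] = D.one ∧ Δ[A] = D.comul ∧ ε[A] = D.counit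

/-- `f` is compatible with multiplications and units. -/
def IsAlgHom (D : BialgData A) (E : BialgData A') (f : A ⟶ A') : Prop :=
  D.mul ≫ f = (f ⊗ₘ f) ≫ E.mul ∧ D.one ≫ f = E.one

/-- `f` is compatible with comultiplications and counits. -/
def IsCoalgHom (D : BialgData A) (E : BialgData A') (f : A ⟶ A') : Prop :=
  f ≫ E.comul = D.comul ≫ (f ⊗ₘ f) ∧ f ≫ E.counit = D.counit

/-- `f` is a morphism of bialgebras. -/
def IsBialgHom (D : BialgData A) (E : BialgData A') (f : A ⟶ A') : Prop :=
  D.IsAlgHom E f ∧ D.IsCoalgHom E f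

/-- The canonical algebra and the canonical coalgebra structure, formed with the braiding of `𝒞`,
on the tensor product of two objects. -/
def tensor (D : BialgData A) (E : BialgData A') : BialgData (A ⊗ A') where
  mul := tensorμ A A' A A' ≫ (D.mul ⊗ₘ E.mul)
  one := (λ_ (𝟙_ 𝒞)).inv ≫ (D.one ⊗ₘ E.one)
  comul := (D.comul ⊗ₘ E.comul) ≫ tensorμ A A A' A'
  counit := (D.counit ⊗ₘ E.counit) ≫ (λ_ (𝟙_ 𝒞)).hom

/-- The structure morphisms of an object that is an algebra and a coalgebra. -/
def of (A : 𝒞) [MonObj A] [ComonObj A] : BialgData A where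
  mul := μ[A]
  one := η[A]
  comul := Δ[A]
  counit := ε[A]

/-! ### Convolution, two-cocycles and twists -/

/-- `χ.f = (χ ⊗ f) ∘ Δ`. -/
def convLeft (D : BialgData A) {V : 𝒞} (χ : A ⟶ 𝟙_ 𝒞) (f : A ⟶ V) : A ⟶ V :=
  D.comul ≫ (χ ⊗ₘ f) ≫ (λ_ V).hom

/-- `f.χ = (f ⊗ χ) ∘ Δ`. -/
def convRight (D : BialgData A) {V : 𝒞} (f : A ⟶ V) (χ : A ⟶ 𝟙_ 𝒞) : A ⟶ V :=
  D.comul ≫ (f ⊗ₘ χ) ≫ (ρ_ V).hom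

/-- `χ` and `χ'` are mutually inverse for the convolution product of morphisms `A ⟶ 𝟙_ 𝒞`. -/
def IsConvInverse (D : BialgData A) (χ χ' : A ⟶ 𝟙_ 𝒞) : Prop :=
  D.convLeft χ χ' = D.counit ∧ D.convLeft χ' χ = D.counit

/-- `χ ∘ (id ⊗ χ.m) = χ ∘ (χ.m ⊗ id)`. -/
def CocycleIdentity (D : BialgData A) (χ : A ⊗ A ⟶ 𝟙_ 𝒞) : Prop :=
  (α_ A A A).hom ≫ A ◁ ((D.tensor D).convLeft χ D.mul) ≫ χ
    = ((D.tensor D).convLeft χ D.mul) ▷ A ≫ χ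

/-- `χ` is a (normalized) two-cocycle. -/
def IsTwoCocycle (D : BialgData A) (χ : A ⊗ A ⟶ 𝟙_ 𝒞) : Prop :=
  D.CocycleIdentity χ ∧
    D.one ▷ A ≫ χ = (λ_ A).hom ≫ D.counit ∧
    A ◁ D.one ≫ χ = (ρ_ A).hom ≫ D.counit

/-- The twist by `χ` with convolution inverse `χ'`: the multiplication becomes `χ.m.χ'`, the
other structure morphisms are unchanged. -/
def twist (D : BialgData A) (χ χ' : A ⊗ A ⟶ 𝟙_ 𝒞) : BialgData A where
  mul := (D.tensor D).convRight ((D.tensor D).convLeft χ D.mul) χ'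
  one := D.one
  comul := D.comul
  counit := D.counit

end BialgData

/-! ### Diagonal actions and coactions -/

variable (H : 𝒞) [HopfObj H]

section Diagonal

variable {H}
variable {X Y : 𝒞}

/-- The diagonal left action on `X ⊗ Y`. -/
def diagActL (a : H ⊗ X ⟶ X) (b : H ⊗ Y ⟶ Y) : H ⊗ (X ⊗ Y) ⟶ X ⊗ Y :=
  Δ[H] ▷ (X ⊗ Y) ⊗≫ H ◁ ((β_ H X).hom ▷ Y) ⊗≫ (a ⊗ₘ b)

/-- The diagonal right action on `X ⊗ Y`. -/
def diagActR (a : X ⊗ H ⟶ X) (b : Y ⊗ H ⟶ Y) : (X ⊗ Y) ⊗ H ⟶ X ⊗ Y :=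
  (X ⊗ Y) ◁ Δ[H] ⊗≫ X ◁ ((β_ Y H).hom ▷ H) ⊗≫ (a ⊗ₘ b)

/-- The diagonal left coaction on `X ⊗ Y`. -/
def diagCoactL (a : X ⟶ H ⊗ X) (b : Y ⟶ H ⊗ Y) : X ⊗ Y ⟶ H ⊗ (X ⊗ Y) :=
  (a ⊗ₘ b) ⊗≫ H ◁ ((β_ X H).hom ▷ Y) ⊗≫ μ[H] ▷ (X ⊗ Y)

/-- The diagonal right coaction on `X ⊗ Y`. -/
def diagCoactR (a : X ⟶ X ⊗ H) (b : Y ⟶ Y ⊗ H) : X ⊗ Y ⟶ (X ⊗ Y) ⊗ H :=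
  (a ⊗ₘ b) ⊗≫ X ◁ ((β_ H Y).hom ▷ H) ⊗≫ (X ⊗ Y) ◁ μ[H]

end Diagonal

/-! ### Crossed modules and bialgebras in the categories of crossed modules -/

/-- A right crossed module (Yetter–Drinfeld module) over `H` on the object `B`. -/
structure RightCrossedModule (B : 𝒞) where
  act : B ⊗ H ⟶ B
  coact : B ⟶ B ⊗ H
  act_one : B ◁ η[H] ≫ act = (ρ_ B).hom
  act_mul : B ◁ μ[H] ≫ act = (α_ B H H).inv ≫ act ▷ H ≫ act
  coact_counit : coact ≫ B ◁ ε[H] = (ρ_ B).inv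
  coact_comul : coact ≫ B ◁ Δ[H] = coact ≫ coact ▷ H ≫ (α_ B H H).hom
  crossed :
    (coact ⊗ₘ Δ[H]) ⊗≫ B ◁ ((β_ H H).hom ▷ H) ⊗≫ (act ⊗ₘ μ[H])
      = B ◁ Δ[H] ⊗≫ (β_ B H).hom ▷ H ⊗≫ H ◁ (act ≫ coact) ⊗≫ (β_ H B).hom ▷ H ⊗≫ B ◁ μ[H]

namespace RightCrossedModule

variable {H} {B : 𝒞} (M : RightCrossedModule H B)

/-- The braiding of `B` with itself in the category of right crossed modules. -/
def braid : B ⊗ B ⟶ B ⊗ B :=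
  B ◁ M.coact ⊗≫ (β_ B B).hom ▷ H ⊗≫ B ◁ M.act

/-- `B` is a bialgebra in the category of right crossed modules: it is an algebra and a
coalgebra whose structure morphisms are morphisms of crossed modules (for the diagonal structure
on `B ⊗ B` and the trivial one on the unit object), and the bialgebra axioms hold with respect to
the braiding of the category of crossed modules. -/
structure IsBialgebra [MonObj B] [ComonObj B] : Prop where
  mul_act : μ[B] ▷ H ≫ M.act = diagActR M.act M.act ≫ μ[B]
  mul_coact : μ[B] ≫ M.coact = diagCoactR M.coact M.coact ≫ μ[B] ▷ H
  one_act : η[B] ▷ H ≫ M.act = (λ_ H).hom ≫ ε[H] ≫ η[B]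
  one_coact : η[B] ≫ M.coact = (λ_ (𝟙_ 𝒞)).inv ≫ (η[B] ⊗ₘ η[H])
  act_comul : M.act ≫ Δ[B] = Δ[B] ▷ H ≫ diagActR M.act M.act
  coact_comul : M.coact ≫ Δ[B] ▷ H = Δ[B] ≫ diagCoactR M.coact M.coact
  act_counit : M.act ≫ ε[B] = (ε[B] ⊗ₘ ε[H]) ≫ (λ_ (𝟙_ 𝒞)).hom
  coact_counit : M.coact ≫ ε[B] ▷ H = ε[B] ≫ η[H] ≫ (λ_ H).inv
  one_counit : η[B] ≫ ε[B] = 𝟙 (𝟙_ 𝒞)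
  mul_counit : μ[B] ≫ ε[B] = (ε[B] ⊗ₘ ε[B]) ≫ (λ_ (𝟙_ 𝒞)).hom
  one_comul : η[B] ≫ Δ[B] = (λ_ (𝟙_ 𝒞)).inv ≫ (η[B] ⊗ₘ η[B])
  mul_comul : μ[B] ≫ Δ[B] = (Δ[B] ⊗ₘ Δ[B]) ⊗≫ B ◁ (M.braid ▷ B) ⊗≫ (μ[B] ⊗ₘ μ[B])

end RightCrossedModule

/-- A left crossed module (Yetter–Drinfeld module) over `H` on the object `C`. -/
structure LeftCrossedModule (C : 𝒞) where
  act : H ⊗ C ⟶ C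
  coact : C ⟶ H ⊗ C
  one_act : η[H] ▷ C ≫ act = (λ_ C).hom
  mul_act : μ[H] ▷ C ≫ act = (α_ H H C).hom ≫ H ◁ act ≫ act
  coact_counit : coact ≫ ε[H] ▷ C = (λ_ C).inv
  coact_comul : coact ≫ Δ[H] ▷ C = coact ≫ H ◁ coact ≫ (α_ H H C).inv
  crossed :
    (Δ[H] ⊗ₘ coact) ⊗≫ H ◁ ((β_ H H).hom ▷ C) ⊗≫ (μ[H] ⊗ₘ act)
      = Δ[H] ▷ C ⊗≫ H ◁ (β_ H C).hom ⊗≫ (act ≫ coact) ▷ H ⊗≫ H ◁ (β_ C H).hom ⊗≫ μ[H] ▷ C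

namespace LeftCrossedModule

variable {H} {C : 𝒞} (N : LeftCrossedModule H C)

/-- The braiding of `C` with itself in the category of left crossed modules. -/
def braid : C ⊗ C ⟶ C ⊗ C :=
  N.coact ▷ C ⊗≫ H ◁ (β_ C C).hom ⊗≫ N.act ▷ C

/-- `C` is a bialgebra in the category of left crossed modules. -/
structure IsBialgebra [MonObj C] [ComonObj C] : Prop where
  act_mul : H ◁ μ[C] ≫ N.act = diagActL N.act N.act ≫ μ[C]
  mul_coact : μ[C] ≫ N.coact = diagCoactL N.coact N.coact ≫ H ◁ μ[C]
  act_one : H ◁ η[C] ≫ N.act = (ρ_ H).hom ≫ ε[H] ≫ η[C]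
  one_coact : η[C] ≫ N.coact = (λ_ (𝟙_ 𝒞)).inv ≫ (η[H] ⊗ₘ η[C])
  act_comul : N.act ≫ Δ[C] = H ◁ Δ[C] ≫ diagActL N.act N.act
  coact_comul : N.coact ≫ H ◁ Δ[C] = Δ[C] ≫ diagCoactL N.coact N.coact
  act_counit : N.act ≫ ε[C] = (ε[H] ⊗ₘ ε[C]) ≫ (λ_ (𝟙_ 𝒞)).hom
  coact_counit : N.coact ≫ H ◁ ε[C] = ε[C] ≫ η[H] ≫ (ρ_ H).inv
  one_counit : η[C] ≫ ε[C] = 𝟙 (𝟙_ 𝒞)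
  mul_counit : μ[C] ≫ ε[C] = (ε[C] ⊗ₘ ε[C]) ≫ (λ_ (𝟙_ 𝒞)).hom
  one_comul : η[C] ≫ Δ[C] = (λ_ (𝟙_ 𝒞)).inv ≫ (η[C] ⊗ₘ η[C])
  mul_comul : μ[C] ≫ Δ[C] = (Δ[C] ⊗ₘ Δ[C]) ⊗≫ C ◁ (N.braid ▷ C) ⊗≫ (μ[C] ⊗ₘ μ[C])

end LeftCrossedModule

/-! ### Hopf bimodules -/

/-- An object with two-sided actions and coactions of `H` (no axioms). -/
structure HopfBimoduleData where
  pt : 𝒞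
  actL : H ⊗ pt ⟶ pt
  actR : pt ⊗ H ⟶ pt
  coactL : pt ⟶ H ⊗ pt
  coactR : pt ⟶ pt ⊗ H

namespace HopfBimoduleData

variable {H}

/-- The axioms of an `H`-Hopf bimodule: a bimodule and bicomodule whose actions are bicomodule
morphisms for the diagonal coactions. -/
structure IsHopfBimodule (X : HopfBimoduleData H) : Prop where
  one_actL : η[H] ▷ X.pt ≫ X.actL = (λ_ X.pt).hom
  mul_actL : μ[H] ▷ X.pt ≫ X.actL = (α_ H H X.pt).hom ≫ H ◁ X.actL ≫ X.actL
  actR_one : X.pt ◁ η[H] ≫ X.actR = (ρ_ X.pt).hom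
  actR_mul : X.pt ◁ μ[H] ≫ X.actR = (α_ X.pt H H).inv ≫ X.actR ▷ H ≫ X.actR
  actL_actR : X.actL ▷ H ≫ X.actR = (α_ H X.pt H).hom ≫ H ◁ X.actR ≫ X.actL
  coactL_counit : X.coactL ≫ ε[H] ▷ X.pt = (λ_ X.pt).inv
  coactL_comul :
    X.coactL ≫ Δ[H] ▷ X.pt = X.coactL ≫ H ◁ X.coactL ≫ (α_ H H X.pt).inv
  coactR_counit : X.coactR ≫ X.pt ◁ ε[H] = (ρ_ X.pt).inv
  coactR_comul :
    X.coactR ≫ X.pt ◁ Δ[H] = X.coactR ≫ X.coactR ▷ H ≫ (α_ X.pt H H).hom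
  coactL_coactR :
    X.coactL ≫ H ◁ X.coactR = X.coactR ≫ X.coactL ▷ H ≫ (α_ H X.pt H).hom
  actL_coactL : X.actL ≫ X.coactL = diagCoactL Δ[H] X.coactL ≫ H ◁ X.actL
  actL_coactR : X.actL ≫ X.coactR = diagCoactR Δ[H] X.coactR ≫ X.actL ▷ H
  actR_coactL : X.actR ≫ X.coactL = diagCoactL X.coactL Δ[H] ≫ H ◁ X.actR
  actR_coactR : X.actR ≫ X.coactR = diagCoactR X.coactR Δ[H] ≫ X.actR ▷ H

/-- Bimodule-bicomodule morphisms. -/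
structure IsHom (X Y : HopfBimoduleData H) (f : X.pt ⟶ Y.pt) : Prop where
  actL : X.actL ≫ f = H ◁ f ≫ Y.actL
  actR : X.actR ≫ f = f ▷ H ≫ Y.actR
  coactL : f ≫ Y.coactL = X.coactL ≫ H ◁ f
  coactR : f ≫ Y.coactR = X.coactR ≫ f ▷ H

variable (H) in
/-- The canonical Hopf bimodule `H`, the unit object of the category of Hopf bimodules. -/
def unit : HopfBimoduleData H where
  pt := H
  actL := μ[H]
  actR := μ[H]
  coactL := Δ[H]
  coactR := Δ[H]

/-- `X ⊙ Y`: induced actions and diagonal coactions on `X ⊗ Y`. -/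
def odot (X Y : HopfBimoduleData H) : HopfBimoduleData H where
  pt := X.pt ⊗ Y.pt
  actL := (α_ H X.pt Y.pt).inv ≫ X.actL ▷ Y.pt
  actR := (α_ X.pt Y.pt H).hom ≫ X.pt ◁ Y.actR
  coactL := diagCoactL X.coactL Y.coactL
  coactR := diagCoactR X.coactR Y.coactR

/-- `X ⊡ Y`: diagonal actions and induced coactions on `X ⊗ Y`. -/
def boxdot (X Y : HopfBimoduleData H) : HopfBimoduleData H where
  pt := X.pt ⊗ Y.pt
  actL := diagActL X.actL Y.actL
  actR := diagActR X.actR Y.actR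
  coactL := X.coactL ▷ Y.pt ≫ (α_ H X.pt Y.pt).hom
  coactR := X.pt ◁ Y.coactR ≫ (α_ X.pt Y.pt H).inv

/-- The morphism
`(μ_r^X ⊗ μ_l^Y) ∘ (id ⊗ Ψ_{H,H} ⊗ id) ∘ (ν_r^X ⊗ ν_l^Y) : X ⊗ Y ⟶ X ⊗ Y`. -/
def exchange (X Y : HopfBimoduleData H) : X.pt ⊗ Y.pt ⟶ X.pt ⊗ Y.pt :=
  (X.coactR ⊗ₘ Y.coactL) ⊗≫ X.pt ◁ ((β_ H H).hom ▷ Y.pt) ⊗≫ (X.actR ⊗ₘ Y.actL)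

/-- The morphism
`Θ = (μ_l^Y ⊗ μ_r^X) ∘ (id ⊗ Ψ_{X,Y} ⊗ id) ∘ (ν_l^X ⊗ ν_r^Y) : X ⊗ Y ⟶ Y ⊗ X`. -/
def theta (X Y : HopfBimoduleData H) : X.pt ⊗ Y.pt ⟶ Y.pt ⊗ X.pt :=
  (X.coactL ⊗ₘ Y.coactR) ⊗≫ H ◁ ((β_ X.pt Y.pt).hom ▷ H) ⊗≫ (Y.actL ⊗ₘ X.actR)

end HopfBimoduleData

/-! ### The tensor product of Hopf bimodules and the braiding -/

/-- Data for a tensor product `X ⊗_H Y`: an object with morphisms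
`lam : X ⊗ Y ⟶ X ⊗_H Y` and `rho : X ⊗_H Y ⟶ X ⊗ Y`. -/
structure HopfTensor {H : 𝒞} [HopfObj H] (X Y : HopfBimoduleData H) where
  obj : HopfBimoduleData H
  lam : X.pt ⊗ Y.pt ⟶ obj.pt
  rho : obj.pt ⟶ X.pt ⊗ Y.pt

namespace HopfTensor

variable {H}
variable {X Y : HopfBimoduleData H}

/-- `P` is the tensor product of the Hopf bimodules `X` and `Y` in the category of Hopf
bimodules: it is a Hopf bimodule, `lam` exhibits it as the tensor product over `H` of the
underlying modules and is a Hopf bimodule morphism `X ⊙ Y ⟶ X ⊗_H Y`, `rho` exhibits it as the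
cotensor product over `H` of the underlying comodules and is a Hopf bimodule morphism
`X ⊗_H Y ⟶ X ⊡ Y`, and both are related by `exchange`. -/
structure IsTensor (P : HopfTensor X Y) : Prop where
  isHopfBimodule : P.obj.IsHopfBimodule
  balanced : X.actR ▷ Y.pt ≫ P.lam = (α_ X.pt H Y.pt).hom ≫ X.pt ◁ Y.actL ≫ P.lam
  lam_universal : ∀ {V : 𝒞} (f : X.pt ⊗ Y.pt ⟶ V),
    X.actR ▷ Y.pt ≫ f = (α_ X.pt H Y.pt).hom ≫ X.pt ◁ Y.actL ≫ f → ∃! g, P.lam ≫ g = f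
  lam_hom : (X.odot Y).IsHom P.obj P.lam
  cobalanced : P.rho ≫ X.coactR ▷ Y.pt ≫ (α_ X.pt H Y.pt).hom = P.rho ≫ X.pt ◁ Y.coactL
  rho_universal : ∀ {V : 𝒞} (f : V ⟶ X.pt ⊗ Y.pt),
    f ≫ X.coactR ▷ Y.pt ≫ (α_ X.pt H Y.pt).hom = f ≫ X.pt ◁ Y.coactL → ∃! g, g ≫ P.rho = f
  rho_hom : P.obj.IsHom (X.boxdot Y) P.rho
  lam_rho : P.lam ≫ P.rho = X.exchange Y

/-- `ψ : X ⊗_H Y ⟶ Y ⊗_H X` is the braiding of the category of Hopf bimodules, that is, the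
unique morphism with `ρ_{Y,X} ∘ ψ ∘ λ_{X,Y} = Θ_{X,Y}`. -/
def IsBraiding (P : HopfTensor X Y) (Q : HopfTensor Y X) (ψ : P.obj.pt ⟶ Q.obj.pt) : Prop :=
  P.lam ≫ ψ ≫ Q.rho = X.theta Y

/-- `F = f ⊗_H g`. -/
def IsTensorHom {X' Y' : HopfBimoduleData H} (P : HopfTensor X Y) (P' : HopfTensor X' Y')
    (f : X.pt ⟶ X'.pt) (g : Y.pt ⟶ Y'.pt) (F : P.obj.pt ⟶ P'.obj.pt) : Prop :=
  P.lam ≫ F = (f ⊗ₘ g) ≫ P'.lam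

/-- `τ = id_X ⊗_H ψ ⊗_H id_{Y'}`, regarded (through the associativity isomorphisms of `⊗_H`) as a
morphism `(X ⊗_H Y) ⊗_H (X' ⊗_H Y') ⟶ (X ⊗_H X') ⊗_H (Y ⊗_H Y')`, where
`ψ : Y ⊗_H X' ⟶ X' ⊗_H Y`. Here `n` is the canonical morphism
`X ⊗ (X' ⊗_H Y) ⊗ Y' ⟶ (X ⊗_H X') ⊗_H (Y ⊗_H Y')`. -/
def IsMiddle {X' Y' : HopfBimoduleData H}
    {XY : HopfTensor X Y} {X'Y' : HopfTensor X' Y'} (S : HopfTensor XY.obj X'Y'.obj)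
    {YX' : HopfTensor Y X'} {X'Y : HopfTensor X' Y} (ψ : YX'.obj.pt ⟶ X'Y.obj.pt)
    {XX' : HopfTensor X X'} {YY' : HopfTensor Y Y'} (T : HopfTensor XX'.obj YY'.obj)
    (τ : S.obj.pt ⟶ T.obj.pt) : Prop :=
  ∃ n : X.pt ⊗ (X'Y.obj.pt ⊗ Y'.pt) ⟶ T.obj.pt,
    X.pt ◁ (X'Y.lam ▷ Y'.pt) ≫ n
      = 𝟙 (X.pt ⊗ ((X'.pt ⊗ Y.pt) ⊗ Y'.pt)) ⊗≫ (XX'.lam ⊗ₘ YY'.lam) ≫ T.lam ∧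
    (XY.lam ⊗ₘ X'Y'.lam) ≫ S.lam ≫ τ
      = 𝟙 ((X.pt ⊗ Y.pt) ⊗ (X'.pt ⊗ Y'.pt)) ⊗≫ X.pt ◁ ((YX'.lam ≫ ψ) ▷ Y'.pt) ≫ n

end HopfTensor

/-- The braiding of the category of Hopf bimodules is involutive on `X` and `Y`:
`Ψ_{X,Y} ∘ Ψ_{Y,X} = id_{Y ⊗_H X}` (tensor products and braidings are unique up to
unique isomorphism). -/
def BraidingInvolutive {H : 𝒞} [HopfObj H] (X Y : HopfBimoduleData H) : Prop :=
  ∀ (P : HopfTensor X Y) (Q : HopfTensor Y X)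
    (ψ : P.obj.pt ⟶ Q.obj.pt) (ψ' : Q.obj.pt ⟶ P.obj.pt),
    P.IsTensor → Q.IsTensor → P.IsBraiding Q ψ → Q.IsBraiding P ψ' → ψ' ≫ ψ = 𝟙 Q.obj.pt

/-! ### Bialgebras in the category of Hopf bimodules -/

/-- Candidate structure morphisms of a bialgebra in the category of Hopf bimodules on the object
`Z`, where `P` is the tensor product `Z ⊗_H Z`. -/
structure HopfBialgData {H : 𝒞} [HopfObj H] {Z : HopfBimoduleData H} (P : HopfTensor Z Z) where
  mul : P.obj.pt ⟶ Z.pt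
  one : H ⟶ Z.pt
  comul : Z.pt ⟶ P.obj.pt
  counit : Z.pt ⟶ H

namespace HopfBialgData

variable {H}
variable {Z : HopfBimoduleData H} {P : HopfTensor Z Z}

/-- The associated structure morphisms in `𝒞`:
`m = m̲ ∘ λ`, `η = η̲ ∘ η_H`, `Δ = ρ ∘ Δ̲`, `ε = ε_H ∘ ε̲`. -/
def toBialgData (b : HopfBialgData P) : BialgData Z.pt where
  mul := P.lam ≫ b.mul
  one := η[H] ≫ b.one
  comul := b.comul ≫ P.rho
  counit := b.counit ≫ ε[H]

/-- The axioms of a bialgebra in the braided monoidal category of Hopf bimodules.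
The (co)algebra axioms are equations between morphisms out of iterated tensor products over `H`
(into iterated cotensor products over `H`) and are written after composition with the canonical
epimorphisms `λ` (monomorphisms `ρ`); the unit isomorphisms `H ⊗_H Z ≅ Z ≅ Z ⊗_H H` are
induced by the actions, their inverses by the coactions. -/
structure IsBialgebra (b : HopfBialgData P) : Prop where
  mul_hom : P.obj.IsHom Z b.mul
  one_hom : (HopfBimoduleData.unit H).IsHom Z b.one
  comul_hom : Z.IsHom P.obj b.comul
  counit_hom : Z.IsHom (HopfBimoduleData.unit H) b.counit
  mul_assoc :
    (P.lam ≫ b.mul) ▷ Z.pt ≫ P.lam ≫ b.mul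
      = (α_ Z.pt Z.pt Z.pt).hom ≫ Z.pt ◁ (P.lam ≫ b.mul) ≫ P.lam ≫ b.mul
  one_mul : b.one ▷ Z.pt ≫ P.lam ≫ b.mul = Z.actL
  mul_one : Z.pt ◁ b.one ≫ P.lam ≫ b.mul = Z.actR
  comul_assoc :
    (b.comul ≫ P.rho) ≫ (b.comul ≫ P.rho) ▷ Z.pt ≫ (α_ Z.pt Z.pt Z.pt).hom
      = (b.comul ≫ P.rho) ≫ Z.pt ◁ (b.comul ≫ P.rho)
  counit_comul : (b.comul ≫ P.rho) ≫ b.counit ▷ Z.pt = Z.coactL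
  comul_counit : (b.comul ≫ P.rho) ≫ Z.pt ◁ b.counit = Z.coactR
  one_counit : b.one ≫ b.counit = 𝟙 H
  mul_counit : P.lam ≫ b.mul ≫ b.counit = (b.counit ⊗ₘ b.counit) ≫ μ[H]
  one_comul : b.one ≫ b.comul ≫ P.rho = Δ[H] ≫ (b.one ⊗ₘ b.one)
  /-- `Δ̲ ∘ m̲ = (m̲ ⊗_H m̲) ∘ (id ⊗_H Ψ_{Z,Z} ⊗_H id) ∘ (Δ̲ ⊗_H Δ̲)`. -/
  mul_comul : ∃ (PP : HopfTensor P.obj P.obj) (ψ : P.obj.pt ⟶ P.obj.pt)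
    (dd : P.obj.pt ⟶ PP.obj.pt) (τ : PP.obj.pt ⟶ PP.obj.pt) (mm : PP.obj.pt ⟶ P.obj.pt),
    PP.IsTensor ∧ P.IsBraiding P ψ ∧ P.IsTensorHom PP b.comul b.comul dd ∧
    HopfTensor.IsMiddle (XY := P) (X'Y' := P) PP (YX' := P) (X'Y := P) ψ
      (XX' := P) (YY' := P) PP τ ∧
    PP.IsTensorHom P b.mul b.mul mm ∧
    b.mul ≫ b.comul = dd ≫ τ ≫ mm

/-- `bZ` is the tensor product of the bialgebras `bY` and `bX` of the category of Hopf
bimodules, on the object `Q = Y ⊗_H X`: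
`m̲ = (m̲_Y ⊗_H m̲_X) ∘ (id_Y ⊗_H Ψ_{X,Y} ⊗_H id_X)`,
`Δ̲ = (id_Y ⊗_H Ψ_{Y,X} ⊗_H id_X) ∘ (Δ̲_Y ⊗_H Δ̲_X)`, and the unit and counit are
`η̲_Y ⊗_H η̲_X` and `ε̲_Y ⊗_H ε̲_X` up to `H ⊗_H H ≅ H`. -/
def IsTensorProduct {X Y : HopfBimoduleData H} {PX : HopfTensor X X} {PY : HopfTensor Y Y}
    {Q : HopfTensor Y X} {PZ : HopfTensor Q.obj Q.obj}
    (bY : HopfBialgData PY) (bX : HopfBialgData PX) (bZ : HopfBialgData PZ) : Prop :=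
  (∃ (P : HopfTensor X Y) (ψ : P.obj.pt ⟶ Q.obj.pt) (ψ' : Q.obj.pt ⟶ P.obj.pt)
    (R : HopfTensor PY.obj PX.obj)
    (τ : PZ.obj.pt ⟶ R.obj.pt) (mm : R.obj.pt ⟶ Q.obj.pt)
    (dd : Q.obj.pt ⟶ R.obj.pt) (τ' : R.obj.pt ⟶ PZ.obj.pt),
    P.IsTensor ∧ P.IsBraiding Q ψ ∧ Q.IsBraiding P ψ' ∧ R.IsTensor ∧
    HopfTensor.IsMiddle (XY := Q) (X'Y' := Q) PZ (YX' := P) (X'Y := Q) ψ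
      (XX' := PY) (YY' := PX) R τ ∧
    R.IsTensorHom Q bY.mul bX.mul mm ∧
    bZ.mul = τ ≫ mm ∧
    Q.IsTensorHom R bY.comul bX.comul dd ∧
    HopfTensor.IsMiddle (XY := PY) (X'Y' := PX) R (YX' := Q) (X'Y := P) ψ'
      (XX' := Q) (YY' := Q) PZ τ' ∧
    bZ.comul = dd ≫ τ') ∧
  μ[H] ≫ bZ.one = (bY.one ⊗ₘ bX.one) ≫ Q.lam ∧
  bZ.counit ≫ Δ[H] = Q.rho ≫ (bY.counit ⊗ₘ bX.counit)

end HopfBialgData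

/-! ### The Hopf bimodules `H ⋉ B` and `C ⋊ H` and their biproduct structures -/

namespace RightCrossedModule

variable {H} {B : 𝒞} (M : RightCrossedModule H B)

/-- The Hopf bimodule `H ⋉ B`: induced left and diagonal right (co)actions on `H ⊗ B`. -/
def hopfBimodule : HopfBimoduleData H where
  pt := H ⊗ B
  actL := (α_ H H B).inv ≫ μ[H] ▷ B
  actR := diagActR μ[H] M.act
  coactL := Δ[H] ▷ B ≫ (α_ H H B).hom
  coactR := diagCoactR Δ[H] M.coact

/-- The biproduct (bosonization) structure morphisms on `H ⊗ B`. -/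
def biproduct [MonObj B] [ComonObj B] : BialgData (H ⊗ B) where
  mul := (H ⊗ B) ◁ (Δ[H] ▷ B) ⊗≫ H ◁ ((β_ B H).hom ▷ (H ⊗ B)) ⊗≫
    (μ[H] ⊗ₘ (M.act ▷ B)) ≫ H ◁ μ[B]
  one := (λ_ (𝟙_ 𝒞)).inv ≫ (η[H] ⊗ₘ η[B])
  comul := H ◁ Δ[B] ≫ (Δ[H] ⊗ₘ (M.coact ▷ B)) ⊗≫ H ◁ ((β_ H B).hom ▷ (H ⊗ B)) ⊗≫
    (H ⊗ B) ◁ (μ[H] ▷ B)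
  counit := (ε[H] ⊗ₘ ε[B]) ≫ (λ_ (𝟙_ 𝒞)).hom

end RightCrossedModule

namespace LeftCrossedModule

variable {H} {C : 𝒞} (N : LeftCrossedModule H C)

/-- The Hopf bimodule `C ⋊ H`: diagonal left and induced right (co)actions on `C ⊗ H`. -/
def hopfBimodule : HopfBimoduleData H where
  pt := C ⊗ H
  actL := diagActL N.act μ[H]
  actR := (α_ C H H).hom ≫ C ◁ μ[H]
  coactL := diagCoactL N.coact Δ[H]
  coactR := C ◁ Δ[H] ≫ (α_ C H H).inv

/-- The biproduct (bosonization) structure morphisms on `C ⊗ H`. -/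
def biproduct [MonObj C] [ComonObj C] : BialgData (C ⊗ H) where
  mul := (C ◁ Δ[H]) ▷ (C ⊗ H) ⊗≫ (C ⊗ H) ◁ ((β_ H C).hom ▷ H) ⊗≫
    ((C ◁ N.act) ⊗ₘ μ[H]) ≫ μ[C] ▷ H
  one := (λ_ (𝟙_ 𝒞)).inv ≫ (η[C] ⊗ₘ η[H])
  comul := Δ[C] ▷ H ≫ ((C ◁ N.coact) ⊗ₘ Δ[H]) ⊗≫ (C ⊗ H) ◁ ((β_ C H).hom ▷ H) ⊗≫
    (C ◁ μ[H]) ▷ (C ⊗ H)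
  counit := (ε[C] ⊗ₘ ε[H]) ≫ (λ_ (𝟙_ 𝒞)).hom

end LeftCrossedModule

/-! ### The object `C ⊗ H ⊗ B` -/

section Double

variable {H} {B C : 𝒞} (M : RightCrossedModule H B) (N : LeftCrossedModule H C)

/-- The tensor product `(C ⋊ H) ⊗_H (H ⋉ B)`, realized on the object `C ⊗ H ⊗ B` with
`λ = id_C ⊗ m_H ⊗ id_B` and `ρ = id_C ⊗ Δ_H ⊗ id_B`; the left (co)action is diagonal on `C ⊗ H`,
the right one is diagonal on `H ⊗ B`. -/
def doubleTensor : HopfTensor N.hopfBimodule M.hopfBimodule where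
  obj :=
    { pt := C ⊗ (H ⊗ B)
      actL := diagActL N.act M.hopfBimodule.actL
      actR := (α_ C (H ⊗ B) H).hom ≫ C ◁ M.hopfBimodule.actR
      coactL := diagCoactL N.coact M.hopfBimodule.coactL
      coactR := C ◁ M.hopfBimodule.coactR ≫ (α_ C (H ⊗ B) H).inv }
  lam := 𝟙 ((C ⊗ H) ⊗ (H ⊗ B)) ⊗≫ C ◁ (μ[H] ▷ B)
  rho := C ◁ (Δ[H] ▷ B) ⊗≫ 𝟙 ((C ⊗ H) ⊗ (H ⊗ B))

variable [MonObj B] [ComonObj B] [MonObj C] [ComonObj C]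

/-- The explicit structure morphisms on `C ⊗ H ⊗ B`. In Sweedler notation (suppressing the
braidings) the multiplication is
`(c h b)(c' h' b') = c (h₁ ▹ c') ⊗ h₂ h'₁ ⊗ (b ◃ h'₂) b'` and the comultiplication is
`c h b ↦ (c₁ ⊗ c₂₍₋₁₎ h₁ ⊗ b₁₍₀₎) ⊗ (c₂₍₀₎ ⊗ h₂ b₁₍₁₎ ⊗ b₂)`. -/
def doubleBialgData : BialgData (C ⊗ (H ⊗ B)) where
  mul :=
    ((C ◁ (Δ[H] ▷ B)) ⊗ₘ (C ◁ (Δ[H] ▷ B))) ⊗≫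
    (C ⊗ H ⊗ H) ◁ ((β_ B C).hom ▷ (H ⊗ H ⊗ B)) ⊗≫
    (C ⊗ H) ◁ (((β_ H C).hom ⊗ₘ (β_ B H).hom) ▷ (H ⊗ B)) ⊗≫
    ((C ◁ N.act) ⊗ₘ (μ[H] ⊗ₘ (M.act ▷ B))) ≫
    (μ[C] ⊗ₘ (H ◁ μ[B]))
  one := (λ_ (𝟙_ 𝒞)).inv ≫ (η[C] ⊗ₘ ((λ_ (𝟙_ 𝒞)).inv ≫ (η[H] ⊗ₘ η[B])))
  comul :=
    (Δ[C] ⊗ₘ (H ◁ Δ[B])) ≫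
    ((C ◁ N.coact) ⊗ₘ (Δ[H] ⊗ₘ (M.coact ▷ B))) ⊗≫
    (C ⊗ H) ◁ (((β_ C H).hom ⊗ₘ (β_ H B).hom) ▷ (H ⊗ B)) ⊗≫
    ((C ◁ μ[H]) ⊗ₘ ((β_ C B).hom ⊗ₘ (μ[H] ▷ B))) ⊗≫
    𝟙 ((C ⊗ (H ⊗ B)) ⊗ (C ⊗ (H ⊗ B)))
  counit := (ε[C] ⊗ₘ ((ε[H] ⊗ₘ ε[B]) ≫ (λ_ (𝟙_ 𝒞)).hom)) ≫ (λ_ (𝟙_ 𝒞)).hom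

/-! ### Pairings -/

/-- `ρ⁽²⁾ = ρ ∘ (id_B ⊗ ρ ⊗ id_C)`. -/
def pairingTwo (ρ : B ⊗ C ⟶ 𝟙_ 𝒞) : (B ⊗ B) ⊗ (C ⊗ C) ⟶ 𝟙_ 𝒞 :=
  𝟙 ((B ⊗ B) ⊗ (C ⊗ C)) ⊗≫ B ◁ (ρ ▷ C) ⊗≫ ρ

/-- The identities imposed on the pairing `ρ : B ⊗ C ⟶ 𝟙`. -/
structure IsCompatiblePairing (ρ : B ⊗ C ⟶ 𝟙_ 𝒞) : Prop where
  act : M.act ▷ C ≫ ρ = (α_ B H C).hom ≫ B ◁ N.act ≫ ρ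
  mul_right : B ◁ μ[C] ≫ ρ = (Δ[B] ≫ (β_ B B).inv) ▷ (C ⊗ C) ≫ pairingTwo ρ
  mul_left : μ[B] ▷ C ≫ ρ = (M.braid ⊗ₘ (Δ[C] ≫ (β_ C C).inv)) ≫ pairingTwo ρ

/-- `ρ` is compatible with the units: `ρ ∘ (η_B ⊗ id) = ε_C` and `ρ ∘ (id ⊗ η_C) = ε_B`. -/
def IsUnitalPairing (ρ : B ⊗ C ⟶ 𝟙_ 𝒞) : Prop :=
  η[B] ▷ C ≫ ρ = (λ_ C).hom ≫ ε[C] ∧ B ◁ η[C] ≫ ρ = (ρ_ B).hom ≫ ε[B]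

variable (H) in
/-- `ρ̂ = ε_C ⊗ ε_H ⊗ ρ ⊗ ε_H ⊗ ε_B` on `(C ⊗ H ⊗ B) ⊗ (C ⊗ H ⊗ B)`. -/
def hatPairing (ρ : B ⊗ C ⟶ 𝟙_ 𝒞) : (C ⊗ (H ⊗ B)) ⊗ (C ⊗ (H ⊗ B)) ⟶ 𝟙_ 𝒞 :=
  ((ε[C] ⊗ₘ (ε[H] ▷ B)) ⊗ₘ (C ◁ (ε[H] ⊗ₘ ε[B]))) ⊗≫ ρ

/-- The explicit multiplication of the double biproduct, a transcription of its string diagram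
row by row. In Sweedler notation (suppressing the braidings), `(c h b)(c' h' b')` is
`ρ(b₁₍₀₎, c'₁) c (h₁ ▹ (b₁₍₁₎ ▹ c'₂)) ⊗ h₂ b₁₍₂₎ c'₃₍₋₂₎ h'₁ ⊗ ((b₂ ◃ c'₃₍₋₁₎) ◃ h'₂) b' ρ⁻(b₃, c'₃₍₀₎)`. -/
def doubleBiproductMul (ρ ρ' : B ⊗ C ⟶ 𝟙_ 𝒞) :
    (C ⊗ (H ⊗ B)) ⊗ (C ⊗ (H ⊗ B)) ⟶ C ⊗ (H ⊗ B) :=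
  ((C ◁ (Δ[H] ⊗ₘ Δ[B])) ⊗ₘ (Δ[C] ⊗ₘ (Δ[H] ▷ B))) ⊗≫
  (C ⊗ H ⊗ H ⊗ B) ◁ ((β_ B C).hom ▷ (C ⊗ H ⊗ H ⊗ B)) ⊗≫
  (C ⊗ H ⊗ H) ◁ (((M.coact ⊗ₘ Δ[C]) ⊗ₘ (Δ[B] ⊗ₘ N.coact)) ▷ (H ⊗ H ⊗ B)) ⊗≫
  (C ⊗ H ⊗ H ⊗ B) ◁ ((((β_ H C).hom ▷ C) ⊗ₘ (B ◁ (β_ B H).hom)) ▷ (C ⊗ H ⊗ H ⊗ B)) ⊗≫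
  (C ⊗ H ⊗ H) ◁ (((ρ ⊗ₘ (Δ[H] ▷ C)) ⊗ₘ ((B ◁ Δ[H]) ⊗ₘ ρ')) ▷ (H ⊗ H ⊗ B)) ⊗≫
  (C ⊗ H ⊗ H ⊗ H) ◁ (((β_ H C).hom ⊗ₘ (β_ B H).hom) ▷ (H ⊗ H ⊗ H ⊗ B)) ⊗≫
  (C ⊗ H ⊗ H) ◁ ((N.act ⊗ₘ (μ[H] ⊗ₘ M.act)) ▷ (H ⊗ H ⊗ B)) ⊗≫
  (C ⊗ H) ◁ (((β_ H C).hom ⊗ₘ (H ◁ (β_ B H).hom)) ▷ (H ⊗ B)) ⊗≫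
  ((C ◁ N.act) ⊗ₘ ((μ[H] ▷ H) ⊗ₘ (M.act ▷ B))) ≫
  (μ[C] ⊗ₘ (μ[H] ⊗ₘ μ[B]))

end Double

end CrossProd

/-!
The statement is about string diagrams over `H`, `B` and `C`, apart from the parts on tensor
products over `H`, which are reduced to string diagrams. Comments describe morphisms in Sweedler
notation, and suppress braidings.

*String diagrams.* Equations between composites of structure morphisms are proved by reflection. A
formal expression `Tm` is compiled to a list of boxes, each with the number of strands to its left,
and `Model.run_compile` says that the list denotes the same morphism as the expression. Axioms are
used as rewriting rules for such lists, up to interchange of boxes and naturality of the braiding. A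
proof of an equation is a script of rewriting steps; `Rule.check` replays it and compares the
results, and `Model.holds_of_check` turns a successful check, which the kernel evaluates, into an
equation in `𝒞`. There are separate calculi for `H`, `B`, `C` and pairings (`DblOp`), for Hopf
bimodules (`HbOp`), for bialgebras with a projection to `H` (`ProjOp`), and for a bialgebra with two
pairings (`TwistOp`).

*Tensor products over `H`.* The tensor product and the cotensor product of Hopf bimodules `X`, `Y`
are the images of the idempotents `x ⊗ y ↦ x₍₀₎ S(x₍₁₎) ⊗ x₍₂₎ y` and
`x ⊗ y ↦ x₍₀₎ S(x₍₁₎) y₍₋₁₎ ⊗ y₍₀₎`. The exchange `ρ ∘ λ` identifies these images, so that tensor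
products exist where idempotents split (`HopfTensor.exists_isTensor`), and every balanced and
cobalanced morphism descends to them, for instance the one that defines the braiding. The morphism
`id ⊗_H ψ ⊗_H id` for a braiding `ψ` comes from the interchange of the middle factors in `𝒞`
(`HopfTensor.exists_isMiddle`). Therefore a bialgebra `Z` in `𝒞` with morphisms of bialgebras
`i : H ⟶ Z`, `p : Z ⟶ H` such that `p ∘ i = id` is a bialgebra in the category of Hopf bimodules
(`IsBialgebraOver.exists_isBialgebra`), and tensor products of such bialgebras can be recognized in
`𝒞` (`HopfBialgData.isTensorProduct`). This applies to `X = H ⋉ B`, `Y = C ⋊ H` and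
`Z = C ⊗ H ⊗ B`.

*The hypothesis on the braidings.* All axioms of a bialgebra on `C ⊗ H ⊗ B` follow from those of `B`
and `C`, except the compatibility of multiplication and comultiplication. That one holds if the
double braiding of `B` and `C` is `b ⊗ c ↦ b₍₀₎ ◃ c₍₋₁₎ ⊗ b₍₁₎ ▹ c₍₀₎` (`double_isBialgebra`). By
means of the inverse of the antipode, the braiding `X ⊗_H Y ⟶ Y ⊗_H X` has an explicit left inverse.
If the other braiding is a right inverse, then it is equal to the explicit one, hence the exchange
of `X` and `Y` is the composite of the morphisms that induce the braidings, and this is the required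
equation on `(1 ⊗ b) ⊗ (c ⊗ 1)` (`commute_of_braidingInvolutive`).

*Twisting.* The cocycle identity for the pairing on `Z` that is induced by `ρ` is a computation with
string diagrams. If `ρ` is invertible for the convolution product, then its restrictions `ρ(1, -)`
and `ρ(-, 1)` are invertible, and idempotent because of the compatibility with the multiplications;
hence they are the counits (`isUnitalPairing_of_isConvInverse`). The twist of a bialgebra by an
invertible two-cocycle `χ` is a bialgebra (`twist_isBialgebra`): the two bracketings of a threefold
product are `F * m * F'` and `G * m * G'` for the two sides `F = G` of the cocycle identity and
their convolution inverses. The explicit multiplication is again a computation (`twist_mul`).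
-/

/-! ### Formal morphisms and their string diagrams -/

namespace CrossProd
namespace Diagram

set_option linter.unusedSectionVars false

universe v u

/-- Formal tensor products of colours; the colours are natural numbers. -/
inductive Ob
  | one
  | of (a : ℕ)
  | tensor (X Y : Ob)

/-- A type of formal generating morphisms, with their sources and targets. -/
class Signature (G : Type) where
  dom : G → Ob
  cod : G → Ob

/-- The boxes of a string diagram: generating morphisms, and crossings `a ⊗ b ⟶ b ⊗ a` which are
positive (the braiding of `a` and `b`) or negative (the inverse of the braiding of `b` and `a`). -/
inductive Gen (G : Type)
  | op (g : G)
  | cr (s : Bool) (a b : ℕ)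
  deriving DecidableEq

/-- A box together with the number of strands to its left. -/
abbrev Layer (G : Type) := ℕ × Gen G

namespace Ob

/-- The number of colours in a formal tensor product. -/
@[reducible] def len : Ob → ℕ
  | one => 0
  | of _ => 1
  | tensor X Y => X.len + Y.len

/-- The list of colours of `X`, followed by `s`. -/
@[reducible] def flat : Ob → List ℕ → List ℕ
  | one, s => s
  | of a, s => a :: s
  | tensor X Y, s => X.flat (Y.flat s)

lemma drop_flat (X : Ob) (s : List ℕ) : (X.flat s).drop X.len = s := by
  induction X generalizing s with
  | one => rfl
  | of a => rfl
  | tensor X Y hX hY => rw [flat, len, ← List.drop_drop, hX, hY]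

end Ob

variable {G : Type} [Signature G]

namespace Gen

/-- The strands that enter a box. -/
@[reducible] def dom : Gen G → Ob
  | op g => Signature.dom g
  | cr _ a b => .tensor (.of a) (.of b)

/-- The strands that leave a box. -/
@[reducible] def cod : Gen G → Ob
  | op g => Signature.cod g
  | cr _ a b => .tensor (.of b) (.of a)

end Gen

/-- Formal expressions for morphisms of a braided monoidal category. -/
inductive Tm (G : Type) [Signature G] : Ob → Ob → Type
  | id (X : Ob) : Tm G X X
  | comp {X Y Z : Ob} (f : Tm G X Y) (g : Tm G Y Z) : Tm G X Z
  | whiskerL (X : Ob) {Y Z : Ob} (f : Tm G Y Z) : Tm G (.tensor X Y) (.tensor X Z)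
  | whiskerR {Y Z : Ob} (f : Tm G Y Z) (X : Ob) : Tm G (.tensor Y X) (.tensor Z X)
  | tens {X Y X' Y' : Ob} (f : Tm G X Y) (g : Tm G X' Y') : Tm G (.tensor X X') (.tensor Y Y')
  | assoc (X Y Z : Ob) : Tm G (.tensor (.tensor X Y) Z) (.tensor X (.tensor Y Z))
  | assocInv (X Y Z : Ob) : Tm G (.tensor X (.tensor Y Z)) (.tensor (.tensor X Y) Z)
  | left (X : Ob) : Tm G (.tensor .one X) X
  | leftInv (X : Ob) : Tm G X (.tensor .one X)
  | right (X : Ob) : Tm G (.tensor X .one) X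
  | rightInv (X : Ob) : Tm G X (.tensor X .one)
  | braid (X Y : Ob) : Tm G (.tensor X Y) (.tensor Y X)
  | braidInv (X Y : Ob) : Tm G (.tensor Y X) (.tensor X Y)
  | gen (g : Gen G) : Tm G g.dom g.cod

/-- The crossings that take the strand `a` in position `p` over or under the strands `Y` to its
right. -/
def strand (s : Bool) (a : ℕ) : Ob → ℕ → List (Layer G)
  | .one, _ => []
  | .of b, p => [(p, .cr s a b)]
  | .tensor Y₁ Y₂, p => strand s a Y₁ p ++ strand s a Y₂ (p + Y₁.len)

/-- The crossings that take the strands `X`, the first of which is in position `p`, over or under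
the strands `Y` to their right. -/
def block (s : Bool) : Ob → Ob → ℕ → List (Layer G)
  | .one, _, _ => []
  | .of a, Y, p => strand s a Y p
  | .tensor X₁ X₂, Y, p => block s X₂ Y (p + X₁.len) ++ block s X₁ Y p

/-- The string diagram of an expression, drawn to the right of `p` strands. -/
def Tm.compile : {X Y : Ob} → Tm G X Y → ℕ → List (Layer G)
  | _, _, .id _, _ => []
  | _, _, .comp f g, p => f.compile p ++ g.compile p
  | _, _, .whiskerL X f, p => f.compile (p + X.len)
  | _, _, .whiskerR f _, p => f.compile p
  | _, _, @Tm.tens _ _ _ Y _ _ f g, p => f.compile p ++ g.compile (p + Y.len)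
  | _, _, .assoc _ _ _, _ => []
  | _, _, .assocInv _ _ _, _ => []
  | _, _, .left _, _ => []
  | _, _, .leftInv _, _ => []
  | _, _, .right _, _ => []
  | _, _, .rightInv _, _ => []
  | _, _, .braid X Y, p => block true X Y p
  | _, _, .braidInv X Y, p => block false Y X p
  | _, _, .gen g, p => [(p, g)]

/-- The diagram `d` with `n` additional strands on its left. -/
def shift (n : ℕ) (d : List (Layer G)) : List (Layer G) := d.map fun x => (x.1 + n, x.2)

@[simp] lemma shift_nil (n : ℕ) : shift n ([] : List (Layer G)) = [] := rfl
@[simp] lemma shift_cons (n p : ℕ) (g : Gen G) (d : List (Layer G)) :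
    shift n ((p, g) :: d) = (p + n, g) :: shift n d := rfl
@[simp] lemma shift_append (n : ℕ) (d e : List (Layer G)) :
    shift n (d ++ e) = shift n d ++ shift n e := by simp [shift]
lemma shift_zero (d : List (Layer G)) : shift 0 d = d := by simp [shift]
lemma shift_shift (m n : ℕ) (d : List (Layer G)) : shift m (shift n d) = shift (n + m) d := by
  simp [shift, Nat.add_assoc]

lemma shift_strand (s : Bool) (a : ℕ) (Y : Ob) (p n : ℕ) :
    shift n (strand s a Y p : List (Layer G)) = strand s a Y (p + n) := by
  induction Y generalizing p with
  | one => simp [strand]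
  | of b => simp [strand]
  | tensor Y₁ Y₂ h₁ h₂ => simp [strand, h₁, h₂, Nat.add_right_comm]

lemma shift_block (s : Bool) (X Y : Ob) (p n : ℕ) :
    shift n (block s X Y p : List (Layer G)) = block s X Y (p + n) := by
  induction X generalizing p with
  | one => simp [block]
  | of a => simp [block, shift_strand]
  | tensor X₁ X₂ h₁ h₂ => simp [block, h₁, h₂, Nat.add_right_comm]

lemma Tm.shift_compile {X Y : Ob} (f : Tm G X Y) (p n : ℕ) :
    shift n (f.compile p) = f.compile (p + n) := by
  induction f generalizing p with
  | comp f g hf hg => simp [Tm.compile, hf, hg]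
  | whiskerL X f hf => rw [Tm.compile, hf, Tm.compile, Nat.add_right_comm]
  | whiskerR f X hf => rw [Tm.compile, hf, Tm.compile]
  | tens f g hf hg => simp only [Tm.compile, shift_append, hf, hg]; rw [Nat.add_right_comm]
  | braid X Y => exact shift_block ..
  | braidInv X Y => exact shift_block ..
  | _ => rfl

/-! ### Interpretation in a braided monoidal category -/

variable {𝒞 : Type u} [Category.{v} 𝒞] [MonoidalCategory.{v} 𝒞] [BraidedCategory 𝒞]

/-- The object denoted by a formal tensor product. This and `Model.den` are reducible so that the
statement that a concrete formal equation holds unfolds to the equation in `𝒞`. -/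
@[reducible] def Ob.den (obj : ℕ → 𝒞) : Ob → 𝒞
  | one => 𝟙_ 𝒞
  | of a => obj a
  | tensor X Y => X.den obj ⊗ Y.den obj

/-- The right-nested tensor product of a list of colours. -/
@[reducible] def obs (obj : ℕ → 𝒞) : List ℕ → 𝒞
  | [] => 𝟙_ 𝒞
  | a :: s => obj a ⊗ obs obj s

/-- The canonical isomorphism which removes the brackets of a formal tensor product. -/
def Ob.iso (obj : ℕ → 𝒞) : (X : Ob) → (s : List ℕ) → (X.den obj ⊗ obs obj s ≅ obs obj (X.flat s))
  | one, s => λ_ (obs obj s)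
  | of a, s => Iso.refl _
  | tensor X Y, s => α_ _ _ _ ≪≫ whiskerLeftIso (X.den obj) (Y.iso obj s) ≪≫ X.iso obj (Y.flat s)

/-- Adding the strands `X` to the left of a morphism. -/
def Ob.pad (obj : ℕ → 𝒞) : (X : Ob) → {s s' : List ℕ} → (obs obj s ⟶ obs obj s') →
    (obs obj (X.flat s) ⟶ obs obj (X.flat s'))
  | one, _, _, k => k
  | of a, _, _, k => obj a ◁ k
  | tensor X Y, _, _, k => X.pad obj (Y.pad obj k)

lemma Ob.iso_hom_pad (obj : ℕ → 𝒞) (X : Ob) {s s' : List ℕ} (k : obs obj s ⟶ obs obj s') :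
    (X.iso obj s).hom ≫ X.pad obj k = X.den obj ◁ k ≫ (X.iso obj s').hom := by
  induction X generalizing s s' with
  | one => simp [iso, pad]
  | of a => simp [iso, pad]
  | tensor X Y hX hY =>
    simp only [iso, pad, Iso.trans_hom, whiskerLeftIso_hom, Category.assoc, hX, hY,
      ← whiskerLeft_comp_assoc]
    simp

lemma Ob.iso_inv_whiskerLeft (obj : ℕ → 𝒞) (X : Ob) {s s' : List ℕ}
    (k : obs obj s ⟶ obs obj s') :
    (X.iso obj s).inv ≫ X.den obj ◁ k = X.pad obj k ≫ (X.iso obj s').inv := by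
  rw [Iso.inv_comp_eq, ← Category.assoc, Ob.iso_hom_pad, Category.assoc, Iso.hom_inv_id,
    Category.comp_id]

/-- An interpretation of the colours and of the generating morphisms. -/
structure Model (G : Type) [Signature G] (𝒞 : Type u) [Category.{v} 𝒞]
    [MonoidalCategory.{v} 𝒞] where
  obj : ℕ → 𝒞
  mor : ∀ g : G, (Signature.dom g).den obj ⟶ (Signature.cod g).den obj

namespace Model

variable (S : Model G 𝒞)

/-- The morphism denoted by a box. -/
@[reducible] def genMor : (g : Gen G) → (g.dom.den S.obj ⟶ g.cod.den S.obj)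
  | .op g => S.mor g
  | .cr true a b => (β_ (S.obj a) (S.obj b)).hom
  | .cr false a b => (β_ (S.obj b) (S.obj a)).inv

/-- The morphism denoted by an expression. -/
@[reducible] def den : {X Y : Ob} → Tm G X Y → (X.den S.obj ⟶ Y.den S.obj)
  | _, _, .id _ => 𝟙 _
  | _, _, .comp f g => den f ≫ den g
  | _, _, .whiskerL X f => X.den S.obj ◁ den f
  | _, _, .whiskerR f X => den f ▷ X.den S.obj
  | _, _, .tens f g => den f ⊗ₘ den g
  | _, _, .assoc X Y Z => (α_ (X.den S.obj) (Y.den S.obj) (Z.den S.obj)).hom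
  | _, _, .assocInv X Y Z => (α_ (X.den S.obj) (Y.den S.obj) (Z.den S.obj)).inv
  | _, _, .left X => (λ_ (X.den S.obj)).hom
  | _, _, .leftInv X => (λ_ (X.den S.obj)).inv
  | _, _, .right X => (ρ_ (X.den S.obj)).hom
  | _, _, .rightInv X => (ρ_ (X.den S.obj)).inv
  | _, _, .braid X Y => (β_ (X.den S.obj) (Y.den S.obj)).hom
  | _, _, .braidInv X Y => (β_ (X.den S.obj) (Y.den S.obj)).inv
  | _, _, .gen g => S.genMor g

/-- A morphism between tensor products of colours, drawn to the left of the strands `s`. -/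
def place {X Y : Ob} (f : X.den S.obj ⟶ Y.den S.obj) (s : List ℕ) :
    obs S.obj (X.flat s) ⟶ obs S.obj (Y.flat s) :=
  (X.iso S.obj s).inv ≫ f ▷ obs S.obj s ≫ (Y.iso S.obj s).hom

lemma place_pad {X Y : Ob} (f : X.den S.obj ⟶ Y.den S.obj) {s s' : List ℕ}
    (k : obs S.obj s ⟶ obs S.obj s') :
    S.place f s ≫ Y.pad S.obj k = X.pad S.obj k ≫ S.place f s' := by
  simp only [place, Category.assoc, Ob.iso_hom_pad]
  rw [← whisker_exchange_assoc, ← Category.assoc, Ob.iso_inv_whiskerLeft, Category.assoc]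

lemma place_id (X : Ob) (s : List ℕ) : S.place (𝟙 (X.den S.obj)) s = 𝟙 _ := by simp [place]

lemma place_comp {X Y Z : Ob} (f : X.den S.obj ⟶ Y.den S.obj) (g : Y.den S.obj ⟶ Z.den S.obj)
    (s : List ℕ) : S.place (X := X) (Y := Z) (f ≫ g) s = S.place f s ≫ S.place g s := by
  simp [place]

lemma place_whiskerLeft (X : Ob) {Y Z : Ob} (f : Y.den S.obj ⟶ Z.den S.obj) (s : List ℕ) :
    S.place (X := .tensor X Y) (Y := .tensor X Z) (X.den S.obj ◁ f) s
      = X.pad S.obj (S.place f s) := by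
  rw [← cancel_epi (X.iso S.obj (Y.flat s)).hom, Ob.iso_hom_pad]
  simp [place, Ob.iso]

lemma place_whiskerRight {Y Z : Ob} (f : Y.den S.obj ⟶ Z.den S.obj) (X : Ob) (s : List ℕ) :
    S.place (X := .tensor Y X) (Y := .tensor Z X) (f ▷ X.den S.obj) s
      = S.place f (X.flat s) := by
  rw [place, place, Iso.inv_comp_eq]
  simp only [Ob.iso, Iso.trans_hom, whiskerLeftIso_hom, Category.assoc]
  rw [Iso.hom_inv_id_assoc, whisker_exchange_assoc]
  simp

/-- A morphism out of the strands `l`. -/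
abbrev Out (l : List ℕ) := Σ l' : List ℕ, (obs S.obj l ⟶ obs S.obj l')

variable {S} in
/-- Composition with a morphism that is defined on all lists of strands. -/
def Out.andThen {l : List ℕ} (x : S.Out l) (f : ∀ l', S.Out l') : S.Out l :=
  ⟨(f x.1).1, x.2 ≫ (f x.1).2⟩

variable {S} in
/-- Adding the strands `X` on the left. -/
def Out.pad (X : Ob) {l : List ℕ} (x : S.Out l) : S.Out (X.flat l) := ⟨X.flat x.1, X.pad S.obj x.2⟩

/-- The morphism given by a box at the left end of the strands `l`. A box that does not fit is
ignored. -/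
def apply (g : Gen G) (l : List ℕ) : S.Out l :=
  if h : g.dom.flat (l.drop g.dom.len) = l then
    ⟨g.cod.flat (l.drop g.dom.len),
      eqToHom (congrArg (obs S.obj) h.symm) ≫ S.place (S.genMor g) (l.drop g.dom.len)⟩
  else ⟨l, 𝟙 _⟩

/-- A box in the position in which it fits denotes the corresponding morphism. -/
lemma apply_flat (g : Gen G) (s : List ℕ) :
    S.apply g (g.dom.flat s) = ⟨g.cod.flat s, S.place (S.genMor g) s⟩ := by
  have h : (g.dom.flat s).drop g.dom.len = s := Ob.drop_flat _ _
  unfold apply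
  rw [dif_pos (by rw [h])]
  -- `h` cannot be rewritten in the dependent pair, so its left-hand side is generalized to `t`
  have key : ∀ (t : List ℕ) (ht : t = s),
      (⟨g.cod.flat t, eqToHom (congrArg (obs S.obj) (by rw [ht])) ≫ S.place (S.genMor g) t⟩ :
        S.Out (g.dom.flat s)) = ⟨g.cod.flat s, S.place (S.genMor g) s⟩ := by
    rintro t rfl; simp
  exact key _ h

/-- The morphism given by a layer of a string diagram. -/
def step (g : Gen G) : (p : ℕ) → (l : List ℕ) → S.Out l
  | 0, l => S.apply g l
  | _ + 1, [] => ⟨[], 𝟙 _⟩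
  | p + 1, a :: l => ⟨a :: (step g p l).1, S.obj a ◁ (step g p l).2⟩

/-- The morphism given by a string diagram. -/
def run : List (Layer G) → (l : List ℕ) → S.Out l
  | [], l => ⟨l, 𝟙 _⟩
  | x :: d, l => (S.step x.2 x.1 l).andThen (run d)

variable {S} in
lemma Out.andThen_assoc {l : List ℕ} (x : S.Out l) (f g : ∀ l', S.Out l') :
    (x.andThen f).andThen g = x.andThen fun l' => (f l').andThen g := by
  simp [Out.andThen]

lemma run_append (d e : List (Layer G)) (l : List ℕ) :
    S.run (d ++ e) l = (S.run d l).andThen (S.run e) := by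
  induction d generalizing l with
  | nil => simp [run, Out.andThen]
  | cons x d h =>
    rw [List.cons_append, run, run, Out.andThen_assoc]
    congr 1; funext l'; exact h l'

variable {S} in
lemma Out.pad_of_andThen (a : ℕ) {l : List ℕ} (x : S.Out l) (f g : ∀ l', S.Out l')
    (h : g (a :: x.1) = Out.pad (.of a) (f x.1)) :
    Out.andThen (l := a :: l) (Out.pad (.of a) x) g = Out.pad (.of a) (x.andThen f) := by
  have h1 : Out.andThen (l := a :: l) (Out.pad (.of a) x) g
      = ⟨(g (a :: x.1)).1, S.obj a ◁ x.2 ≫ (g (a :: x.1)).2⟩ := rfl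
  rw [h1, h]
  simp only [Out.andThen, Out.pad, Ob.pad, whiskerLeft_comp]

lemma run_shift_one (a : ℕ) (d : List (Layer G)) (l : List ℕ) :
    S.run (shift 1 d) (a :: l) = Out.pad (.of a) (S.run d l) := by
  induction d generalizing l with
  | nil =>
    simp only [shift_nil, run, Out.pad, Ob.pad, whiskerLeft_id]
  | cons x d h => exact Out.pad_of_andThen a (S.step x.2 x.1 l) _ _ (h _)

lemma run_shift_len (X : Ob) (d : List (Layer G)) (l : List ℕ) :
    S.run (shift X.len d) (X.flat l) = Out.pad X (S.run d l) := by
  induction X generalizing d l with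
  | one => rw [Ob.len, shift_zero]; rfl
  | of a => exact S.run_shift_one a d l
  | tensor X Y hX hY =>
    rw [Ob.len, Nat.add_comm, ← shift_shift]
    exact (hX _ _).trans (congrArg (Out.pad X) (hY _ _))

/-- Whether the strands `l` have the colours `X` from position `p` on. -/
def _root_.CrossProd.Diagram.fits (X : Ob) : ℕ → List ℕ → Bool
  | 0, l => X.flat (l.drop X.len) == l
  | _ + 1, [] => false
  | p + 1, _ :: l => fits X p l

lemma run_shift_congr {X : Ob} {d e : List (Layer G)}
    (h : ∀ s, S.run d (X.flat s) = S.run e (X.flat s)) (p : ℕ) (l : List ℕ)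
    (hl : fits X p l = true) : S.run (shift p d) l = S.run (shift p e) l := by
  induction p generalizing l with
  | zero =>
    have hl' : X.flat (l.drop X.len) = l := by simpa [fits] using hl
    rw [shift_zero, shift_zero, ← hl']
    exact h _
  | succ p ih =>
    cases l with
    | nil => simp [fits] at hl
    | cons a l =>
      rw [← shift_shift, ← shift_shift, run_shift_one, run_shift_one, ih l hl]

lemma run_append_congr {d d' : List (Layer G)} {l : List ℕ} (h : S.run d l = S.run d' l)
    (e : List (Layer G)) : S.run (d ++ e) l = S.run (d' ++ e) l := by
  rw [run_append, run_append, h]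

/-! ### The string diagram of an expression -/

/-- The crossing of `X` and `Y`. -/
def crossing : (s : Bool) → (X Y : Ob) →
    (Ob.den S.obj (.tensor X Y) ⟶ Ob.den S.obj (.tensor Y X))
  | true, X, Y => (β_ (X.den S.obj) (Y.den S.obj)).hom
  | false, X, Y => (β_ (Y.den S.obj) (X.den S.obj)).inv

lemma place_crossing_tensor_left (s : Bool) (X₁ X₂ Y : Ob) (l : List ℕ) :
    S.place (S.crossing s (.tensor X₁ X₂) Y) l
      = X₁.pad S.obj (S.place (S.crossing s X₂ Y) l) ≫
        S.place (S.crossing s X₁ Y) (X₂.flat l) := by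
  rw [← place_whiskerLeft, ← place_whiskerRight]
  cases s <;> simp [place, Ob.iso, crossing]

lemma place_crossing_tensor_right (s : Bool) (X Y₁ Y₂ : Ob) (l : List ℕ) :
    S.place (S.crossing s X (.tensor Y₁ Y₂)) l
      = S.place (S.crossing s X Y₁) (Y₂.flat l) ≫
        Y₁.pad S.obj (S.place (S.crossing s X Y₂) l) := by
  rw [← place_whiskerLeft, ← place_whiskerRight]
  cases s <;> simp [place, Ob.iso, crossing]

lemma place_crossing_one_left (s : Bool) (Y : Ob) (l : List ℕ) :
    S.place (S.crossing s .one Y) l = 𝟙 _ := by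
  cases s <;> simp [place, Ob.iso, crossing]

lemma place_crossing_one_right (s : Bool) (X : Ob) (l : List ℕ) :
    S.place (S.crossing s X .one) l = 𝟙 _ := by
  cases s <;> simp [place, Ob.iso, crossing]

lemma run_singleton (g : Gen G) (l : List ℕ) :
    S.run [(0, g)] (g.dom.flat l) = ⟨g.cod.flat l, S.place (S.genMor g) l⟩ := by
  have h : S.step g 0 (g.dom.flat l) = ⟨g.cod.flat l, S.place (S.genMor g) l⟩ := S.apply_flat g l
  simp [run, h, Out.andThen]

/-- Diagrams that denote given morphisms compose. -/
lemma run_append_place {X Y Z : Ob} {f : X.den S.obj ⟶ Y.den S.obj}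
    {g : Y.den S.obj ⟶ Z.den S.obj} {d e : List (Layer G)} {l : List ℕ}
    (hd : S.run d (X.flat l) = ⟨Y.flat l, S.place f l⟩)
    (he : S.run e (Y.flat l) = ⟨Z.flat l, S.place g l⟩) :
    S.run (d ++ e) (X.flat l) = ⟨Z.flat l, S.place (X := X) (Y := Z) (f ≫ g) l⟩ := by
  rw [run_append, hd, place_comp, Out.andThen, he]

/-- The crossings of two blocks of strands denote the braiding or its inverse. -/
lemma run_block (s : Bool) (X Y : Ob) (l : List ℕ) :
    S.run (block s X Y 0) (Ob.flat (.tensor X Y) l)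
      = ⟨Ob.flat (.tensor Y X) l, S.place (S.crossing s X Y) l⟩ := by
  induction X generalizing l with
  | one => rw [place_crossing_one_left]; simp only [block]; rfl
  | of a =>
    simp only [block]
    induction Y generalizing l with
    | one => rw [place_crossing_one_right]; simp only [strand]; rfl
    | of b =>
      cases s
      · exact S.run_singleton (.cr false a b) l
      · exact S.run_singleton (.cr true a b) l
    | tensor Y₁ Y₂ h₁ h₂ =>
      simp only [strand]
      rw [run_append, h₁ (Y₂.flat l), Out.andThen, ← shift_strand,
        place_crossing_tensor_right]
      have := (S.run_shift_len Y₁ (strand s a Y₂ 0) (a :: Y₂.flat l)).trans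
        (congrArg (Out.pad Y₁) (h₂ l))
      rw [this]; rfl
  | tensor X₁ X₂ h₁ h₂ =>
    simp only [block]
    rw [run_append, ← shift_block, place_crossing_tensor_left]
    have := (S.run_shift_len X₁ (block s X₂ Y 0) (X₂.flat (Y.flat l))).trans
      (congrArg (Out.pad X₁) (h₂ l))
    rw [this]
    simp only [Out.andThen, Out.pad]
    rw [h₁ (X₂.flat l)]

/-- The string diagram of an expression denotes the same morphism as the expression. -/
theorem run_compile {X Y : Ob} (f : Tm G X Y) (l : List ℕ) :
    S.run (f.compile 0) (X.flat l) = ⟨Y.flat l, S.place (S.den f) l⟩ := by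
  induction f generalizing l with
  | id X => rw [place_id]; rfl
  | comp f g hf hg => exact S.run_append_place (hf l) (hg l)
  | whiskerL X f hf =>
    rw [Tm.compile, ← Tm.shift_compile]
    exact (S.run_shift_len X (f.compile 0) _).trans
      ((congrArg (Out.pad X) (hf l)).trans (by rw [den, place_whiskerLeft]; rfl))
  | whiskerR f X hf => exact (hf _).trans (by rw [den, place_whiskerRight])
  | @tens X Y X' Y' f g hf hg =>
    rw [den, MonoidalCategory.tensorHom_def]
    refine S.run_append_place (Y := .tensor Y X') ?_ ?_
    · exact (hf _).trans (by rw [place_whiskerRight])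
    · rw [← Tm.shift_compile]
      exact (S.run_shift_len Y (g.compile 0) _).trans
        ((congrArg (Out.pad Y) (hg l)).trans (by rw [place_whiskerLeft]; rfl))
  | assoc X Y Z =>
    have : S.place (S.den (.assoc X Y Z)) l = 𝟙 _ := by simp [place, Ob.iso]
    rw [this]; rfl
  | assocInv X Y Z =>
    have : S.place (S.den (.assocInv X Y Z)) l = 𝟙 _ := by simp [place, Ob.iso]
    rw [this]; rfl
  | left X =>
    have : S.place (S.den (.left X)) l = 𝟙 _ := by simp [place, Ob.iso]
    rw [this]; rfl
  | leftInv X =>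
    have : S.place (S.den (.leftInv X)) l = 𝟙 _ := by simp [place, Ob.iso]
    rw [this]; rfl
  | right X =>
    have : S.place (S.den (.right X)) l = 𝟙 _ := by simp [place, Ob.iso]
    rw [this]; rfl
  | rightInv X =>
    have : S.place (S.den (.rightInv X)) l = 𝟙 _ := by simp [place, Ob.iso]
    rw [this]; rfl
  | braid X Y => exact S.run_block true X Y l
  | braidInv X Y => exact S.run_block false Y X l
  | gen g => exact S.run_singleton g l

/-- Expressions with the same denotation have interchangeable string diagrams, wherever these are
placed. -/
lemma run_compile_congr {X Y : Ob} {f g : Tm G X Y} (h : S.den f = S.den g) (p : ℕ) (l : List ℕ)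
    (hl : fits X p l = true) : S.run (f.compile p) l = S.run (g.compile p) l := by
  have := S.run_shift_congr (d := f.compile 0) (e := g.compile 0)
    (fun s => by rw [run_compile, run_compile, h]) p l hl
  simpa only [Tm.shift_compile, Nat.zero_add] using this

end Model

/-! ### Rewriting of string diagrams -/

/-- An equation between two expressions. -/
structure Rule (G : Type) [Signature G] where
  dom : Ob
  cod : Ob
  lhs : Tm G dom cod
  rhs : Tm G dom cod

/-- The reversed equation. -/
def Rule.symm (r : Rule G) : Rule G := ⟨r.dom, r.cod, r.rhs, r.lhs⟩

/-- The equation holds in a model. -/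
def Model.Holds (S : Model G 𝒞) (r : Rule G) : Prop := S.den r.lhs = S.den r.rhs

@[simp] lemma Model.holds_symm (S : Model G 𝒞) (r : Rule G) : S.Holds r.symm ↔ S.Holds r :=
  eq_comm

variable [DecidableEq G]

/-- The strands below a box in position `p`, when `l` are those above. -/
def ty (g : Gen G) : ℕ → List ℕ → List ℕ
  | 0, l => if g.dom.flat (l.drop g.dom.len) = l then g.cod.flat (l.drop g.dom.len) else l
  | _ + 1, [] => []
  | p + 1, a :: l => a :: ty g p l

lemma Model.step_fst (S : Model G 𝒞) (g : Gen G) (p : ℕ) (l : List ℕ) :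
    (S.step g p l).1 = ty g p l := by
  induction p generalizing l with
  | zero => simp only [step, apply, ty]; split <;> rfl
  | succ p ih => cases l with
    | nil => rfl
    | cons a l => exact congrArg (a :: ·) (ih l)

/-- The crossing `y` of a strand with an input of the box `x` that is to be drawn above it: the
layers that have to follow `y` in order that the strand passes `x`, and the layers that follow `x`
after the strand has passed. -/
def through (x y : Layer G) (l : List ℕ) : Option (List (Layer G) × List (Layer G)) :=
  match y.2 with
  | .op _ => none
  | .cr s a b =>
    if y.1 + 1 = x.1 then
      match block s (.of a) x.2.dom y.1 with
      | z :: d => if z = y ∧ fits (.tensor (.of a) x.2.dom) y.1 l = true then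
          some (d ++ [(y.1, x.2)], block s (.of a) x.2.cod y.1) else none
      | [] => none
    else
      match block s x.2.dom (.of b) x.1 with
      | z :: d => if z = y ∧ fits (.tensor x.2.dom (.of b)) x.1 l = true then
          some (d ++ [(x.1 + 1, x.2)], block s x.2.cod (.of b) x.1) else none
      | [] => none

/-- The crossing `x` of a strand with an input of the box `y`, that is to be drawn above it: the
layers in which the strand crosses the outputs of `y`, and the layers that follow `x` after the
strand has passed. -/
def around (x y : Layer G) (l : List ℕ) : Option (List (Layer G) × List (Layer G)) :=
  match x.2 with
  | .op _ => none
  | .cr s a b =>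
    if x.1 + 1 = y.1 then
      match block s (.of a) y.2.dom x.1 with
      | z :: d => if z = x ∧ fits (.tensor (.of a) y.2.dom) x.1 l = true then
          some (block s (.of a) y.2.cod x.1, d ++ [(x.1, y.2)]) else none
      | [] => none
    else
      match block s y.2.dom (.of b) y.1 with
      | z :: d => if z = x ∧ fits (.tensor y.2.dom (.of b)) y.1 l = true then
          some (block s y.2.cod (.of b) y.1, d ++ [(y.1 + 1, y.2)]) else none
      | [] => none

/-- Successively moves the layers of a list to the top of a diagram, by means of `f`. -/
def pulls (f : List ℕ → Layer G → List (Layer G) → Option (List (Layer G))) :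
    List ℕ → List (Layer G) → List (Layer G) → Option (List (Layer G))
  | _, [], d => some d
  | l, x :: xs, d => (f l x d).bind (pulls f (ty x.2 x.1 l) xs)

/-- Moves the layer `x` to the top of a diagram by interchanges and by the naturality of the
braiding, and returns the rest of the diagram. The first argument bounds the depth of the recursion,
which is not structural: pulling a box past a crossing requires pulling several layers. -/
def pull : ℕ → List ℕ → Layer G → List (Layer G) → Option (List (Layer G))
  | 0, _, _, _ => none
  | _ + 1, _, _, [] => none
  | n + 1, l, x, y :: d =>
    if x = y then some d else
    if y.1 + y.2.dom.len ≤ x.1 ∧ fits y.2.dom y.1 l = true then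
      (pull n (ty y.2 y.1 l) (x.1 - y.2.dom.len + y.2.cod.len, x.2) d).map (y :: ·)
    else if x.1 + x.2.dom.len ≤ y.1 ∧ fits x.2.dom x.1 l = true then
      (pull n (ty y.2 y.1 l) x d).map ((y.1 - x.2.dom.len + x.2.cod.len, y.2) :: ·)
    else ((through x y l).bind fun t =>
      (pulls (pull n) (ty y.2 y.1 l) t.1 d).map (t.2 ++ ·)).or
      ((around x y l).bind fun t => (pulls (pull n) (ty y.2 y.1 l) t.1 d).map (t.2 ++ ·))

namespace Model
variable (S : Model G 𝒞)

lemma run_cons_congr (x : Layer G) {d e : List (Layer G)} {l : List ℕ}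
    (h : S.run d (ty x.2 x.1 l) = S.run e (ty x.2 x.1 l)) :
    S.run (x :: d) l = S.run (x :: e) l := by
  have key : ∀ o : S.Out l, S.run d o.1 = S.run e o.1 → o.andThen (S.run d) = o.andThen (S.run e) :=
    fun o ho => by unfold Out.andThen; rw [ho]
  exact key _ (by rw [step_fst, h])

/-- Boxes next to each other may be interchanged. -/
lemma run_interchange (g h : Gen G) (p q : ℕ) (l : List ℕ) (hl : fits g.dom p l = true)
    (hq : p + g.dom.len ≤ q) :
    S.run [(p, g), (q - g.dom.len + g.cod.len, h)] l = S.run [(q, h), (p, g)] l := by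
  obtain ⟨r, rfl⟩ := Nat.exists_eq_add_of_le hq
  have key : ∀ s, S.run [(0, g), (r + g.cod.len, h)] (g.dom.flat s)
      = S.run [(r + g.dom.len, h), (0, g)] (g.dom.flat s) := by
    intro s
    have e₁ : S.run [(r + g.cod.len, h)] (g.cod.flat s) = Out.pad g.cod (S.run [(r, h)] s) :=
      S.run_shift_len g.cod [(r, h)] s
    have e₂ : S.run [(r + g.dom.len, h)] (g.dom.flat s) = Out.pad g.dom (S.run [(r, h)] s) :=
      S.run_shift_len g.dom [(r, h)] s
    have e₃ : S.run [(0, g), (r + g.cod.len, h)] (g.dom.flat s)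
        = (S.run [(0, g)] (g.dom.flat s)).andThen (S.run [(r + g.cod.len, h)]) :=
      S.run_append [(0, g)] [(r + g.cod.len, h)] _
    have e₄ : S.run [(r + g.dom.len, h), (0, g)] (g.dom.flat s)
        = (S.run [(r + g.dom.len, h)] (g.dom.flat s)).andThen (S.run [(0, g)]) :=
      S.run_append [(r + g.dom.len, h)] [(0, g)] _
    rw [e₃, e₄, e₂, run_singleton]
    have e₅ : Out.andThen (S := S) ⟨g.cod.flat s, S.place (S.genMor g) s⟩
        (S.run [(r + g.cod.len, h)]) = ⟨g.cod.flat (S.run [(r, h)] s).1,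
          S.place (S.genMor g) s ≫ g.cod.pad S.obj (S.run [(r, h)] s).2⟩ := by
      unfold Out.andThen; rw [e₁]; rfl
    have e₆ : (Out.pad g.dom (S.run [(r, h)] s)).andThen (S.run [(0, g)])
        = ⟨g.cod.flat (S.run [(r, h)] s).1,
          g.dom.pad S.obj (S.run [(r, h)] s).2 ≫ S.place (S.genMor g) _⟩ := by
      generalize S.run [(r, h)] s = o
      have : (Out.pad g.dom o).andThen (S.run [(0, g)])
          = ⟨(S.run [(0, g)] (g.dom.flat o.1)).1, g.dom.pad S.obj o.2 ≫
              (S.run [(0, g)] (g.dom.flat o.1)).2⟩ := rfl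
      rw [this, run_singleton]
    rw [e₅, e₆, place_pad]
  have := S.run_shift_congr key p l hl
  have e₁ : p + g.dom.len + r - g.dom.len + g.cod.len = r + g.cod.len + p := by omega
  have e₂ : p + g.dom.len + r = r + g.dom.len + p := by omega
  rw [e₁, e₂]
  simpa using this

lemma genMor_crossing_left (s : Bool) (a : ℕ) (g : Gen G) :
    S.obj a ◁ S.genMor g ≫ S.crossing s (.of a) g.cod
      = S.crossing s (.of a) g.dom ≫ S.genMor g ▷ S.obj a := by
  cases s <;> simp [crossing]

lemma genMor_crossing_right (s : Bool) (b : ℕ) (g : Gen G) :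
    S.genMor g ▷ S.obj b ≫ S.crossing s g.cod (.of b)
      = S.crossing s g.dom (.of b) ≫ S.obj b ◁ S.genMor g := by
  cases s <;> simp [crossing]

/-- Naturality of a crossing of a strand with a box to its right. -/
lemma run_crossing_left (s : Bool) (a : ℕ) (g : Gen G) (p : ℕ) (l : List ℕ)
    (hl : fits (.tensor (.of a) g.dom) p l = true) :
    S.run (block s (.of a) g.dom p ++ [(p, g)]) l
      = S.run ((p + 1, g) :: block s (.of a) g.cod p) l := by
  have key : ∀ t, S.run (block s (.of a) g.dom 0 ++ [(0, g)]) (Ob.flat (.tensor (.of a) g.dom) t)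
      = S.run ([(1, g)] ++ block s (.of a) g.cod 0) (Ob.flat (.tensor (.of a) g.dom) t) := by
    intro t
    have e₁ := S.run_append_place (S.run_block s (.of a) g.dom t)
      (S.run_compile (.whiskerR (.gen g) (.of a)) t)
    have e₂ := S.run_append_place (S.run_compile (.whiskerL (.of a) (.gen g)) t)
      (S.run_block s (.of a) g.cod t)
    refine e₁.trans (Eq.trans ?_ e₂.symm)
    exact congrArg (fun k => (⟨_, S.place (X := .tensor (.of a) g.dom) (Y := .tensor g.cod (.of a))
      k t⟩ : S.Out _)) (S.genMor_crossing_left s a g).symm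
  have := S.run_shift_congr key p l hl
  simpa [shift_block, Nat.add_comm] using this

/-- Naturality of a crossing of a strand with a box to its left. -/
lemma run_crossing_right (s : Bool) (b : ℕ) (g : Gen G) (p : ℕ) (l : List ℕ)
    (hl : fits (.tensor g.dom (.of b)) p l = true) :
    S.run (block s g.dom (.of b) p ++ [(p + 1, g)]) l
      = S.run ((p, g) :: block s g.cod (.of b) p) l := by
  have key : ∀ t, S.run (block s g.dom (.of b) 0 ++ [(1, g)]) (Ob.flat (.tensor g.dom (.of b)) t)
      = S.run ([(0, g)] ++ block s g.cod (.of b) 0) (Ob.flat (.tensor g.dom (.of b)) t) := by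
    intro t
    have e₁ := S.run_append_place (S.run_block s g.dom (.of b) t)
      (S.run_compile (.whiskerL (.of b) (.gen g)) t)
    have e₂ := S.run_append_place (S.run_compile (.whiskerR (.gen g) (.of b)) t)
      (S.run_block s g.cod (.of b) t)
    refine e₁.trans (Eq.trans ?_ e₂.symm)
    exact congrArg (fun k => (⟨_, S.place (X := .tensor g.dom (.of b)) (Y := .tensor (.of b) g.cod)
      k t⟩ : S.Out _)) (S.genMor_crossing_right s b g).symm
  have := S.run_shift_congr key p l hl
  simpa [shift_block, Nat.add_comm] using this

lemma run_through {x y : Layer G} {l : List ℕ} {t : List (Layer G) × List (Layer G)}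
    (h : through x y l = some t) : S.run (y :: t.1) l = S.run (x :: t.2) l := by
  obtain ⟨p, g⟩ := x
  obtain ⟨q, h'⟩ := y
  cases h' with
  | op g => simp [through] at h
  | cr s a b =>
    simp only [through] at h
    split at h
    · rename_i hq
      subst hq
      split at h
      · rename_i z d hz
        split at h
        · rename_i hz'
          obtain ⟨rfl, hl⟩ := hz'
          cases h
          rw [← S.run_crossing_left s a g q l hl, hz]; rfl
        · cases h
      · cases h
    · split at h
      · rename_i z d hz
        split at h
        · rename_i hz'
          obtain ⟨rfl, hl⟩ := hz'
          cases h
          rw [← S.run_crossing_right s b g p l hl, hz]; rfl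
        · cases h
      · cases h

lemma run_around {x y : Layer G} {l : List ℕ} {t : List (Layer G) × List (Layer G)}
    (h : around x y l = some t) : S.run (y :: t.1) l = S.run (x :: t.2) l := by
  obtain ⟨q, g⟩ := y
  obtain ⟨p, h'⟩ := x
  cases h' with
  | op g => simp [around] at h
  | cr s a b =>
    simp only [around] at h
    split at h
    · rename_i hq
      subst hq
      split at h
      · rename_i z d hz
        split at h
        · rename_i hz'
          obtain ⟨rfl, hl⟩ := hz'
          cases h
          rw [← S.run_crossing_left s a g p l hl, hz]; rfl
        · cases h
      · cases h
    · split at h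
      · rename_i z d hz
        split at h
        · rename_i hz'
          obtain ⟨rfl, hl⟩ := hz'
          cases h
          rw [← S.run_crossing_right s b g q l hl, hz]; rfl
        · cases h
      · cases h

lemma run_pulls {f : List ℕ → Layer G → List (Layer G) → Option (List (Layer G))}
    (hf : ∀ l x d d', f l x d = some d' → S.run d l = S.run (x :: d') l)
    {l : List ℕ} {xs d d' : List (Layer G)} (h : pulls f l xs d = some d') :
    S.run d l = S.run (xs ++ d') l := by
  induction xs generalizing l d with
  | nil => cases h; rfl
  | cons x xs ih =>
    obtain ⟨e, he, h⟩ := Option.bind_eq_some_iff.1 h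
    rw [hf _ _ _ _ he]
    exact S.run_cons_congr x (ih h)

lemma run_pull (n : ℕ) {l : List ℕ} {x : Layer G} {d d' : List (Layer G)}
    (h : pull n l x d = some d') : S.run d l = S.run (x :: d') l := by
  induction n generalizing l x d d' with
  | zero => simp [pull] at h
  | succ n ih =>
    cases d with
    | nil => simp [pull] at h
    | cons y d =>
      rw [pull] at h
      split_ifs at h with h₁ h₂ h₃
      · cases h; rw [h₁]
      · obtain ⟨e, he, rfl⟩ := Option.map_eq_some_iff.1 h
        rw [S.run_cons_congr y (ih he)]
        exact S.run_append_congr (S.run_interchange y.2 x.2 y.1 x.1 l h₂.2 h₂.1) e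
      · obtain ⟨e, he, rfl⟩ := Option.map_eq_some_iff.1 h
        rw [S.run_cons_congr y (ih he)]
        exact (S.run_append_congr (S.run_interchange x.2 y.2 x.1 y.1 l h₃.2 h₃.1) e).symm
      · rcases Option.or_eq_some_iff.1 h with h | ⟨-, h⟩
        all_goals
          obtain ⟨t, ht, h⟩ := Option.bind_eq_some_iff.1 h
          obtain ⟨e, he, rfl⟩ := Option.map_eq_some_iff.1 h
          rw [S.run_cons_congr y (S.run_pulls (fun _ _ _ _ => ih) he)]
        · exact S.run_append_congr (S.run_through ht) e
        · exact S.run_append_congr (S.run_around ht) e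

end Model

/-- Rewrites the top of a diagram by an equation, whose left-hand side is found to the right of `p`
strands, up to isotopy. Here `250` is an ample bound for the depth of the recursion of `pull`. -/
def rewriteTop (r : Rule G) (p : ℕ) (l : List ℕ) (d : List (Layer G)) : Option (List (Layer G)) :=
  if fits r.dom p l = true then
    (pulls (pull 250) l (r.lhs.compile p) d).map (r.rhs.compile p ++ ·) else none

/-- Moves the layer `y` from below the layers of a list to above them, if it is independent of them,
and returns the new layers. -/
def rise : List ℕ → List (Layer G) → Layer G → Option (Layer G × List (Layer G))
  | _, [], y => some (y, [])
  | l, z :: c, y => (rise (ty z.2 z.1 l) c y).bind fun t =>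
    if z.1 + z.2.cod.len ≤ t.1.1 ∧ fits z.2.dom z.1 l = true then
      some ((t.1.1 - z.2.cod.len + z.2.dom.len, t.1.2), z :: t.2)
    else if t.1.1 + t.1.2.dom.len ≤ z.1 ∧ fits t.1.2.dom t.1.1 l = true then
      some (t.1, (z.1 - t.1.2.dom.len + t.1.2.cod.len, z.2) :: t.2)
    else none

/-- Sorts the layers of `d` into those that can be moved above the layers `c` and the others. -/
def sink : List ℕ → List (Layer G) → List (Layer G) → List (Layer G) × List (Layer G)
  | _, c, [] => ([], c)
  | l, c, y :: d => match rise l c y with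
    | some (y', c') => (y' :: (sink (ty y'.2 y'.1 l) c' d).1, (sink (ty y'.2 y'.1 l) c' d).2)
    | none => sink l (c ++ [y]) d

/-- The strands below the layers `d`, when `l` are those above. -/
def tys (l : List ℕ) (d : List (Layer G)) : List ℕ := d.foldl (fun l x => ty x.2 x.1 l) l

/-- Rewrites a diagram by an equation, whose left-hand side begins with the first layer of the
diagram. -/
def rewriteHead (r : Rule G) (l : List ℕ) : List (Layer G) → Option (List (Layer G))
  | [] => none
  | x :: d => match sink l [x] d, r.lhs.compile 0 with
    | (pre, z :: e), w :: _ => if w.1 ≤ z.1 then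
        (rewriteTop r (z.1 - w.1) (tys l pre) (z :: e)).map (pre ++ ·) else none
    | _, _ => none

/-- Rewrites a diagram by an equation, whose left-hand side is found below the first `i` layers and
either to the right of `p` strands, or beginning with the next layer. -/
def rewrite (r : Rule G) : (i p : ℕ) → List ℕ → List (Layer G) → Option (List (Layer G))
  | 0, p, l, d => (rewriteTop r p l d).or (rewriteHead r l d)
  | _ + 1, _, _, [] => none
  | i + 1, p, l, x :: d => (rewrite r i p (ty x.2 x.1 l) d).map (x :: ·)

/-- Naturality of the braiding in its left argument. -/
abbrev Rule.natL {X Y : Ob} (f : Tm G X Y) (Z : Ob) : Rule G :=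
  ⟨_, _, .comp (.whiskerR f Z) (.braid Y Z), .comp (.braid X Z) (.whiskerL Z f)⟩

/-- Naturality of the braiding in its right argument. -/
abbrev Rule.natR {X Y : Ob} (Z : Ob) (f : Tm G X Y) : Rule G :=
  ⟨_, _, .comp (.whiskerL Z f) (.braid Z Y), .comp (.braid Z X) (.whiskerR f Z)⟩

/-- Naturality of the inverse braiding in its left argument. -/
abbrev Rule.negL {X Y : Ob} (f : Tm G X Y) (Z : Ob) : Rule G :=
  ⟨_, _, .comp (.whiskerR f Z) (.braidInv Z Y), .comp (.braidInv Z X) (.whiskerL Z f)⟩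

/-- Naturality of the inverse braiding in its right argument. -/
abbrev Rule.negR {X Y : Ob} (Z : Ob) (f : Tm G X Y) : Rule G :=
  ⟨_, _, .comp (.whiskerL Z f) (.braidInv Y Z), .comp (.braidInv X Z) (.whiskerR f Z)⟩

/-- The cancellation of two crossings. -/
abbrev Rule.cancel (s : Bool) (X Y : Ob) : Rule G :=
  bif s then ⟨_, _, .comp (.braid X Y) (.braidInv X Y), .id _⟩
  else ⟨_, _, .comp (.braidInv X Y) (.braid X Y), .id _⟩

/-- A rewriting step: the use of an axiom, of the naturality of the braiding or of its inverse, in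
one of the two directions, or the cancellation of two crossings. -/
inductive Step (K G : Type)
  | ax (k : K)
  | inv (k : K)
  | natL (g : G) (c : ℕ)
  | natR (c : ℕ) (g : G)
  | natLInv (g : G) (c : ℕ)
  | natRInv (c : ℕ) (g : G)
  | negL (g : G) (c : ℕ)
  | negR (c : ℕ) (g : G)
  | negLInv (g : G) (c : ℕ)
  | negRInv (c : ℕ) (g : G)
  | cancel (s : Bool) (a b : ℕ)

variable {K : Type}

/-- The equation used in a step. -/
def Step.rule (ax : K → Rule G) : Step K G → Rule G
  | .ax k => ax k
  | .inv k => (ax k).symm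
  | .natL g c => .natL (.gen (.op g)) (.of c)
  | .natR c g => .natR (.of c) (.gen (.op g))
  | .natLInv g c => (Rule.natL (.gen (.op g)) (.of c)).symm
  | .natRInv c g => (Rule.natR (.of c) (.gen (.op g))).symm
  | .negL g c => .negL (.gen (.op g)) (.of c)
  | .negR c g => .negR (.of c) (.gen (.op g))
  | .negLInv g c => (Rule.negL (.gen (.op g)) (.of c)).symm
  | .negRInv c g => (Rule.negR (.of c) (.gen (.op g))).symm
  | .cancel s a b => .cancel s (.of a) (.of b)

/-- Whether the axiom used in a step, if any, is one of those allowed by `ok`. -/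
def Step.allowed (ok : K → Bool) : Step K G → Bool
  | .ax k => ok k
  | .inv k => ok k
  | _ => true

/-- A list of rewriting steps, with the places where they are to be applied: the number of layers
above and the number of strands to the left of the left-hand side. -/
abbrev Script (K G : Type) := List (Step K G × ℕ × ℕ)

/-- The diagram that results from the rewriting steps, if these can all be applied. -/
def Script.apply (ax : K → Rule G) (l : List ℕ) : Script K G → List (Layer G) →
    Option (List (Layer G))
  | [], d => some d
  | (x, i, p) :: s, d => (rewrite (x.rule ax) i p l d).bind (Script.apply ax l s)

/-- Whether the two sides of an equation become isotopic after the given rewriting steps `s` and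
`t`, which use only axioms that are allowed by `ok`. This is a computation with lists of natural
numbers, which `decide +kernel` performs for concrete equations and scripts. -/
def Rule.check (ax : K → Rule G) (ok : K → Bool) (r : Rule G) (s t : Script K G) : Bool :=
  (s ++ t).all (fun x => x.1.allowed ok) &&
    match s.apply ax (r.dom.flat []) (r.lhs.compile 0),
      t.apply ax (r.dom.flat []) (r.rhs.compile 0) with
    | some d, some e => pulls (pull 250) (r.dom.flat []) e d = some []
    | _, _ => false

namespace Model
variable (S : Model G 𝒞)

lemma run_rewriteTop {r : Rule G} (hr : S.Holds r) {p : ℕ} {l : List ℕ} {d d' : List (Layer G)}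
    (h : rewriteTop r p l d = some d') : S.run d l = S.run d' l := by
  unfold rewriteTop at h
  split_ifs at h with hl
  obtain ⟨e, he, rfl⟩ := Option.map_eq_some_iff.1 h
  rw [S.run_pulls (fun _ _ _ _ => S.run_pull 250) he]
  exact S.run_append_congr (S.run_compile_congr hr p l hl) e

lemma run_rise {l : List ℕ} {c : List (Layer G)} {y : Layer G} {t : Layer G × List (Layer G)}
    (h : rise l c y = some t) : S.run (c ++ [y]) l = S.run (t.1 :: t.2) l := by
  induction c generalizing l t with
  | nil => cases h; rfl
  | cons z c ih =>
    obtain ⟨u, hu, h⟩ := Option.bind_eq_some_iff.1 h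
    rw [List.cons_append, S.run_cons_congr z (ih hu)]
    split_ifs at h with h₁ h₂
    · cases h
      have := S.run_append_congr (S.run_interchange z.2 u.1.2 z.1
        (u.1.1 - z.2.cod.len + z.2.dom.len) l h₁.2 (by omega)) u.2
      rw [Nat.add_sub_cancel, Nat.sub_add_cancel (by omega)] at this
      exact this
    · cases h
      exact (S.run_append_congr (S.run_interchange u.1.2 z.2 u.1.1 z.1 l h₂.2 h₂.1) u.2).symm

lemma run_sink (l : List ℕ) (c d : List (Layer G)) :
    S.run (c ++ d) l = S.run ((sink l c d).1 ++ (sink l c d).2) l := by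
  induction d generalizing l c with
  | nil => simp [sink]
  | cons y d ih =>
    rw [sink]
    split
    · rename_i y' c' h
      have := S.run_append_congr (S.run_rise h) d
      rw [List.append_assoc, List.singleton_append] at this
      rw [this]
      exact S.run_cons_congr y' (ih _ _)
    · rw [← ih, List.append_assoc, List.singleton_append]

lemma run_append_left_congr {l : List ℕ} (c : List (Layer G)) {d e : List (Layer G)}
    (h : S.run d (tys l c) = S.run e (tys l c)) : S.run (c ++ d) l = S.run (c ++ e) l := by
  induction c generalizing l with
  | nil => exact h
  | cons x c ih => exact S.run_cons_congr x (ih h)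

lemma run_rewriteHead {r : Rule G} (hr : S.Holds r) {l : List ℕ} {d d' : List (Layer G)}
    (h : rewriteHead r l d = some d') : S.run d l = S.run d' l := by
  cases d with
  | nil => cases h
  | cons x d =>
    have hs := S.run_sink l [x] d
    simp only [rewriteHead] at h
    split at h
    · rename_i pre z e w _ h₁ h₂
      rw [h₁] at hs
      split_ifs at h
      obtain ⟨e', he, rfl⟩ := Option.map_eq_some_iff.1 h
      exact hs.trans (S.run_append_left_congr pre (S.run_rewriteTop hr he))
    · cases h

lemma run_rewrite {r : Rule G} (hr : S.Holds r) {i p : ℕ} {l : List ℕ} {d d' : List (Layer G)}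
    (h : rewrite r i p l d = some d') : S.run d l = S.run d' l := by
  induction i generalizing l d d' with
  | zero =>
    rcases Option.or_eq_some_iff.1 h with h | ⟨-, h⟩
    · exact S.run_rewriteTop hr h
    · exact S.run_rewriteHead hr h
  | succ i ih =>
    cases d with
    | nil => simp [rewrite] at h
    | cons x d =>
      obtain ⟨e, he, rfl⟩ := Option.map_eq_some_iff.1 h
      exact S.run_cons_congr x (ih he)

/-- The equation used in a rewriting step holds in every model of the allowed axioms. -/
lemma holds_step {ax : K → Rule G} {ok : K → Bool} (hS : ∀ k, ok k = true → S.Holds (ax k))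
    {x : Step K G} (hx : x.allowed ok = true) : S.Holds (x.rule ax) := by
  have hl : ∀ {X Y : Ob} (f : Tm G X Y) (Z : Ob), S.Holds (.natL f Z) := fun f Z =>
    BraidedCategory.braiding_naturality_left (S.den f) (Z.den S.obj)
  have hr : ∀ {X Y : Ob} (f : Tm G X Y) (Z : Ob), S.Holds (.natR Z f) := fun f Z =>
    BraidedCategory.braiding_naturality_right (Z.den S.obj) (S.den f)
  have hl' : ∀ {X Y : Ob} (f : Tm G X Y) (Z : Ob), S.Holds (.negL f Z) := fun f Z =>
    BraidedCategory.braiding_inv_naturality_left (S.den f) (Z.den S.obj)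
  have hr' : ∀ {X Y : Ob} (f : Tm G X Y) (Z : Ob), S.Holds (.negR Z f) := fun f Z =>
    BraidedCategory.braiding_inv_naturality_right (Z.den S.obj) (S.den f)
  cases x with
  | ax k => exact hS k hx
  | inv k => exact (hS k hx).symm
  | natL g c => exact hl _ _
  | natR c g => exact hr _ _
  | natLInv g c => exact (hl _ _).symm
  | natRInv c g => exact (hr _ _).symm
  | negL g c => exact hl' _ _
  | negR c g => exact hr' _ _
  | negLInv g c => exact (hl' _ _).symm
  | negRInv c g => exact (hr' _ _).symm
  | cancel s a b =>
    cases s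
    · exact (β_ (S.obj a) (S.obj b)).inv_hom_id
    · exact (β_ (S.obj a) (S.obj b)).hom_inv_id

lemma run_script {ax : K → Rule G} {ok : K → Bool} (hS : ∀ k, ok k = true → S.Holds (ax k))
    {s : Script K G} (hs : s.all (fun x => x.1.allowed ok) = true) {l : List ℕ}
    {d d' : List (Layer G)} (h : s.apply ax l d = some d') : S.run d l = S.run d' l := by
  induction s generalizing d with
  | nil => cases h; rfl
  | cons x s ih =>
    obtain ⟨e, he, h⟩ := Option.bind_eq_some_iff.1 h
    rw [List.all_cons, Bool.and_eq_true] at hs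
    rw [S.run_rewrite (S.holds_step hS hs.1) he]
    exact ih hs.2 h

/-- An equation holds in a model when its two sides can be rewritten to isotopic string diagrams by
axioms that hold in the model. Scripts `s` for the left-hand side and `t` for the right-hand side
are the proofs of all equations between string diagrams below. -/
theorem holds_of_check {ax : K → Rule G} {ok : K → Bool} (hS : ∀ k, ok k = true → S.Holds (ax k))
    {r : Rule G} (s t : Script K G) (h : r.check ax ok s t = true) : S.Holds r := by
  have key : S.run (r.lhs.compile 0) (r.dom.flat []) = S.run (r.rhs.compile 0) (r.dom.flat []) := by
    rw [Rule.check, List.all_append, Bool.and_eq_true, Bool.and_eq_true] at h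
    obtain ⟨⟨h₁, h₂⟩, h⟩ := h
    split at h
    · rename_i d e hd he
      rw [S.run_script hS h₁ hd, S.run_script hS h₂ he,
        S.run_pulls (fun _ _ _ _ => S.run_pull 250) (by simpa using h), List.append_nil]
    · cases h
  rw [run_compile, run_compile] at key
  have := eq_of_heq (Sigma.mk.inj key).2
  rw [Holds]
  simpa [place] using this

end Model

end Diagram
end CrossProd

namespace CrossProd
namespace Diagram

universe v u

/-! ### Notation for formal morphisms -/

infixr:70 " ⊗ᵒ " => Ob.tensor
infixr:80 " ≫ᵗ " => Tm.comp
infixr:81 " ◁ᵗ " => Tm.whiskerL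
infixl:81 " ▷ᵗ " => Tm.whiskerR
infixr:70 " ⊗ᵗ " => Tm.tens

/-- The coherence isomorphism that is inserted between two formal tensor products. The instances
repeat those of `MonoidalCoherence` that occur, so that `⊗≫ᵗ` denotes `⊗≫` definitionally. -/
class Coh (X Y : Ob) where
  tm (G : Type) [Signature G] : Tm G X Y

namespace Coh
instance refl (X : Ob) : Coh X X := ⟨fun _ _ => .id X⟩
instance whiskerLeft (X Y Z : Ob) [Coh Y Z] : Coh (X ⊗ᵒ Y) (X ⊗ᵒ Z) :=
  ⟨fun G _ => X ◁ᵗ tm G⟩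
instance whiskerRight (X Y Z : Ob) [Coh X Y] : Coh (X ⊗ᵒ Z) (Y ⊗ᵒ Z) :=
  ⟨fun G _ => tm G ▷ᵗ Z⟩
instance tensor_right' (X Y : Ob) [Coh Y .one] : Coh (X ⊗ᵒ Y) X :=
  ⟨fun G _ => X ◁ᵗ tm G ≫ᵗ .right X⟩
instance left (X Y : Ob) [Coh X Y] : Coh (.one ⊗ᵒ X) Y := ⟨fun G _ => .left X ≫ᵗ tm G⟩
instance right' (X Y : Ob) [Coh X Y] : Coh X (Y ⊗ᵒ .one) := ⟨fun G _ => tm G ≫ᵗ .rightInv Y⟩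
instance assoc (X Y Z W : Ob) [Coh (X ⊗ᵒ (Y ⊗ᵒ Z)) W] : Coh ((X ⊗ᵒ Y) ⊗ᵒ Z) W :=
  ⟨fun G _ => .assoc X Y Z ≫ᵗ tm G⟩
instance assoc' (W X Y Z : Ob) [Coh W (X ⊗ᵒ (Y ⊗ᵒ Z))] : Coh W ((X ⊗ᵒ Y) ⊗ᵒ Z) :=
  ⟨fun G _ => tm G ≫ᵗ .assocInv X Y Z⟩
end Coh

variable {G : Type} [Signature G]

/-- Composition up to coherence isomorphisms. -/
abbrev Tm.cohComp {W X Y Z : Ob} [Coh X Y] (f : Tm G W X) (g : Tm G Y Z) : Tm G W Z :=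
  f ≫ᵗ Coh.tm G ≫ᵗ g

infixr:80 " ⊗≫ᵗ " => Tm.cohComp

namespace Tm

/-- The formal version of `MonoidalCategory.tensorμ`. -/
abbrev tensorμ (X₁ X₂ Y₁ Y₂ : Ob) : Tm G ((X₁ ⊗ᵒ X₂) ⊗ᵒ Y₁ ⊗ᵒ Y₂) ((X₁ ⊗ᵒ Y₁) ⊗ᵒ X₂ ⊗ᵒ Y₂) :=
  .assoc X₁ X₂ (Y₁ ⊗ᵒ Y₂) ≫ᵗ (X₁ ◁ᵗ .assocInv X₂ Y₁ Y₂) ≫ᵗ (X₁ ◁ᵗ .braid X₂ Y₁ ▷ᵗ Y₂) ≫ᵗ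
    (X₁ ◁ᵗ .assoc Y₁ X₂ Y₂) ≫ᵗ .assocInv X₁ Y₁ (X₂ ⊗ᵒ Y₂)

/-! ### Formal versions of the constructions -/

section Diagonal

variable {H X Y : Ob}

/-- The diagonal left action on a tensor product. -/
abbrev diagActL (d : Tm G H (H ⊗ᵒ H)) (a : Tm G (H ⊗ᵒ X) X) (b : Tm G (H ⊗ᵒ Y) Y) :
    Tm G (H ⊗ᵒ (X ⊗ᵒ Y)) (X ⊗ᵒ Y) :=
  d ▷ᵗ (X ⊗ᵒ Y) ⊗≫ᵗ H ◁ᵗ (.braid H X ▷ᵗ Y) ⊗≫ᵗ (a ⊗ᵗ b)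

/-- The diagonal right action on a tensor product. -/
abbrev diagActR (d : Tm G H (H ⊗ᵒ H)) (a : Tm G (X ⊗ᵒ H) X) (b : Tm G (Y ⊗ᵒ H) Y) :
    Tm G ((X ⊗ᵒ Y) ⊗ᵒ H) (X ⊗ᵒ Y) :=
  (X ⊗ᵒ Y) ◁ᵗ d ⊗≫ᵗ X ◁ᵗ (.braid Y H ▷ᵗ H) ⊗≫ᵗ (a ⊗ᵗ b)

/-- The diagonal left coaction on a tensor product. -/
abbrev diagCoactL (m : Tm G (H ⊗ᵒ H) H) (a : Tm G X (H ⊗ᵒ X)) (b : Tm G Y (H ⊗ᵒ Y)) :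
    Tm G (X ⊗ᵒ Y) (H ⊗ᵒ (X ⊗ᵒ Y)) :=
  (a ⊗ᵗ b) ⊗≫ᵗ H ◁ᵗ (.braid X H ▷ᵗ Y) ⊗≫ᵗ m ▷ᵗ (X ⊗ᵒ Y)

/-- The diagonal right coaction on a tensor product. -/
abbrev diagCoactR (m : Tm G (H ⊗ᵒ H) H) (a : Tm G X (X ⊗ᵒ H)) (b : Tm G Y (Y ⊗ᵒ H)) :
    Tm G (X ⊗ᵒ Y) ((X ⊗ᵒ Y) ⊗ᵒ H) :=
  (a ⊗ᵗ b) ⊗≫ᵗ X ◁ᵗ (.braid H Y ▷ᵗ H) ⊗≫ᵗ (X ⊗ᵒ Y) ◁ᵗ m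

end Diagonal

end Tm

/-- Formal structure morphisms of a bialgebra. -/
structure Bialg (G : Type) [Signature G] (A : Ob) where
  mul : Tm G (A ⊗ᵒ A) A
  one : Tm G .one A
  comul : Tm G A (A ⊗ᵒ A)
  counit : Tm G A .one

namespace Bialg

variable {A A' V : Ob}

/-- The tensor product of two bialgebras. -/
abbrev tensor (D : Bialg G A) (E : Bialg G A') : Bialg G (A ⊗ᵒ A') where
  mul := .tensorμ A A' A A' ≫ᵗ (D.mul ⊗ᵗ E.mul)
  one := .leftInv .one ≫ᵗ (D.one ⊗ᵗ E.one)
  comul := (D.comul ⊗ᵗ E.comul) ≫ᵗ .tensorμ A A A' A'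
  counit := (D.counit ⊗ᵗ E.counit) ≫ᵗ .left .one

/-- The convolution product `χ.f`. -/
abbrev convLeft (D : Bialg G A) (χ : Tm G A .one) (f : Tm G A V) : Tm G A V :=
  D.comul ≫ᵗ (χ ⊗ᵗ f) ≫ᵗ .left V

/-- The convolution product `f.χ`. -/
abbrev convRight (D : Bialg G A) (f : Tm G A V) (χ : Tm G A .one) : Tm G A V :=
  D.comul ≫ᵗ (f ⊗ᵗ χ) ≫ᵗ .right V

end Bialg

/-- Formal structure morphisms of a Hopf bimodule over `H`. -/
structure Bimod (G : Type) [Signature G] (H : Ob) where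
  pt : Ob
  actL : Tm G (H ⊗ᵒ pt) pt
  actR : Tm G (pt ⊗ᵒ H) pt
  coactL : Tm G pt (H ⊗ᵒ pt)
  coactR : Tm G pt (pt ⊗ᵒ H)

namespace Bimod

variable {H : Ob}

/-- The Hopf bimodule `H`. -/
abbrev unit (A : Bialg G H) : Bimod G H := ⟨H, A.mul, A.mul, A.comul, A.comul⟩

/-- The tensor product in `𝒞`, with induced actions and diagonal coactions. -/
abbrev odot (m : Tm G (H ⊗ᵒ H) H) (P Q : Bimod G H) : Bimod G H where
  pt := P.pt ⊗ᵒ Q.pt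
  actL := .assocInv H P.pt Q.pt ≫ᵗ P.actL ▷ᵗ Q.pt
  actR := .assoc P.pt Q.pt H ≫ᵗ P.pt ◁ᵗ Q.actR
  coactL := .diagCoactL m P.coactL Q.coactL
  coactR := .diagCoactR m P.coactR Q.coactR

/-- The tensor product in `𝒞`, with diagonal actions and induced coactions. -/
abbrev boxdot (d : Tm G H (H ⊗ᵒ H)) (P Q : Bimod G H) : Bimod G H where
  pt := P.pt ⊗ᵒ Q.pt
  actL := .diagActL d P.actL Q.actL
  actR := .diagActR d P.actR Q.actR
  coactL := P.coactL ▷ᵗ Q.pt ≫ᵗ .assoc H P.pt Q.pt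
  coactR := P.pt ◁ᵗ Q.coactR ≫ᵗ .assocInv P.pt Q.pt H

/-- `x ⊗ y ↦ x₍₀₎ y₍₋₁₎ ⊗ x₍₁₎ y₍₀₎`, the composite of the canonical morphisms `λ` and `ρ`. -/
abbrev exchange (P Q : Bimod G H) : Tm G (P.pt ⊗ᵒ Q.pt) (P.pt ⊗ᵒ Q.pt) :=
  (P.coactR ⊗ᵗ Q.coactL) ⊗≫ᵗ P.pt ◁ᵗ (.braid H H ▷ᵗ Q.pt) ⊗≫ᵗ (P.actR ⊗ᵗ Q.actL)

/-- `x ⊗ y ↦ x₍₋₁₎ y₍₀₎ ⊗ x₍₀₎ y₍₁₎`, which induces the braiding of Hopf bimodules. -/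
abbrev theta (P Q : Bimod G H) : Tm G (P.pt ⊗ᵒ Q.pt) (Q.pt ⊗ᵒ P.pt) :=
  (P.coactL ⊗ᵗ Q.coactR) ⊗≫ᵗ H ◁ᵗ (.braid P.pt Q.pt ▷ᵗ H) ⊗≫ᵗ (Q.actL ⊗ᵗ P.actR)

/-- The projection `x ↦ x₍₀₎ s(x₍₁₎)` to the right coinvariants. -/
abbrev coinv (s : Tm G H H) (P : Bimod G H) : Tm G P.pt P.pt := P.coactR ≫ᵗ P.pt ◁ᵗ s ≫ᵗ P.actR

/-- The idempotent `x ⊗ y ↦ x₍₀₎ s(x₍₁₎) ⊗ x₍₂₎ y`. -/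
abbrev split (s : Tm G H H) (P Q : Bimod G H) : Tm G (P.pt ⊗ᵒ Q.pt) (P.pt ⊗ᵒ Q.pt) :=
  P.coactR ▷ᵗ Q.pt ≫ᵗ (P.coinv s ▷ᵗ H) ▷ᵗ Q.pt ≫ᵗ .assoc P.pt H Q.pt ≫ᵗ P.pt ◁ᵗ Q.actL

/-- The idempotent `x ⊗ y ↦ x₍₀₎ s(x₍₁₎) y₍₋₁₎ ⊗ y₍₀₎`. -/
abbrev cosplit (s : Tm G H H) (P Q : Bimod G H) : Tm G (P.pt ⊗ᵒ Q.pt) (P.pt ⊗ᵒ Q.pt) :=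
  P.coinv s ▷ᵗ Q.pt ≫ᵗ P.pt ◁ᵗ Q.coactL ≫ᵗ .assocInv P.pt H Q.pt ≫ᵗ P.actR ▷ᵗ Q.pt

end Bimod

/-! ### Equations -/

namespace Rule

variable {H X Y Z : Ob}

abbrev mulAssoc (m : Tm G (X ⊗ᵒ X) X) : Rule G :=
  ⟨_, _, m ▷ᵗ X ≫ᵗ m, .assoc X X X ≫ᵗ X ◁ᵗ m ≫ᵗ m⟩

abbrev oneMul (m : Tm G (X ⊗ᵒ X) X) (e : Tm G .one X) : Rule G := ⟨_, _, e ▷ᵗ X ≫ᵗ m, .left X⟩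

abbrev mulOne (m : Tm G (X ⊗ᵒ X) X) (e : Tm G .one X) : Rule G := ⟨_, _, X ◁ᵗ e ≫ᵗ m, .right X⟩

abbrev comulAssoc (d : Tm G X (X ⊗ᵒ X)) : Rule G :=
  ⟨_, _, d ≫ᵗ d ▷ᵗ X ≫ᵗ .assoc X X X, d ≫ᵗ X ◁ᵗ d⟩

abbrev counitComul (d : Tm G X (X ⊗ᵒ X)) (c : Tm G X .one) : Rule G :=
  ⟨_, _, d ≫ᵗ c ▷ᵗ X, .leftInv X⟩

abbrev comulCounit (d : Tm G X (X ⊗ᵒ X)) (c : Tm G X .one) : Rule G :=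
  ⟨_, _, d ≫ᵗ X ◁ᵗ c, .rightInv X⟩

abbrev mulComul (m : Tm G (X ⊗ᵒ X) X) (d : Tm G X (X ⊗ᵒ X)) : Rule G :=
  ⟨_, _, m ≫ᵗ d, (d ⊗ᵗ d) ≫ᵗ .tensorμ X X X X ≫ᵗ (m ⊗ᵗ m)⟩

abbrev oneComul (e : Tm G .one X) (d : Tm G X (X ⊗ᵒ X)) : Rule G :=
  ⟨_, _, e ≫ᵗ d, .leftInv .one ≫ᵗ (e ⊗ᵗ e)⟩

abbrev mulCounit (m : Tm G (X ⊗ᵒ X) X) (c : Tm G X .one) : Rule G :=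
  ⟨_, _, m ≫ᵗ c, (c ⊗ᵗ c) ≫ᵗ .left .one⟩

abbrev oneCounit (e : Tm G .one X) (c : Tm G X .one) : Rule G := ⟨_, _, e ≫ᵗ c, .id .one⟩

abbrev oneActL (e : Tm G .one H) (a : Tm G (H ⊗ᵒ X) X) : Rule G := ⟨_, _, e ▷ᵗ X ≫ᵗ a, .left X⟩

abbrev actLAssoc (m : Tm G (H ⊗ᵒ H) H) (a : Tm G (H ⊗ᵒ X) X) : Rule G :=
  ⟨_, _, .assoc H H X ≫ᵗ H ◁ᵗ a ≫ᵗ a, m ▷ᵗ X ≫ᵗ a⟩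

abbrev actROne (e : Tm G .one H) (a : Tm G (X ⊗ᵒ H) X) : Rule G := ⟨_, _, X ◁ᵗ e ≫ᵗ a, .right X⟩

abbrev actRAssoc (m : Tm G (H ⊗ᵒ H) H) (a : Tm G (X ⊗ᵒ H) X) : Rule G :=
  ⟨_, _, .assocInv X H H ≫ᵗ a ▷ᵗ H ≫ᵗ a, X ◁ᵗ m ≫ᵗ a⟩

abbrev coactLCounit (c : Tm G H .one) (n : Tm G X (H ⊗ᵒ X)) : Rule G :=
  ⟨_, _, n ≫ᵗ c ▷ᵗ X, .leftInv X⟩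

abbrev coactLAssoc (d : Tm G H (H ⊗ᵒ H)) (n : Tm G X (H ⊗ᵒ X)) : Rule G :=
  ⟨_, _, n ≫ᵗ H ◁ᵗ n ≫ᵗ .assocInv H H X, n ≫ᵗ d ▷ᵗ X⟩

abbrev coactRCounit (c : Tm G H .one) (n : Tm G X (X ⊗ᵒ H)) : Rule G :=
  ⟨_, _, n ≫ᵗ X ◁ᵗ c, .rightInv X⟩

abbrev coactRAssoc (d : Tm G H (H ⊗ᵒ H)) (n : Tm G X (X ⊗ᵒ H)) : Rule G :=
  ⟨_, _, n ≫ᵗ n ▷ᵗ H ≫ᵗ .assoc X H H, n ≫ᵗ X ◁ᵗ d⟩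

end Rule

section Bimod

variable {H : Ob}

/-- The equation that says that `f` is balanced over `H`. -/
abbrev balanced (P Q : Bimod G H) {Z : Ob} (f : Tm G (P.pt ⊗ᵒ Q.pt) Z) : Rule G :=
  ⟨_, _, P.actR ▷ᵗ Q.pt ≫ᵗ f, .assoc P.pt H Q.pt ≫ᵗ P.pt ◁ᵗ Q.actL ≫ᵗ f⟩

/-- The equation that says that `f` takes values in the cotensor product over `H`. -/
abbrev cobalanced (P Q : Bimod G H) {Z : Ob} (f : Tm G Z (P.pt ⊗ᵒ Q.pt)) : Rule G :=
  ⟨_, _, f ≫ᵗ P.coactR ▷ᵗ Q.pt ≫ᵗ .assoc P.pt H Q.pt, f ≫ᵗ P.pt ◁ᵗ Q.coactL⟩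

/-- Labels for the four equations that say that a morphism is one of Hopf bimodules. -/
inductive HomAx
  | actL | actR | coactL | coactR

/-- The four equations that say that `f` is a morphism of Hopf bimodules. -/
abbrev hom (P Q : Bimod G H) (f : Tm G P.pt Q.pt) : HomAx → Rule G
  | .actL => ⟨_, _, P.actL ≫ᵗ f, H ◁ᵗ f ≫ᵗ Q.actL⟩
  | .actR => ⟨_, _, P.actR ≫ᵗ f, f ▷ᵗ H ≫ᵗ Q.actR⟩
  | .coactL => ⟨_, _, f ≫ᵗ Q.coactL, P.coactL ≫ᵗ H ◁ᵗ f⟩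
  | .coactR => ⟨_, _, f ≫ᵗ Q.coactR, P.coactR ≫ᵗ f ▷ᵗ H⟩

/-- Labels for the four equations that say that a morphism is one of bialgebras. -/
inductive BialgHomAx
  | mul | one | comul | counit

/-- The four equations that say that `f` is a morphism of bialgebras. -/
abbrev bialgHom {A A' : Ob} (D : Bialg G A) (E : Bialg G A') (f : Tm G A A') : BialgHomAx → Rule G
  | .mul => ⟨_, _, D.mul ≫ᵗ f, (f ⊗ᵗ f) ≫ᵗ E.mul⟩
  | .one => ⟨_, _, D.one ≫ᵗ f, E.one⟩
  | .comul => ⟨_, _, f ≫ᵗ E.comul, D.comul ≫ᵗ (f ⊗ᵗ f)⟩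
  | .counit => ⟨_, _, f ≫ᵗ E.counit, D.counit⟩

/-- Labels for the fourteen axioms of a Hopf bimodule. -/
inductive BimodAx
  | oneActL | mulActL | actROne | actRMul | actLActR
  | coactLCounit | coactLComul | coactRCounit | coactRComul | coactLCoactR
  | actLCoactL | actLCoactR | actRCoactL | actRCoactR

/-- The fourteen axioms of a Hopf bimodule. -/
abbrev bimodAx (A : Bialg G H) (P : Bimod G H) : BimodAx → Rule G
  | .oneActL => .oneActL A.one P.actL
  | .mulActL => .actLAssoc A.mul P.actL
  | .actROne => .actROne A.one P.actR
  | .actRMul => .actRAssoc A.mul P.actR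
  | .actLActR => ⟨_, _, P.actL ▷ᵗ H ≫ᵗ P.actR, .assoc H P.pt H ≫ᵗ H ◁ᵗ P.actR ≫ᵗ P.actL⟩
  | .coactLCounit => .coactLCounit A.counit P.coactL
  | .coactLComul => .coactLAssoc A.comul P.coactL
  | .coactRCounit => .coactRCounit A.counit P.coactR
  | .coactRComul => .coactRAssoc A.comul P.coactR
  | .coactLCoactR =>
    ⟨_, _, P.coactL ≫ᵗ H ◁ᵗ P.coactR, P.coactR ≫ᵗ P.coactL ▷ᵗ H ≫ᵗ .assoc H P.pt H⟩
  | .actLCoactL =>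
    ⟨_, _, P.actL ≫ᵗ P.coactL, .diagCoactL A.mul A.comul P.coactL ≫ᵗ H ◁ᵗ P.actL⟩
  | .actLCoactR =>
    ⟨_, _, P.actL ≫ᵗ P.coactR, .diagCoactR A.mul A.comul P.coactR ≫ᵗ P.actL ▷ᵗ H⟩
  | .actRCoactL =>
    ⟨_, _, P.actR ≫ᵗ P.coactL, .diagCoactL A.mul P.coactL A.comul ≫ᵗ H ◁ᵗ P.actR⟩
  | .actRCoactR =>
    ⟨_, _, P.actR ≫ᵗ P.coactR, .diagCoactR A.mul P.coactR A.comul ≫ᵗ P.actR ▷ᵗ H⟩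

end Bimod

end Diagram
end CrossProd

namespace CrossProd

universe v u
variable {𝒞 : Type u} [Category.{v} 𝒞] [MonoidalCategory.{v} 𝒞] [BraidedCategory 𝒞]
open Diagram

set_option linter.unusedSectionVars false

/-! ### The calculus of a Hopf algebra and two crossed modules -/

/-- The generating morphisms of the calculus of the Hopf algebra `H`, the right crossed module `B`,
the left crossed module `C` and two pairings of `B` and `C`. The generator `antiInvH` stands for the
inverse of the antipode, `pair` and `pair'` for a pairing and its convolution inverse. -/
inductive DblOp
  | mulH | oneH | comulH | counitH | antiH | antiInvH
  | mulB | oneB | comulB | counitB | actB | coactB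
  | mulC | oneC | comulC | counitC | actC | coactC
  | pair | pair'
  deriving DecidableEq

namespace Dbl

abbrev H : Ob := .of 0
abbrev B : Ob := .of 1
abbrev C : Ob := .of 2

open DblOp in
/-- The sources of the generating morphisms. -/
@[reducible] def dom : DblOp → Ob
  | mulH => H ⊗ᵒ H | oneH => .one | comulH => H | counitH => H | antiH => H | antiInvH => H
  | mulB => B ⊗ᵒ B | oneB => .one | comulB => B | counitB => B | actB => B ⊗ᵒ H | coactB => B
  | mulC => C ⊗ᵒ C | oneC => .one | comulC => C | counitC => C | actC => H ⊗ᵒ C | coactC => C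
  | pair => B ⊗ᵒ C | pair' => B ⊗ᵒ C

open DblOp in
/-- The targets of the generating morphisms. -/
@[reducible] def cod : DblOp → Ob
  | mulH => H | oneH => H | comulH => H ⊗ᵒ H | counitH => .one | antiH => H | antiInvH => H
  | mulB => B | oneB => B | comulB => B ⊗ᵒ B | counitB => .one | actB => B | coactB => B ⊗ᵒ H
  | mulC => C | oneC => C | comulC => C ⊗ᵒ C | counitC => .one | actC => C | coactC => H ⊗ᵒ C
  | pair => .one | pair' => .one

end Dbl

instance : Signature DblOp := ⟨Dbl.dom, Dbl.cod⟩

namespace Dbl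

abbrev mH : Tm DblOp (H ⊗ᵒ H) H := .gen (.op DblOp.mulH)
abbrev eH : Tm DblOp .one H := .gen (.op DblOp.oneH)
abbrev dH : Tm DblOp H (H ⊗ᵒ H) := .gen (.op DblOp.comulH)
abbrev cH : Tm DblOp H .one := .gen (.op DblOp.counitH)
abbrev sH : Tm DblOp H H := .gen (.op DblOp.antiH)
abbrev tH : Tm DblOp H H := .gen (.op DblOp.antiInvH)
abbrev mB : Tm DblOp (B ⊗ᵒ B) B := .gen (.op DblOp.mulB)
abbrev eB : Tm DblOp .one B := .gen (.op DblOp.oneB)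
abbrev dB : Tm DblOp B (B ⊗ᵒ B) := .gen (.op DblOp.comulB)
abbrev cB : Tm DblOp B .one := .gen (.op DblOp.counitB)
abbrev aB : Tm DblOp (B ⊗ᵒ H) B := .gen (.op DblOp.actB)
abbrev nB : Tm DblOp B (B ⊗ᵒ H) := .gen (.op DblOp.coactB)
abbrev mC : Tm DblOp (C ⊗ᵒ C) C := .gen (.op DblOp.mulC)
abbrev eC : Tm DblOp .one C := .gen (.op DblOp.oneC)
abbrev dC : Tm DblOp C (C ⊗ᵒ C) := .gen (.op DblOp.comulC)
abbrev cC : Tm DblOp C .one := .gen (.op DblOp.counitC)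
abbrev aC : Tm DblOp (H ⊗ᵒ C) C := .gen (.op DblOp.actC)
abbrev nC : Tm DblOp C (H ⊗ᵒ C) := .gen (.op DblOp.coactC)
abbrev pr : Tm DblOp (B ⊗ᵒ C) .one := .gen (.op DblOp.pair)
abbrev pr' : Tm DblOp (B ⊗ᵒ C) .one := .gen (.op DblOp.pair')

/-- The braiding of `B` with itself in the category of right crossed modules. -/
abbrev braidB : Tm DblOp (B ⊗ᵒ B) (B ⊗ᵒ B) :=
  B ◁ᵗ nB ⊗≫ᵗ .braid B B ▷ᵗ H ⊗≫ᵗ B ◁ᵗ aB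

/-- The braiding of `C` with itself in the category of left crossed modules. -/
abbrev braidC : Tm DblOp (C ⊗ᵒ C) (C ⊗ᵒ C) :=
  nC ▷ᵗ C ⊗≫ᵗ H ◁ᵗ .braid C C ⊗≫ᵗ aC ▷ᵗ C

/-- The pairing `p ∘ (id ⊗ p ⊗ id)` of `B ⊗ B` and `C ⊗ C`. -/
abbrev pairTwo (p : Tm DblOp (B ⊗ᵒ C) .one) : Tm DblOp ((B ⊗ᵒ B) ⊗ᵒ (C ⊗ᵒ C)) .one :=
  .id ((B ⊗ᵒ B) ⊗ᵒ (C ⊗ᵒ C)) ⊗≫ᵗ B ◁ᵗ (p ▷ᵗ C) ⊗≫ᵗ p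

abbrev bialgH : Bialg DblOp H := ⟨mH, eH, dH, cH⟩
abbrev bialgB : Bialg DblOp B := ⟨mB, eB, dB, cB⟩
abbrev bialgC : Bialg DblOp C := ⟨mC, eC, dC, cC⟩

end Dbl

/-- Labels for the equations of the Hopf algebra `H`, the crossed modules `B` and `C`, and the
pairings. The equation `commute` expresses the double braiding of `B` and `C` by the coactions and
the actions of `H`; it is the condition under which `C ⊗ H ⊗ B` is a bialgebra. -/
inductive DblAx
  | assocH | oneMulH | mulOneH | coassocH | counitComulH | comulCounitH
  | mulComulH | oneComulH | mulCounitH | oneCounitH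
  | antiRight | antiInvLeft | antiInvRight | mulAntiInv
  | assocB | oneMulB | mulOneB | coassocB | counitComulB | comulCounitB
  | mulComulB | oneComulB | mulCounitB | oneCounitB
  | actAssocB | actOneB | coactAssocB | coactCounitB | crossedB
  | mulActB | mulCoactB | oneActB | oneCoactB
  | actComulB | coactComulB | actCounitB | coactComulCounitB
  | assocC | oneMulC | mulOneC | coassocC | counitComulC | comulCounitC
  | mulComulC | oneComulC | mulCounitC | oneCounitC
  | actAssocC | actOneC | coactAssocC | coactCounitC | crossedC
  | mulActC | mulCoactC | oneActC | oneCoactC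
  | actComulC | coactComulC | actCounitC | coactComulCounitC
  | commute
  | pairAct | pairMulRight | pairMulLeft | pairOneLeft | pairOneRight
  | pairConv | pairConv'

namespace Dbl

open DblAx in
/-- The equations with the given labels. -/
@[reducible] def ax : DblAx → Rule DblOp
  | assocH => .mulAssoc mH
  | oneMulH => .oneMul mH eH
  | mulOneH => .mulOne mH eH
  | coassocH => .comulAssoc dH
  | counitComulH => .counitComul dH cH
  | comulCounitH => .comulCounit dH cH
  | mulComulH => .mulComul mH dH
  | oneComulH => .oneComul eH dH
  | mulCounitH => .mulCounit mH cH
  | oneCounitH => .oneCounit eH cH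
  | antiRight => ⟨_, _, dH ≫ᵗ H ◁ᵗ sH ≫ᵗ mH, cH ≫ᵗ eH⟩
  | antiInvLeft => ⟨_, _, dH ≫ᵗ .braidInv H H ≫ᵗ H ◁ᵗ tH ≫ᵗ mH, cH ≫ᵗ eH⟩
  | antiInvRight => ⟨_, _, dH ≫ᵗ .braidInv H H ≫ᵗ tH ▷ᵗ H ≫ᵗ mH, cH ≫ᵗ eH⟩
  | mulAntiInv => ⟨_, _, mH ≫ᵗ tH, (tH ⊗ᵗ tH) ≫ᵗ .braidInv H H ≫ᵗ mH⟩
  | assocB => .mulAssoc mB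
  | oneMulB => .oneMul mB eB
  | mulOneB => .mulOne mB eB
  | coassocB => .comulAssoc dB
  | counitComulB => .counitComul dB cB
  | comulCounitB => .comulCounit dB cB
  | mulComulB => ⟨_, _, mB ≫ᵗ dB, (dB ⊗ᵗ dB) ⊗≫ᵗ B ◁ᵗ (braidB ▷ᵗ B) ⊗≫ᵗ (mB ⊗ᵗ mB)⟩
  | oneComulB => .oneComul eB dB
  | mulCounitB => .mulCounit mB cB
  | oneCounitB => .oneCounit eB cB
  | actAssocB => .actRAssoc mH aB
  | actOneB => .actROne eH aB
  | coactAssocB => .coactRAssoc dH nB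
  | coactCounitB => .coactRCounit cH nB
  | crossedB => ⟨_, _,
      B ◁ᵗ dH ⊗≫ᵗ .braid B H ▷ᵗ H ⊗≫ᵗ H ◁ᵗ (aB ≫ᵗ nB) ⊗≫ᵗ .braid H B ▷ᵗ H ⊗≫ᵗ B ◁ᵗ mH,
      (nB ⊗ᵗ dH) ⊗≫ᵗ B ◁ᵗ (.braid H H ▷ᵗ H) ⊗≫ᵗ (aB ⊗ᵗ mH)⟩
  | mulActB => ⟨_, _, mB ▷ᵗ H ≫ᵗ aB, .diagActR dH aB aB ≫ᵗ mB⟩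
  | mulCoactB => ⟨_, _, mB ≫ᵗ nB, .diagCoactR mH nB nB ≫ᵗ mB ▷ᵗ H⟩
  | oneActB => ⟨_, _, eB ▷ᵗ H ≫ᵗ aB, .left H ≫ᵗ cH ≫ᵗ eB⟩
  | oneCoactB => ⟨_, _, eB ≫ᵗ nB, .leftInv .one ≫ᵗ (eB ⊗ᵗ eH)⟩
  | actComulB => ⟨_, _, aB ≫ᵗ dB, dB ▷ᵗ H ≫ᵗ .diagActR dH aB aB⟩
  | coactComulB => ⟨_, _, nB ≫ᵗ dB ▷ᵗ H, dB ≫ᵗ .diagCoactR mH nB nB⟩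
  | actCounitB => ⟨_, _, aB ≫ᵗ cB, (cB ⊗ᵗ cH) ≫ᵗ .left .one⟩
  | coactComulCounitB => ⟨_, _, nB ≫ᵗ cB ▷ᵗ H, cB ≫ᵗ eH ≫ᵗ .leftInv H⟩
  | assocC => .mulAssoc mC
  | oneMulC => .oneMul mC eC
  | mulOneC => .mulOne mC eC
  | coassocC => .comulAssoc dC
  | counitComulC => .counitComul dC cC
  | comulCounitC => .comulCounit dC cC
  | mulComulC => ⟨_, _, mC ≫ᵗ dC, (dC ⊗ᵗ dC) ⊗≫ᵗ C ◁ᵗ (braidC ▷ᵗ C) ⊗≫ᵗ (mC ⊗ᵗ mC)⟩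
  | oneComulC => .oneComul eC dC
  | mulCounitC => .mulCounit mC cC
  | oneCounitC => .oneCounit eC cC
  | actAssocC => .actLAssoc mH aC
  | actOneC => .oneActL eH aC
  | coactAssocC => .coactLAssoc dH nC
  | coactCounitC => .coactLCounit cH nC
  | crossedC => ⟨_, _,
      dH ▷ᵗ C ⊗≫ᵗ H ◁ᵗ .braid H C ⊗≫ᵗ (aC ≫ᵗ nC) ▷ᵗ H ⊗≫ᵗ H ◁ᵗ .braid C H ⊗≫ᵗ mH ▷ᵗ C,
      (dH ⊗ᵗ nC) ⊗≫ᵗ H ◁ᵗ (.braid H H ▷ᵗ C) ⊗≫ᵗ (mH ⊗ᵗ aC)⟩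
  | mulActC => ⟨_, _, H ◁ᵗ mC ≫ᵗ aC, .diagActL dH aC aC ≫ᵗ mC⟩
  | mulCoactC => ⟨_, _, mC ≫ᵗ nC, .diagCoactL mH nC nC ≫ᵗ H ◁ᵗ mC⟩
  | oneActC => ⟨_, _, H ◁ᵗ eC ≫ᵗ aC, .right H ≫ᵗ cH ≫ᵗ eC⟩
  | oneCoactC => ⟨_, _, eC ≫ᵗ nC, .leftInv .one ≫ᵗ (eH ⊗ᵗ eC)⟩
  | actComulC => ⟨_, _, aC ≫ᵗ dC, H ◁ᵗ dC ≫ᵗ .diagActL dH aC aC⟩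
  | coactComulC => ⟨_, _, nC ≫ᵗ H ◁ᵗ dC, dC ≫ᵗ .diagCoactL mH nC nC⟩
  | actCounitC => ⟨_, _, aC ≫ᵗ cC, (cH ⊗ᵗ cC) ≫ᵗ .left .one⟩
  | coactComulCounitC => ⟨_, _, nC ≫ᵗ H ◁ᵗ cC, cC ≫ᵗ eH ≫ᵗ .rightInv H⟩
  | commute => ⟨_, _, (nB ⊗ᵗ nC) ⊗≫ᵗ B ◁ᵗ (.braid H H ▷ᵗ C) ⊗≫ᵗ (aB ⊗ᵗ aC),
      .braid B C ≫ᵗ .braid C B⟩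
  | pairAct => ⟨_, _, .assoc B H C ≫ᵗ B ◁ᵗ aC ≫ᵗ pr, aB ▷ᵗ C ≫ᵗ pr⟩
  | pairMulRight => ⟨_, _, B ◁ᵗ mC ≫ᵗ pr, (dB ≫ᵗ .braidInv B B) ▷ᵗ (C ⊗ᵒ C) ≫ᵗ pairTwo pr⟩
  | pairMulLeft => ⟨_, _, mB ▷ᵗ C ≫ᵗ pr, (braidB ⊗ᵗ (dC ≫ᵗ .braidInv C C)) ≫ᵗ pairTwo pr⟩
  | pairOneLeft => ⟨_, _, eB ▷ᵗ C ≫ᵗ pr, .left C ≫ᵗ cC⟩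
  | pairOneRight => ⟨_, _, B ◁ᵗ eC ≫ᵗ pr, .right B ≫ᵗ cB⟩
  | pairConv => ⟨_, _, (bialgB.tensor bialgC).convLeft pr pr', (bialgB.tensor bialgC).counit⟩
  | pairConv' => ⟨_, _, (bialgB.tensor bialgC).convLeft pr' pr, (bialgB.tensor bialgC).counit⟩

/-- The biproduct `H ⋉ B`. -/
abbrev biproductB : Bialg DblOp (H ⊗ᵒ B) where
  mul := (H ⊗ᵒ B) ◁ᵗ (dH ▷ᵗ B) ⊗≫ᵗ H ◁ᵗ (.braid B H ▷ᵗ (H ⊗ᵒ B)) ⊗≫ᵗ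
    (mH ⊗ᵗ (aB ▷ᵗ B)) ≫ᵗ H ◁ᵗ mB
  one := .leftInv .one ≫ᵗ (eH ⊗ᵗ eB)
  comul := H ◁ᵗ dB ≫ᵗ (dH ⊗ᵗ (nB ▷ᵗ B)) ⊗≫ᵗ H ◁ᵗ (.braid H B ▷ᵗ (H ⊗ᵒ B)) ⊗≫ᵗ
    (H ⊗ᵒ B) ◁ᵗ (mH ▷ᵗ B)
  counit := (cH ⊗ᵗ cB) ≫ᵗ .left .one

/-- The biproduct `C ⋊ H`. -/
abbrev biproductC : Bialg DblOp (C ⊗ᵒ H) where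
  mul := (C ◁ᵗ dH) ▷ᵗ (C ⊗ᵒ H) ⊗≫ᵗ (C ⊗ᵒ H) ◁ᵗ (.braid H C ▷ᵗ H) ⊗≫ᵗ
    ((C ◁ᵗ aC) ⊗ᵗ mH) ≫ᵗ mC ▷ᵗ H
  one := .leftInv .one ≫ᵗ (eC ⊗ᵗ eH)
  comul := dC ▷ᵗ H ≫ᵗ ((C ◁ᵗ nC) ⊗ᵗ dH) ⊗≫ᵗ (C ⊗ᵒ H) ◁ᵗ (.braid C H ▷ᵗ H) ⊗≫ᵗ
    (C ◁ᵗ mH) ▷ᵗ (C ⊗ᵒ H)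
  counit := (cC ⊗ᵗ cH) ≫ᵗ .left .one

/-- The bialgebra `C ⊗ H ⊗ B`. -/
abbrev double : Bialg DblOp (C ⊗ᵒ (H ⊗ᵒ B)) where
  mul :=
    ((C ◁ᵗ (dH ▷ᵗ B)) ⊗ᵗ (C ◁ᵗ (dH ▷ᵗ B))) ⊗≫ᵗ
    (C ⊗ᵒ H ⊗ᵒ H) ◁ᵗ (.braid B C ▷ᵗ (H ⊗ᵒ H ⊗ᵒ B)) ⊗≫ᵗ
    (C ⊗ᵒ H) ◁ᵗ ((.braid H C ⊗ᵗ .braid B H) ▷ᵗ (H ⊗ᵒ B)) ⊗≫ᵗ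
    ((C ◁ᵗ aC) ⊗ᵗ (mH ⊗ᵗ (aB ▷ᵗ B))) ≫ᵗ
    (mC ⊗ᵗ (H ◁ᵗ mB))
  one := .leftInv .one ≫ᵗ (eC ⊗ᵗ (.leftInv .one ≫ᵗ (eH ⊗ᵗ eB)))
  comul :=
    (dC ⊗ᵗ (H ◁ᵗ dB)) ≫ᵗ
    ((C ◁ᵗ nC) ⊗ᵗ (dH ⊗ᵗ (nB ▷ᵗ B))) ⊗≫ᵗ
    (C ⊗ᵒ H) ◁ᵗ ((.braid C H ⊗ᵗ .braid H B) ▷ᵗ (H ⊗ᵒ B)) ⊗≫ᵗ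
    ((C ◁ᵗ mH) ⊗ᵗ (.braid C B ⊗ᵗ (mH ▷ᵗ B))) ⊗≫ᵗ
    .id ((C ⊗ᵒ (H ⊗ᵒ B)) ⊗ᵒ (C ⊗ᵒ (H ⊗ᵒ B)))
  counit := (cC ⊗ᵗ ((cH ⊗ᵗ cB) ≫ᵗ .left .one)) ≫ᵗ .left .one

/-- The Hopf bimodule `H ⋉ B`. -/
abbrev bimodB : Bimod DblOp H where
  pt := H ⊗ᵒ B
  actL := .assocInv H H B ≫ᵗ mH ▷ᵗ B
  actR := .diagActR dH mH aB
  coactL := dH ▷ᵗ B ≫ᵗ .assoc H H B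
  coactR := .diagCoactR mH dH nB

/-- The Hopf bimodule `C ⋊ H`. -/
abbrev bimodC : Bimod DblOp H where
  pt := C ⊗ᵒ H
  actL := .diagActL dH aC mH
  actR := .assoc C H H ≫ᵗ C ◁ᵗ mH
  coactL := .diagCoactL mH nC dH
  coactR := C ◁ᵗ dH ≫ᵗ .assocInv C H H

/-- The Hopf bimodule `C ⊗ H ⊗ B`. -/
abbrev bimodZ : Bimod DblOp H where
  pt := C ⊗ᵒ (H ⊗ᵒ B)
  actL := .diagActL dH aC bimodB.actL
  actR := .assoc C (H ⊗ᵒ B) H ≫ᵗ C ◁ᵗ bimodB.actR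
  coactL := .diagCoactL mH nC bimodB.coactL
  coactR := C ◁ᵗ bimodB.coactR ≫ᵗ .assocInv C (H ⊗ᵒ B) H

/-- `(c ⊗ h) ⊗ (k ⊗ b) ↦ c ⊗ h k ⊗ b`. -/
abbrev lamZ : Tm DblOp ((C ⊗ᵒ H) ⊗ᵒ (H ⊗ᵒ B)) (C ⊗ᵒ (H ⊗ᵒ B)) :=
  .id ((C ⊗ᵒ H) ⊗ᵒ (H ⊗ᵒ B)) ⊗≫ᵗ C ◁ᵗ (mH ▷ᵗ B)

/-- `c ⊗ h ⊗ b ↦ (c ⊗ h₍₁₎) ⊗ (h₍₂₎ ⊗ b)`. -/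
abbrev rhoZ : Tm DblOp (C ⊗ᵒ (H ⊗ᵒ B)) ((C ⊗ᵒ H) ⊗ᵒ (H ⊗ᵒ B)) :=
  C ◁ᵗ (dH ▷ᵗ B) ⊗≫ᵗ .id ((C ⊗ᵒ H) ⊗ᵒ (H ⊗ᵒ B))

/-- The section `c ⊗ h ⊗ b ↦ (c ⊗ 1) ⊗ (h ⊗ b)` of `lamZ`. -/
abbrev secZ : Tm DblOp (C ⊗ᵒ (H ⊗ᵒ B)) ((C ⊗ᵒ H) ⊗ᵒ (H ⊗ᵒ B)) :=
  (.rightInv C ≫ᵗ C ◁ᵗ eH) ▷ᵗ (H ⊗ᵒ B)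

/-- The retraction `(c ⊗ h) ⊗ (k ⊗ b) ↦ c ⊗ ε(h) k ⊗ b` of `rhoZ`. -/
abbrev retZ : Tm DblOp ((C ⊗ᵒ H) ⊗ᵒ (H ⊗ᵒ B)) (C ⊗ᵒ (H ⊗ᵒ B)) :=
  (C ◁ᵗ cH ≫ᵗ .right C) ▷ᵗ (H ⊗ᵒ B)

abbrev inclB : Tm DblOp H (H ⊗ᵒ B) := .rightInv H ≫ᵗ H ◁ᵗ eB
abbrev projB : Tm DblOp (H ⊗ᵒ B) H := H ◁ᵗ cB ≫ᵗ .right H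
abbrev inclC : Tm DblOp H (C ⊗ᵒ H) := .leftInv H ≫ᵗ eC ▷ᵗ H
abbrev projC : Tm DblOp (C ⊗ᵒ H) H := cC ▷ᵗ H ≫ᵗ .left H
abbrev inclZ : Tm DblOp H (C ⊗ᵒ (H ⊗ᵒ B)) := inclC ≫ᵗ C ◁ᵗ inclB
abbrev projZ : Tm DblOp (C ⊗ᵒ (H ⊗ᵒ B)) H := C ◁ᵗ projB ≫ᵗ projC

/-- `c ⊗ h ⊗ b ↦ (h₍₂₎ ⊗ b) ⊗ (S⁻¹(h₍₁₎) ▹ c ⊗ 1)`, which induces a left inverse of the braiding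
`X ⊗_H Y ⟶ Y ⊗_H X`. -/
abbrev secBraid : Tm DblOp (C ⊗ᵒ (H ⊗ᵒ B)) ((H ⊗ᵒ B) ⊗ᵒ (C ⊗ᵒ H)) :=
  C ◁ᵗ (dH ▷ᵗ B) ⊗≫ᵗ .braidInv H C ▷ᵗ (H ⊗ᵒ B) ⊗≫ᵗ tH ▷ᵗ (C ⊗ᵒ (H ⊗ᵒ B)) ⊗≫ᵗ
    aC ▷ᵗ (H ⊗ᵒ B) ≫ᵗ .braidInv (H ⊗ᵒ B) C ⊗≫ᵗ ((H ⊗ᵒ B) ⊗ᵒ C) ◁ᵗ eH ⊗≫ᵗ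
    .id ((H ⊗ᵒ B) ⊗ᵒ (C ⊗ᵒ H))

/-- `(h ⊗ b) ⊗ (c ⊗ k) ↦ (h ⊗ b) ⊗ k₍₂₎ ⊗ (S⁻¹(k₍₁₎) ▹ c ⊗ 1)`. The action of the middle factor on
the right gives back the argument, since `k₍₂₎ ▹ S⁻¹(k₍₁₎) ▹ c = ε(k₍₁₎) c`, up to braidings. -/
abbrev midBraid : Tm DblOp ((H ⊗ᵒ B) ⊗ᵒ (C ⊗ᵒ H)) (((H ⊗ᵒ B) ⊗ᵒ H) ⊗ᵒ (C ⊗ᵒ H)) :=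
  (H ⊗ᵒ B) ◁ᵗ (C ◁ᵗ dH ⊗≫ᵗ .braidInv H C ▷ᵗ H ⊗≫ᵗ (tH ▷ᵗ C ≫ᵗ aC) ▷ᵗ H ≫ᵗ .braidInv H C ⊗≫ᵗ
    (H ⊗ᵒ C) ◁ᵗ eH) ⊗≫ᵗ .id (((H ⊗ᵒ B) ⊗ᵒ H) ⊗ᵒ (C ⊗ᵒ H))

/-- `b ⊗ c ↦ (1 ⊗ b) ⊗ (c ⊗ 1)`. -/
abbrev unitBC : Tm DblOp (B ⊗ᵒ C) ((H ⊗ᵒ B) ⊗ᵒ (C ⊗ᵒ H)) :=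
  (.leftInv B ≫ᵗ eH ▷ᵗ B) ⊗ᵗ (.rightInv C ≫ᵗ C ◁ᵗ eH)

/-- `(h ⊗ b) ⊗ (c ⊗ k) ↦ ε(h) b ⊗ c ε(k)`. -/
abbrev counitBC : Tm DblOp ((H ⊗ᵒ B) ⊗ᵒ (C ⊗ᵒ H)) (B ⊗ᵒ C) :=
  (cH ▷ᵗ B ≫ᵗ .left B) ⊗ᵗ (C ◁ᵗ cH ≫ᵗ .right C)

end Dbl

section Double

variable {H : 𝒞} [HopfObj H] {B C : 𝒞} [MonObj B] [ComonObj B] [MonObj C] [ComonObj C]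

namespace Dbl

/-- The colours `0`, `1`, `2` stand for `H`, `B`, `C`. -/
@[reducible] def objects (H B C : 𝒞) : ℕ → 𝒞
  | 0 => H
  | 1 => B
  | _ => C

variable (M : RightCrossedModule H B) (N : LeftCrossedModule H C)

open DblOp in
/-- The interpretation of the generating morphisms, where the pairings and the inverse of the
antipode are arbitrary morphisms. -/
@[reducible] def model (ρ ρ' : B ⊗ C ⟶ 𝟙_ 𝒞) (t : H ⟶ H) : Model DblOp 𝒞 where
  obj := objects H B C
  mor := fun
    | mulH => μ[H] | oneH => η[H] | comulH => Δ[H] | counitH => ε[H]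
    | antiH => 𝒮[H] | antiInvH => t
    | mulB => μ[B] | oneB => η[B] | comulB => Δ[B] | counitB => ε[B]
    | actB => M.act | coactB => M.coact
    | mulC => μ[C] | oneC => η[C] | comulC => Δ[C] | counitC => ε[C]
    | actC => N.act | coactC => N.coact
    | pair => ρ | pair' => ρ'

open DblAx in
/-- The equations that express that `B` and `C` are bialgebras in the categories of crossed
modules. -/
def crossedAx : DblAx → Bool
  | antiInvLeft | antiInvRight | mulAntiInv | commute | pairAct | pairMulRight | pairMulLeft
  | pairOneLeft | pairOneRight | pairConv | pairConv' => false
  | _ => true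

variable {M N}

theorem holds_crossedAx (hB : M.IsBialgebra) (hC : N.IsBialgebra) (ρ ρ' : B ⊗ C ⟶ 𝟙_ 𝒞)
    (t : H ⟶ H) (k : DblAx) (hk : crossedAx k = true) : (model M N ρ ρ' t).Holds (ax k) := by
  cases k
  case assocH => exact MonObj.mul_assoc H
  case oneMulH => exact MonObj.one_mul H
  case mulOneH => exact MonObj.mul_one H
  case coassocH =>
    exact (by simp : Δ[H] ≫ Δ[H] ▷ H ≫ (α_ H H H).hom = Δ[H] ≫ H ◁ Δ[H])
  case counitComulH => exact ComonObj.counit_comul H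
  case comulCounitH => exact ComonObj.comul_counit H
  case mulComulH => exact BimonObj.mul_comul H
  case oneComulH => exact BimonObj.one_comul H
  case mulCounitH => exact BimonObj.mul_counit H
  case oneCounitH => exact BimonObj.one_counit H
  case antiRight => exact HopfObj.antipode_right H
  case assocB => exact MonObj.mul_assoc B
  case oneMulB => exact MonObj.one_mul B
  case mulOneB => exact MonObj.mul_one B
  case coassocB =>
    exact (by simp : Δ[B] ≫ Δ[B] ▷ B ≫ (α_ B B B).hom = Δ[B] ≫ B ◁ Δ[B])
  case counitComulB => exact ComonObj.counit_comul B
  case comulCounitB => exact ComonObj.comul_counit B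
  case mulComulB => exact hB.mul_comul
  case oneComulB => exact hB.one_comul
  case mulCounitB => exact hB.mul_counit
  case oneCounitB => exact hB.one_counit
  case actAssocB => exact M.act_mul.symm
  case actOneB => exact M.act_one
  case coactAssocB => exact M.coact_comul.symm
  case coactCounitB => exact M.coact_counit
  case crossedB => exact M.crossed.symm
  case mulActB => exact hB.mul_act
  case mulCoactB => exact hB.mul_coact
  case oneActB => exact hB.one_act
  case oneCoactB => exact hB.one_coact
  case actComulB => exact hB.act_comul
  case coactComulB => exact hB.coact_comul
  case actCounitB => exact hB.act_counit
  case coactComulCounitB => exact hB.coact_counit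
  case assocC => exact MonObj.mul_assoc C
  case oneMulC => exact MonObj.one_mul C
  case mulOneC => exact MonObj.mul_one C
  case coassocC =>
    exact (by simp : Δ[C] ≫ Δ[C] ▷ C ≫ (α_ C C C).hom = Δ[C] ≫ C ◁ Δ[C])
  case counitComulC => exact ComonObj.counit_comul C
  case comulCounitC => exact ComonObj.comul_counit C
  case mulComulC => exact hC.mul_comul
  case oneComulC => exact hC.one_comul
  case mulCounitC => exact hC.mul_counit
  case oneCounitC => exact hC.one_counit
  case actAssocC => exact N.mul_act.symm
  case actOneC => exact N.one_act
  case coactAssocC => exact N.coact_comul.symm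
  case coactCounitC => exact N.coact_counit
  case crossedC => exact N.crossed.symm
  case mulActC => exact hC.act_mul
  case mulCoactC => exact hC.mul_coact
  case oneActC => exact hC.act_one
  case oneCoactC => exact hC.one_coact
  case actComulC => exact hC.act_comul
  case coactComulC => exact hC.coact_comul
  case actCounitC => exact hC.act_counit
  case coactComulCounitC => exact hC.coact_counit
  all_goals cases hk

end Dbl

end Double

namespace Diagram

variable {G : Type} [Signature G]

/-- The structure morphisms denoted by formal ones. -/
@[reducible] def Bialg.data (S : Model G 𝒞) {A : Ob} (D : Bialg G A) : BialgData (A.den S.obj) :=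
  ⟨S.den D.mul, S.den D.one, S.den D.comul, S.den D.counit⟩

/-- The axioms of a bialgebra, as equations between formal morphisms. -/
theorem Bialg.isBialgebra {S : Model G 𝒞} {A : Ob} {D : Bialg G A}
    (mul_assoc : S.Holds (.mulAssoc D.mul)) (one_mul : S.Holds (.oneMul D.mul D.one))
    (mul_one : S.Holds (.mulOne D.mul D.one)) (comul_assoc : S.Holds (.comulAssoc D.comul))
    (counit_comul : S.Holds (.counitComul D.comul D.counit))
    (comul_counit : S.Holds (.comulCounit D.comul D.counit))
    (mul_comul : S.Holds (.mulComul D.mul D.comul)) (one_comul : S.Holds (.oneComul D.one D.comul))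
    (mul_counit : S.Holds (.mulCounit D.mul D.counit))
    (one_counit : S.Holds (.oneCounit D.one D.counit)) : (D.data S).IsBialgebra :=
  ⟨{ mul := S.den D.mul
     one := S.den D.one
     comul := S.den D.comul
     counit := S.den D.counit
     one_mul := one_mul
     mul_one := mul_one
     mul_assoc := mul_assoc
     counit_comul := counit_comul
     comul_counit := comul_counit
     comul_assoc := by
       have : S.den D.comul ≫ S.den D.comul ▷ _ ≫ (α_ _ _ _).hom = _ := comul_assoc
       exact this.symm
     mul_comul := mul_comul
     one_comul := one_comul
     mul_counit := mul_counit
     one_counit := one_counit }, rfl, rfl, rfl, rfl⟩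

end Diagram

/-! ### The biproduct bialgebras -/

section Double

variable {H : 𝒞} [HopfObj H] {B C : 𝒞} [MonObj B] [ComonObj B] [MonObj C] [ComonObj C]
variable {M : RightCrossedModule H B} {N : LeftCrossedModule H C}

open Dbl

/-- Equations that can be derived from those of `B` and `C` hold, with any morphisms in the place
of the pairings and of the inverse of the antipode. -/
theorem holds_of_check (hB : M.IsBialgebra) (hC : N.IsBialgebra) {ρ ρ' : B ⊗ C ⟶ 𝟙_ 𝒞} {t : H ⟶ H}
    {r : Rule DblOp} (s s' : Script DblAx DblOp) (h : r.check ax crossedAx s s' = true) :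
    (model M N ρ ρ' t).Holds r :=
  (model M N ρ ρ' t).holds_of_check (holds_crossedAx hB hC ρ ρ' t) s s' h

set_option maxRecDepth 4000 in
theorem biproductB_isBialgebra (hB : M.IsBialgebra) (hC : N.IsBialgebra)
    (ρ ρ' : B ⊗ C ⟶ 𝟙_ 𝒞) (t : H ⟶ H) : (biproductB.data (model M N ρ ρ' t)).IsBialgebra := by
  refine Bialg.isBialgebra ?_ ?_ ?_ ?_ ?_ ?_ ?_ ?_ ?_ ?_
  · exact holds_of_check hB hC
      [(.natL .mulB 0, 4, 1), (.natL .actB 0, 3, 1), (.ax .assocH, 2, 0), (.ax .mulActB, 7, 3),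
        (.ax .assocB, 11, 3), (.ax .actAssocB, 6, 3)]
      [(.ax .mulComulH, 2, 2), (.ax .coassocH, 0, 4)] (by decide +kernel)
  · exact holds_of_check hB hC
      [(.natL .oneB 0, 1, 1), (.ax .oneMulH, 0, 0), (.ax .oneActB, 1, 1),
        (.ax .comulCounitH, 0, 0), (.ax .oneMulB, 0, 1)]
      [] (by decide +kernel)
  · exact holds_of_check hB hC
      [(.ax .oneComulH, 0, 2), (.natR 1 .oneH, 0, 1), (.ax .mulOneH, 0, 0), (.ax .mulOneB, 1, 2),
        (.ax .actOneB, 0, 1)]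
      [] (by decide +kernel)
  · exact holds_of_check hB hC
      [(.ax .coassocH, 1, 0), (.ax .coactComulB, 3, 3), (.ax .coassocB, 0, 1),
        (.ax .coactAssocB, 4, 3)]
      [(.ax .mulComulH, 4, 2), (.natL .mulH 1, 8, 3), (.ax .assocH, 12, 4)] (by decide +kernel)
  · exact holds_of_check hB hC
      [(.ax .counitComulH, 1, 0), (.ax .coactComulCounitB, 1, 1), (.ax .mulOneH, 2, 0),
        (.ax .counitComulB, 0, 1)]
      [] (by decide +kernel)
  · exact holds_of_check hB hC
      [(.natL .mulH 1, 4, 2), (.ax .mulCounitH, 6, 3), (.ax .comulCounitH, 1, 0),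
        (.ax .comulCounitB, 0, 1), (.ax .coactCounitB, 0, 1)]
      [] (by decide +kernel)
  · exact holds_of_check hB hC
      [(.ax .mulComulH, 2, 0), (.natL .mulH 1, 6, 1), (.ax .assocH, 12, 2),
        (.ax .coassocH, 0, 2), (.ax .mulComulB, 8, 3), (.ax .mulCoactB, 13, 3),
        (.natR 0 .mulB, 17, 2), (.natR 0 .mulB, 19, 1), (.ax .actComulB, 7, 3),
        (.natL .actB 1, 11, 4), (.ax .actAssocB, 18, 6), (.ax .coactAssocB, 12, 6),
        (.inv .assocH, 24, 4), (.inv .coassocH, 1, 3), (.natLInv .comulB 0, 3, 1),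
        (.natR 1 .comulH, 2, 2), (.ax .crossedB, 15, 2), (.natL .mulH 1, 19, 3),
        (.natR 0 .actB, 18, 1), (.ax .assocH, 27, 4), (.ax .coassocH, 1, 3)]
      [(.natL .mulH 0, 4, 2), (.natL .mulH 1, 17, 3), (.ax .mulComulH, 8, 7),
        (.natR 1 .mulH, 11, 6), (.ax .assocH, 18, 4), (.ax .coassocH, 1, 3)] (by decide +kernel)
  · exact holds_of_check hB hC
      [(.ax .oneComulH, 0, 0), (.natL .oneH 1, 1, 1), (.ax .oneMulH, 4, 2),
        (.ax .oneComulB, 1, 1), (.ax .oneCoactB, 1, 1)]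
      [] (by decide +kernel)
  · exact holds_of_check hB hC
      [(.ax .mulCounitH, 2, 0), (.ax .counitComulH, 0, 2), (.ax .mulCounitB, 2, 0),
        (.ax .actCounitB, 1, 0)]
      [] (by decide +kernel)
  · exact holds_of_check hB hC
      [(.ax .oneCounitH, 0, 0), (.ax .oneCounitB, 0, 0)]
      [] (by decide +kernel)

theorem biproduct_isBialgebra (hB : M.IsBialgebra) (hC : N.IsBialgebra) :
    M.biproduct.IsBialgebra :=
  biproductB_isBialgebra (N := N) hB hC ((ε[B] ⊗ₘ ε[C]) ≫ (λ_ _).hom)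
    ((ε[B] ⊗ₘ ε[C]) ≫ (λ_ _).hom) (𝟙 H)

end Double

section Double

variable {H : 𝒞} [HopfObj H] {B C : 𝒞} [MonObj B] [ComonObj B] [MonObj C] [ComonObj C]
variable {M : RightCrossedModule H B} {N : LeftCrossedModule H C}

open Dbl

/-- The version of `holds_of_check` with additional equations. -/
theorem holds_of_check_extra (hB : M.IsBialgebra) (hC : N.IsBialgebra) {ρ ρ' : B ⊗ C ⟶ 𝟙_ 𝒞}
    {t : H ⟶ H} {extra : DblAx → Bool}
    (hS : ∀ k, extra k = true → (model M N ρ ρ' t).Holds (ax k)) {r : Rule DblOp}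
    (s s' : Script DblAx DblOp) (h : r.check ax (fun k => crossedAx k || extra k) s s' = true) :
    (model M N ρ ρ' t).Holds r :=
  (model M N ρ ρ' t).holds_of_check
    (fun k hk => (Bool.or_eq_true_iff.1 hk).elim (holds_crossedAx hB hC ρ ρ' t k) (hS k)) s s' h

set_option maxRecDepth 4000 in
theorem biproductC_isBialgebra (hB : M.IsBialgebra) (hC : N.IsBialgebra)
    (ρ ρ' : B ⊗ C ⟶ 𝟙_ 𝒞) (t : H ⟶ H) : (biproductC.data (model M N ρ ρ' t)).IsBialgebra := by
  refine Bialg.isBialgebra ?_ ?_ ?_ ?_ ?_ ?_ ?_ ?_ ?_ ?_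
  · exact holds_of_check hB hC
      [(.ax .mulComulH, 3, 2), (.natL .mulH 2, 7, 3), (.ax .assocH, 9, 4), (.ax .assocC, 11, 0)]
      [(.natR 0 .mulC, 4, 1), (.natR 0 .actC, 2, 2), (.ax .mulActC, 8, 1), (.ax .coassocH, 0, 1),
        (.ax .actAssocC, 8, 3)] (by decide +kernel)
  · exact holds_of_check hB hC
      [(.ax .oneComulH, 1, 1), (.natL .oneH 2, 2, 2), (.ax .oneMulH, 1, 2), (.ax .oneMulC, 0, 0),
        (.ax .actOneC, 0, 0)]
      [] (by decide +kernel)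
  · exact holds_of_check hB hC
      [(.natR 0 .oneC, 0, 1), (.ax .mulOneH, 0, 1), (.ax .oneActC, 1, 1),
        (.ax .counitComulH, 0, 1), (.ax .mulOneC, 0, 0)]
      [] (by decide +kernel)
  · exact holds_of_check hB hC
      [(.ax .mulComulH, 4, 1), (.ax .coassocH, 2, 3), (.ax .coassocC, 0, 0)]
      [(.ax .coactComulC, 1, 1), (.ax .assocH, 5, 1), (.ax .coactAssocC, 2, 2)] (by decide +kernel)
  · exact holds_of_check hB hC
      [(.natR 2 .mulH, 4, 0), (.ax .mulCounitH, 6, 0), (.ax .counitComulH, 2, 3),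
        (.ax .counitComulC, 0, 0), (.ax .coactCounitC, 0, 0)]
      [] (by decide +kernel)
  · exact holds_of_check hB hC
      [(.ax .comulCounitH, 2, 3), (.ax .coactComulCounitC, 1, 1), (.ax .oneMulH, 2, 1),
        (.ax .comulCounitC, 0, 0)]
      [] (by decide +kernel)
  · exact holds_of_check hB hC
      [(.ax .mulComulH, 3, 2), (.natR 2 .mulH, 6, 1), (.ax .mulComulC, 7, 0),
        (.ax .mulCoactC, 12, 2), (.natL .mulC 0, 16, 3), (.natL .mulC 0, 18, 4),
        (.ax .assocH, 15, 2), (.ax .actComulC, 2, 1), (.natR 2 .actC, 5, 0),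
        (.ax .coassocH, 0, 1), (.ax .actAssocC, 17, 1), (.ax .coactAssocC, 11, 1),
        (.inv .assocH, 20, 6), (.inv .coassocH, 1, 2), (.natRInv 0 .comulC, 3, 4),
        (.natL .comulH 2, 1, 2), (.ax .crossedC, 11, 5), (.natR 2 .mulH, 21, 2),
        (.ax .assocH, 23, 2), (.ax .coassocH, 2, 2)]
      [(.natR 0 .mulH, 9, 4), (.natR 2 .mulH, 17, 2), (.ax .mulComulH, 4, 1),
        (.natL .mulH 2, 8, 2), (.ax .assocH, 26, 3), (.ax .coassocH, 2, 3)] (by decide +kernel)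
  · exact holds_of_check hB hC
      [(.ax .oneComulH, 1, 1), (.natR 2 .oneH, 1, 0), (.ax .mulOneH, 4, 1),
        (.ax .oneComulC, 0, 0), (.ax .oneCoactC, 1, 1)]
      [] (by decide +kernel)
  · exact holds_of_check hB hC
      [(.ax .mulCounitH, 3, 2), (.ax .comulCounitH, 0, 1), (.ax .mulCounitC, 2, 0),
        (.ax .actCounitC, 0, 1)]
      [] (by decide +kernel)
  · exact holds_of_check hB hC
      [(.ax .oneCounitH, 1, 1), (.ax .oneCounitC, 0, 0)]
      [] (by decide +kernel)

/-- The equation for the double braiding of `B` and `C`. -/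
def commuteAx : DblAx → Bool
  | .commute => true
  | _ => false

set_option maxRecDepth 4000 in
/-- The equation for the double braiding of `B` and `C` is needed only for the compatibility of the
comultiplication with the multiplication. -/
theorem double_isBialgebra (hB : M.IsBialgebra) (hC : N.IsBialgebra)
    (ρ ρ' : B ⊗ C ⟶ 𝟙_ 𝒞) (t : H ⟶ H) (h : (model M N ρ ρ' t).Holds (ax .commute)) :
    (double.data (model M N ρ ρ' t)).IsBialgebra := by
  refine Bialg.isBialgebra ?_ ?_ ?_ ?_ ?_ ?_ ?_ ?_ ?_ ?_
  · exact holds_of_check hB hC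
      [(.natL .mulB 2, 9, 2), (.natL .mulB 0, 11, 3), (.natL .actB 2, 7, 3),
        (.natL .actB 0, 14, 4), (.ax .mulComulH, 6, 2), (.natL .mulH 2, 10, 3),
        (.ax .assocH, 24, 3), (.ax .coassocH, 0, 4), (.ax .mulActB, 20, 6), (.ax .assocB, 24, 6),
        (.ax .actAssocB, 19, 6), (.ax .assocC, 11, 0)]
      [(.natR 1 .mulC, 8, 2), (.natR 0 .mulC, 10, 1), (.natR 1 .actC, 5, 3),
        (.natR 0 .actC, 14, 3), (.ax .mulComulH, 5, 6), (.natR 1 .mulH, 8, 5),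
        (.ax .coassocH, 0, 7), (.ax .mulActC, 20, 1), (.ax .coassocH, 0, 1),
        (.ax .actAssocC, 20, 3)] (by decide +kernel)
  · exact holds_of_check hB hC
      [(.natL .oneB 2, 2, 2), (.natL .oneB 0, 2, 3), (.ax .oneComulH, 1, 1),
        (.natL .oneH 2, 2, 2), (.ax .oneMulH, 2, 3), (.ax .oneActB, 5, 2),
        (.ax .comulCounitH, 2, 3), (.ax .oneMulB, 4, 2), (.ax .oneMulC, 0, 0),
        (.ax .actOneC, 0, 0)]
      [] (by decide +kernel)
  · exact holds_of_check hB hC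
      [(.natR 1 .oneC, 0, 2), (.natR 0 .oneC, 0, 1), (.ax .oneComulH, 0, 3),
        (.natR 1 .oneH, 0, 2), (.ax .mulOneH, 0, 1), (.ax .mulOneB, 1, 3), (.ax .actOneB, 0, 2),
        (.ax .oneActC, 1, 1), (.ax .counitComulH, 0, 1), (.ax .mulOneC, 0, 0)]
      [] (by decide +kernel)
  · exact holds_of_check hB hC
      [(.ax .mulComulH, 7, 1), (.natL .mulH 1, 11, 2), (.natR 2 .mulH, 10, 0),
        (.ax .assocH, 18, 6), (.ax .coassocH, 3, 3), (.ax .coactComulB, 5, 6),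
        (.ax .coassocB, 1, 3), (.ax .coactAssocB, 6, 6), (.ax .coassocC, 0, 0)]
      [(.ax .mulComulH, 7, 5), (.natL .mulH 1, 11, 6), (.natR 2 .mulH, 10, 4),
        (.ax .assocH, 18, 9), (.ax .coactComulC, 2, 1), (.ax .assocH, 6, 1),
        (.ax .coactAssocC, 3, 2)] (by decide +kernel)
  · exact holds_of_check hB hC
      [(.natR 2 .mulH, 7, 0), (.ax .mulCounitH, 9, 0), (.ax .counitComulH, 3, 3),
        (.ax .coactComulCounitB, 3, 4), (.ax .mulOneH, 4, 3), (.ax .counitComulB, 1, 3),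
        (.ax .counitComulC, 0, 0), (.ax .coactCounitC, 0, 0)]
      [] (by decide +kernel)
  · exact holds_of_check hB hC
      [(.ax .mulCounitH, 7, 5), (.ax .comulCounitH, 3, 3), (.ax .comulCounitB, 1, 3),
        (.ax .coactCounitB, 2, 4), (.ax .coactComulCounitC, 1, 1), (.ax .oneMulH, 2, 1),
        (.ax .comulCounitC, 0, 0)]
      [] (by decide +kernel)
  · exact holds_of_check_extra (extra := commuteAx) hB hC
      (by rintro ⟨⟩ hk <;> first | exact h | cases hk)
      [(.ax .mulComulH, 6, 2), (.natL .mulH 1, 10, 3), (.natR 2 .mulH, 9, 1),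
        (.ax .assocH, 18, 6), (.ax .coassocH, 0, 4), (.ax .mulComulB, 12, 5),
        (.ax .mulCoactB, 17, 5), (.natR 0 .mulB, 21, 4), (.natR 0 .mulB, 23, 3),
        (.natR 2 .mulB, 25, 2), (.ax .actComulB, 10, 6), (.natL .actB 1, 14, 7),
        (.ax .actAssocB, 29, 8), (.ax .coactAssocB, 16, 8), (.ax .mulComulC, 14, 0),
        (.ax .mulCoactC, 19, 2), (.natL .mulC 0, 23, 3), (.natL .mulC 0, 25, 4),
        (.natL .mulC 1, 27, 5), (.natL .mulC 1, 51, 3), (.ax .assocH, 22, 2),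
        (.ax .actComulC, 7, 1), (.natR 2 .actC, 10, 0), (.ax .coassocH, 0, 1),
        (.ax .actAssocC, 45, 1), (.ax .coactAssocC, 18, 1), (.inv .assocH, 33, 6),
        (.inv .coassocH, 1, 2), (.natLInv .comulB 2, 5, 5), (.natRInv 1 .comulC, 6, 6),
        (.natL .comulH 2, 1, 2), (.ax .crossedC, 40, 5), (.natR 2 .mulH, 52, 2),
        (.natL .actC 0, 55, 4), (.natL .actC 1, 57, 5), (.ax .assocH, 54, 2),
        (.ax .coassocH, 1, 2), (.inv .assocH, 33, 13), (.inv .coassocH, 4, 8),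
        (.natRInv 1 .coactC, 9, 7), (.natR 1 .comulH, 5, 7), (.natL .comulH 2, 1, 2),
        (.natL .comulH 0, 42, 6), (.ax .crossedB, 27, 9), (.natL .mulH 1, 31, 10),
        (.natR 0 .actB, 30, 8), (.natR 2 .actB, 58, 4), (.natR 0 .actB, 60, 3),
        (.ax .assocH, 54, 9), (.ax .coassocH, 2, 6)]
      [(.natR 1 .mulH, 17, 6), (.natR 0 .mulH, 30, 4), (.natL .mulH 2, 9, 4),
        (.natL .mulH 0, 30, 6), (.natL .mulH 0, 32, 7), (.natL .mulH 1, 34, 8),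
        (.ax .mulComulH, 7, 1), (.natL .mulH 2, 11, 2), (.inv .actAssocC, 10, 1),
        (.inv .coactAssocC, 2, 1), (.ax .mulComulH, 8, 6), (.natL .mulH 2, 11, 6),
        (.natL .mulH 0, 41, 8), (.natL .mulH 0, 43, 9), (.natL .mulH 1, 45, 10),
        (.natL .mulH 2, 11, 8), (.natL .mulH 0, 34, 10), (.natL .mulH 0, 36, 11),
        (.natL .mulH 1, 38, 12), (.natL .mulH 2, 40, 13), (.inv .actAssocC, 52, 11),
        (.inv .coactAssocB, 4, 5), (.ax .mulComulH, 22, 17), (.natR 1 .mulH, 25, 16),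
        (.inv .actAssocB, 25, 18), (.inv .coactAssocB, 17, 16), (.ax .mulComulH, 23, 13),
        (.natR 1 .mulH, 26, 12), (.natR 0 .mulH, 44, 7), (.natR 0 .mulH, 46, 6),
        (.natR 0 .mulH, 48, 5), (.natR 0 .mulH, 50, 4), (.natR 1 .mulH, 26, 14),
        (.natR 0 .mulH, 57, 7), (.natR 0 .mulH, 59, 6), (.natR 0 .mulH, 61, 5),
        (.natR 0 .mulH, 63, 4), (.natR 2 .mulH, 51, 3), (.natR 1 .mulH, 53, 2),
        (.natR 2 .mulH, 67, 3), (.inv .actAssocB, 69, 2), (.inv .coactAssocC, 16, 13),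
        (.ax .coassocH, 6, 4), (.ax .coassocH, 6, 10), (.natL .coactB 2, 4, 5),
        (.natL .comulH 2, 7, 5), (.natL .coactB 0, 36, 7), (.natL .coactB 0, 37, 8),
        (.natL .coactC 0, 3, 2), (.natL .coactC 0, 9, 9), (.natR 1 .coactC, 8, 7),
        (.natR 0 .coactC, 30, 6), (.natR 0 .coactC, 53, 6), (.natL .coactC 2, 18, 3),
        (.natLInv .actB 0, 12, 12), (.natRInv 2 .actB, 42, 4), (.natRInv 2 .actB, 69, 2),
        (.natLInv .actC 0, 49, 6), (.natRInv 2 .actC, 16, 2), (.ax .commute, 33, 6),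
        (.natL .actB 0, 42, 10), (.natL .actC 0, 57, 4), (.natR 2 .actC, 16, 2),
        (.ax .assocH, 21, 3), (.ax .assocH, 54, 10), (.ax .actAssocB, 43, 13),
        (.ax .coactAssocB, 8, 12), (.ax .actAssocC, 18, 1), (.ax .coactAssocC, 2, 1)]
        (by decide +kernel)
  · exact (Model.holds_symm _ _).1 (holds_of_check hB hC
      []
      [(.ax .oneComulH, 1, 1), (.natL .oneH 1, 2, 2), (.natR 2 .oneH, 1, 0),
        (.ax .oneMulH, 6, 4), (.ax .mulOneH, 6, 1), (.ax .oneComulB, 1, 1),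
        (.ax .oneCoactB, 1, 1), (.natR 2 .oneB, 1, 0), (.ax .oneComulC, 0, 0),
        (.ax .oneCoactC, 1, 1)] (by decide +kernel))
  · exact holds_of_check hB hC
      [(.ax .mulCounitH, 6, 2), (.ax .counitComulH, 0, 4), (.ax .comulCounitH, 0, 1),
        (.ax .mulCounitB, 4, 1), (.ax .actCounitB, 2, 2), (.ax .mulCounitC, 4, 0),
        (.ax .actCounitC, 1, 1)]
      [] (by decide +kernel)
  · exact holds_of_check hB hC
      [(.ax .oneCounitH, 1, 1), (.ax .oneCounitB, 1, 1), (.ax .oneCounitC, 0, 0)]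
      [] (by decide +kernel)

end Double

/-! ### The calculus of Hopf bimodules -/

/-- The generating morphisms of the calculus of a Hopf algebra `H`, of objects `X 0, X 1, …` with
two-sided actions and coactions of `H`, and of additional morphisms `b : β`. -/
inductive HbOp (β : Type)
  | mul | one | comul | counit | anti
  | actL (i : ℕ) | actR (i : ℕ) | coactL (i : ℕ) | coactR (i : ℕ)
  | box (b : β)
  deriving DecidableEq

/-- Sources and targets of the additional morphisms. -/
class Boxes (β : Type) where
  dom : β → Ob
  cod : β → Ob

namespace Hb

/-- The Hopf algebra has colour `0`. -/
abbrev H : Ob := .of 0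

/-- An object without additional structure has colour `1`. -/
abbrev V : Ob := .of 1

/-- The object `X i` has colour `i + 2`. -/
abbrev X (i : ℕ) : Ob := .of (i + 2)

variable {β : Type} [Boxes β]

/-- The sources of the generating morphisms. -/
@[reducible] def dom : HbOp β → Ob
  | .mul => H ⊗ᵒ H | .one => .one | .comul => H | .counit => H | .anti => H
  | .actL i => H ⊗ᵒ X i | .actR i => X i ⊗ᵒ H | .coactL i => X i | .coactR i => X i
  | .box b => Boxes.dom b

/-- The targets of the generating morphisms. -/
@[reducible] def cod : HbOp β → Ob
  | .mul => H | .one => H | .comul => H ⊗ᵒ H | .counit => .one | .anti => H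
  | .actL i => X i | .actR i => X i | .coactL i => H ⊗ᵒ X i | .coactR i => X i ⊗ᵒ H
  | .box b => Boxes.cod b

end Hb

instance {β : Type} [Boxes β] : Signature (HbOp β) := ⟨Hb.dom, Hb.cod⟩

namespace Hb

variable {β : Type} [Boxes β]

abbrev mH : Tm (HbOp β) (H ⊗ᵒ H) H := .gen (.op HbOp.mul)
abbrev eH : Tm (HbOp β) .one H := .gen (.op HbOp.one)
abbrev dH : Tm (HbOp β) H (H ⊗ᵒ H) := .gen (.op HbOp.comul)
abbrev cH : Tm (HbOp β) H .one := .gen (.op HbOp.counit)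
abbrev sH : Tm (HbOp β) H H := .gen (.op HbOp.anti)

abbrev bialgH : Bialg (HbOp β) H := ⟨mH, eH, dH, cH⟩

/-- Formal structure morphisms of a Hopf bimodule over the generic Hopf algebra. -/
abbrev Bimod (β : Type) [Boxes β] := Diagram.Bimod (HbOp β) H

/-- The object `X i` with its structure morphisms. -/
abbrev bimod (i : ℕ) : Bimod β where
  pt := X i
  actL := .gen (.op (HbOp.actL i))
  actR := .gen (.op (HbOp.actR i))
  coactL := .gen (.op (HbOp.coactL i))
  coactR := .gen (.op (HbOp.coactR i))

namespace Bimod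

abbrev odot (P Q : Bimod β) : Bimod β := Diagram.Bimod.odot mH P Q

abbrev boxdot (P Q : Bimod β) : Bimod β := Diagram.Bimod.boxdot dH P Q

abbrev coinv (P : Bimod β) : Tm (HbOp β) P.pt P.pt := Diagram.Bimod.coinv sH P

abbrev split (P Q : Bimod β) : Tm (HbOp β) (P.pt ⊗ᵒ Q.pt) (P.pt ⊗ᵒ Q.pt) :=
  Diagram.Bimod.split sH P Q

abbrev cosplit (P Q : Bimod β) : Tm (HbOp β) (P.pt ⊗ᵒ Q.pt) (P.pt ⊗ᵒ Q.pt) :=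
  Diagram.Bimod.cosplit sH P Q

end Bimod

/-- Labels for the equations in use: those of the Hopf algebra, those of the Hopf bimodules `X i`,
and additional ones. -/
inductive Ax (K : Type)
  | assoc | oneMul | mulOne | coassoc | counitComul | comulCounit
  | mulComul | oneComul | mulCounit | oneCounit
  | antiLeft | antiRight | mulAnti | comulAnti | oneAnti | antiCounit
  | bimod (i : ℕ) (k : BimodAx)
  | extra (k : K)

/-- The equations with the given labels. -/
@[reducible] def ax {K : Type} (extra : K → Rule (HbOp β)) : Ax K → Rule (HbOp β)
  | .assoc => .mulAssoc mH
  | .oneMul => .oneMul mH eH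
  | .mulOne => .mulOne mH eH
  | .coassoc => .comulAssoc dH
  | .counitComul => .counitComul dH cH
  | .comulCounit => .comulCounit dH cH
  | .mulComul => .mulComul mH dH
  | .oneComul => .oneComul eH dH
  | .mulCounit => .mulCounit mH cH
  | .oneCounit => .oneCounit eH cH
  | .antiLeft => ⟨_, _, dH ≫ᵗ sH ▷ᵗ H ≫ᵗ mH, cH ≫ᵗ eH⟩
  | .antiRight => ⟨_, _, dH ≫ᵗ H ◁ᵗ sH ≫ᵗ mH, cH ≫ᵗ eH⟩
  | .mulAnti => ⟨_, _, mH ≫ᵗ sH, (sH ⊗ᵗ sH) ≫ᵗ .braid H H ≫ᵗ mH⟩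
  | .comulAnti => ⟨_, _, sH ≫ᵗ dH, dH ≫ᵗ .braid H H ≫ᵗ (sH ⊗ᵗ sH)⟩
  | .oneAnti => ⟨_, _, eH ≫ᵗ sH, eH⟩
  | .antiCounit => ⟨_, _, sH ≫ᵗ cH, cH⟩
  | .bimod i k => bimodAx bialgH (Hb.bimod i) k
  | .extra k => extra k

variable {H' : 𝒞} [HopfObj H']

/-- The interpretation of the colours. -/
@[reducible] def objects (V : 𝒞) (X : ℕ → HopfBimoduleData H') : ℕ → 𝒞
  | 0 => H'
  | 1 => V
  | i + 2 => (X i).pt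

/-- The interpretation of the generating morphisms, where `m` is that of the additional ones. -/
@[reducible] def model (V : 𝒞) (X : ℕ → HopfBimoduleData H')
    (m : ∀ b : β, (Boxes.dom b).den (objects V X) ⟶ (Boxes.cod b).den (objects V X)) :
    Model (HbOp β) 𝒞 where
  obj := objects V X
  mor := fun
    | .mul => μ[H'] | .one => η[H'] | .comul => Δ[H'] | .counit => ε[H'] | .anti => 𝒮[H']
    | .actL i => (X i).actL | .actR i => (X i).actR
    | .coactL i => (X i).coactL | .coactR i => (X i).coactR
    | .box b => m b

/-- Whether an equation is one of the Hopf algebra, one of the Hopf bimodules `X i` with `i < n`, or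
an additional one that is allowed by `ok`. -/
def allowed {K : Type} (n : ℕ) (ok : K → Bool) : Ax K → Bool
  | .bimod i _ => decide (i < n)
  | .extra k => ok k
  | _ => true

/-- Equations that can be derived from the axioms of Hopf algebras and of Hopf bimodules, and from
additional ones, hold in all Hopf bimodules. -/
theorem holds_of_check {V : 𝒞} {X : ℕ → HopfBimoduleData H'}
    {m : ∀ b : β, (Boxes.dom b).den (objects V X) ⟶ (Boxes.cod b).den (objects V X)}
    [DecidableEq β] {K : Type} {extra : K → Rule (HbOp β)} {n : ℕ} {ok : K → Bool}
    (hX : ∀ i < n, (X i).IsHopfBimodule)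
    (hK : ∀ k, ok k = true → (model V X m).Holds (extra k)) {r : Rule (HbOp β)}
    (s t : Script (Ax K) (HbOp β)) (h : r.check (ax extra) (allowed n ok) s t = true) :
    (model V X m).Holds r := by
  refine (model V X m).holds_of_check (fun k hk => ?_) s t h
  cases k
  case assoc => exact MonObj.mul_assoc H'
  case oneMul => exact MonObj.one_mul H'
  case mulOne => exact MonObj.mul_one H'
  case coassoc =>
    exact (by simp : Δ[H'] ≫ Δ[H'] ▷ H' ≫ (α_ H' H' H').hom = Δ[H'] ≫ H' ◁ Δ[H'])
  case counitComul => exact ComonObj.counit_comul H'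
  case comulCounit => exact ComonObj.comul_counit H'
  case mulComul => exact BimonObj.mul_comul H'
  case oneComul => exact BimonObj.one_comul H'
  case mulCounit => exact BimonObj.mul_counit H'
  case oneCounit => exact BimonObj.one_counit H'
  case antiLeft => exact HopfObj.antipode_left H'
  case antiRight => exact HopfObj.antipode_right H'
  case mulAnti => exact HopfObj.mul_antipode H'
  case comulAnti => exact HopfObj.antipode_comul H'
  case oneAnti => exact HopfObj.one_antipode H'
  case antiCounit => exact HopfObj.antipode_counit H'
  case bimod i k =>
    have hi := hX i (of_decide_eq_true hk)
    cases k
    case oneActL => exact hi.one_actL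
    case mulActL => exact hi.mul_actL.symm
    case actROne => exact hi.actR_one
    case actRMul => exact hi.actR_mul.symm
    case actLActR => exact hi.actL_actR
    case coactLCounit => exact hi.coactL_counit
    case coactLComul => exact hi.coactL_comul.symm
    case coactRCounit => exact hi.coactR_counit
    case coactRComul => exact hi.coactR_comul.symm
    case coactLCoactR => exact hi.coactL_coactR
    case actLCoactL => exact hi.actL_coactL
    case actLCoactR => exact hi.actL_coactR
    case actRCoactL => exact hi.actR_coactL
    case actRCoactR => exact hi.actR_coactR
  case extra k => exact hK k hk

instance : Boxes Empty := ⟨nofun, nofun⟩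

/-- A morphism `f : X 0 ⊗ X 1 ⟶ V`. -/
inductive ToBox
  | f
  deriving DecidableEq

instance : Boxes ToBox where
  dom | .f => X 0 ⊗ᵒ X 1
  cod | .f => V

abbrev toBox : Tm (HbOp ToBox) (X 0 ⊗ᵒ X 1) V := .gen (.op (HbOp.box ToBox.f))

/-- The equation that says that `f` is balanced. -/
@[reducible] def toAx : Unit → Rule (HbOp ToBox) := fun _ => balanced (bimod 0) (bimod 1) toBox

/-- A morphism `g : V ⟶ X 0 ⊗ X 1`. -/
inductive FromBox
  | g
  deriving DecidableEq

instance : Boxes FromBox where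
  dom | .g => V
  cod | .g => X 0 ⊗ᵒ X 1

abbrev fromBox : Tm (HbOp FromBox) V (X 0 ⊗ᵒ X 1) := .gen (.op (HbOp.box FromBox.g))

/-- The equation that says that `g` is cobalanced. -/
@[reducible] def fromAx : Unit → Rule (HbOp FromBox) := fun _ =>
  cobalanced (bimod 0) (bimod 1) fromBox

/-- A morphism `q : X 0 ⟶ X 1` of Hopf bimodules. -/
inductive HomBox
  | q
  deriving DecidableEq

instance : Boxes HomBox where
  dom | .q => X 0
  cod | .q => X 1

abbrev homBox : Tm (HbOp HomBox) (X 0) (X 1) := .gen (.op (HbOp.box HomBox.q))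

/-- The equations that say that `q` is a morphism of Hopf bimodules. -/
@[reducible] def homAx : HomAx → Rule (HbOp HomBox) := hom (bimod 0) (bimod 1) homBox

/-- Morphisms `ρ : X 4 ⟶ X 0 ⊗ X 1`, `ρ' : X 5 ⟶ X 2 ⊗ X 3`, `λ : X 0 ⊗ X 2 ⟶ X 6` and
`λ' : X 1 ⊗ X 3 ⟶ X 7`. -/
inductive QuadBox
  | rho | rho' | lam | lam'
  deriving DecidableEq

instance : Boxes QuadBox where
  dom | .rho => X 4 | .rho' => X 5 | .lam => X 0 ⊗ᵒ X 2 | .lam' => X 1 ⊗ᵒ X 3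
  cod | .rho => X 0 ⊗ᵒ X 1 | .rho' => X 2 ⊗ᵒ X 3 | .lam => X 6 | .lam' => X 7

abbrev rho : Tm (HbOp QuadBox) (X 4) (X 0 ⊗ᵒ X 1) := .gen (.op (HbOp.box QuadBox.rho))
abbrev rho' : Tm (HbOp QuadBox) (X 5) (X 2 ⊗ᵒ X 3) := .gen (.op (HbOp.box QuadBox.rho'))
abbrev lam : Tm (HbOp QuadBox) (X 0 ⊗ᵒ X 2) (X 6) := .gen (.op (HbOp.box QuadBox.lam))
abbrev lam' : Tm (HbOp QuadBox) (X 1 ⊗ᵒ X 3) (X 7) := .gen (.op (HbOp.box QuadBox.lam'))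

/-- Labels for the equations that say that `ρ`, `ρ'`, `λ` and `λ'` are morphisms of Hopf bimodules
which factor through cotensor products and tensor products over `H`. -/
inductive QuadAx
  | rhoHom (k : HomAx) | rhoHom' (k : HomAx) | lamHom (k : HomAx) | lamHom' (k : HomAx)
  | cobalanced | cobalanced' | balanced | balanced'

/-- The equations with the given labels. -/
@[reducible] def quadAx : QuadAx → Rule (HbOp QuadBox)
  | .rhoHom k => hom (bimod 4) ((bimod 0).boxdot (bimod 1)) rho k
  | .rhoHom' k => hom (bimod 5) ((bimod 2).boxdot (bimod 3)) rho' k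
  | .lamHom k => hom ((bimod 0).odot (bimod 2)) (bimod 6) lam k
  | .lamHom' k => hom ((bimod 1).odot (bimod 3)) (bimod 7) lam' k
  | .cobalanced => Diagram.cobalanced (bimod 0) (bimod 1) rho
  | .cobalanced' => Diagram.cobalanced (bimod 2) (bimod 3) rho'
  | .balanced => Diagram.balanced (bimod 0) (bimod 2) lam
  | .balanced' => Diagram.balanced (bimod 1) (bimod 3) lam'

/-- `(x ⊗ y) ⊗ (x' ⊗ y') ↦ λ(x ⊗ x') ⊗ λ'(y ⊗ y')`, composed with `ρ ⊗ ρ'`. -/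
abbrev interchange : Tm (HbOp QuadBox) (X 4 ⊗ᵒ X 5) (X 6 ⊗ᵒ X 7) :=
  (rho ⊗ᵗ rho') ≫ᵗ .tensorμ (X 0) (X 1) (X 2) (X 3) ≫ᵗ (lam ⊗ᵗ lam')

/-- `x ⊗ (x' ⊗ y) ⊗ y' ↦ λ(x₍₀₎ ⊗ x' y'₍₋₁₎) ⊗ λ'(x₍₁₎ y ⊗ y'₍₀₎)`. -/
abbrev outer : Tm (HbOp QuadBox) (X 0 ⊗ᵒ ((X 2 ⊗ᵒ X 1) ⊗ᵒ X 3)) (X 6 ⊗ᵒ X 7) :=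
  ((bimod 0).coactR ⊗ᵗ ((X 2 ⊗ᵒ X 1) ◁ᵗ (bimod 3).coactL)) ⊗≫ᵗ
  X 0 ◁ᵗ ((.braid H (X 2) ⊗ᵗ .braid (X 1) H) ▷ᵗ X 3) ⊗≫ᵗ
  (X 0 ⊗ᵒ X 2) ◁ᵗ (.braid H H ▷ᵗ (X 1 ⊗ᵒ X 3)) ⊗≫ᵗ
  (X 0 ◁ᵗ (bimod 2).actR ⊗ᵗ (bimod 1).actL ▷ᵗ X 3) ≫ᵗ (lam ⊗ᵗ lam')

end Hb

section

variable {H : 𝒞} [HopfObj H]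

/-! ### Balanced and cobalanced morphisms -/

namespace Hb

/-- The interpretation of `X 0` and of `X i` for `i ≠ 0` by `X` and `Y`. -/
@[reducible] def pair (X Y : HopfBimoduleData H) : ℕ → HopfBimoduleData H
  | 0 => X
  | _ => Y

variable {X Y : HopfBimoduleData H}

lemma pair_isHopfBimodule (hX : X.IsHopfBimodule) (hY : Y.IsHopfBimodule) (i : ℕ) :
    (pair X Y i).IsHopfBimodule := by
  cases i with
  | zero => exact hX
  | succ i => exact hY

/-- The calculus of two Hopf bimodules without additional morphisms. -/
theorem holds_pair (hX : X.IsHopfBimodule) (hY : Y.IsHopfBimodule) {r : Rule (HbOp Empty)}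
    (s t : Script (Ax Empty) (HbOp Empty))
    (h : r.check (ax nofun) (allowed 2 nofun) s t = true) :
    (model (𝟙_ 𝒞) (pair X Y) nofun).Holds r :=
  holds_of_check (fun i _ => pair_isHopfBimodule hX hY i) nofun s t h

end Hb

namespace HopfBimoduleData

/-- A morphism `X ⊗ Y ⟶ V` is balanced if it factors through the tensor product over `H`. -/
def IsBalanced (X Y : HopfBimoduleData H) {V : 𝒞} (f : X.pt ⊗ Y.pt ⟶ V) : Prop :=
  X.actR ▷ Y.pt ≫ f = (α_ X.pt H Y.pt).hom ≫ X.pt ◁ Y.actL ≫ f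

/-- A morphism `V ⟶ X ⊗ Y` is cobalanced if it factors through the cotensor product over `H`. -/
def IsCobalanced (X Y : HopfBimoduleData H) {V : 𝒞} (g : V ⟶ X.pt ⊗ Y.pt) : Prop :=
  g ≫ X.coactR ▷ Y.pt ≫ (α_ X.pt H Y.pt).hom = g ≫ X.pt ◁ Y.coactL

/-- The projection `x ↦ x₍₀₎ S(x₍₁₎)` to the right coinvariants. -/
def coinv (X : HopfBimoduleData H) : X.pt ⟶ X.pt := X.coactR ≫ X.pt ◁ 𝒮[H] ≫ X.actR

/-- The idempotent `x ⊗ y ↦ x₍₀₎ S(x₍₁₎) ⊗ x₍₂₎ y`, whose image is the tensor product over `H`. -/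
def split (X Y : HopfBimoduleData H) : X.pt ⊗ Y.pt ⟶ X.pt ⊗ Y.pt :=
  X.coactR ▷ Y.pt ≫ (X.coinv ▷ H) ▷ Y.pt ≫ (α_ X.pt H Y.pt).hom ≫ X.pt ◁ Y.actL

/-- The idempotent `x ⊗ y ↦ x₍₀₎ S(x₍₁₎) y₍₋₁₎ ⊗ y₍₀₎`, whose image is the cotensor product
over `H`. -/
def cosplit (X Y : HopfBimoduleData H) : X.pt ⊗ Y.pt ⟶ X.pt ⊗ Y.pt :=
  X.coinv ▷ Y.pt ≫ X.pt ◁ Y.coactL ≫ (α_ X.pt H Y.pt).inv ≫ X.actR ▷ Y.pt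

variable {X Y : HopfBimoduleData H}

section
open Hb

theorem split_isBalanced (hX : X.IsHopfBimodule) (hY : Y.IsHopfBimodule) :
    X.IsBalanced Y (X.split Y) :=
  Hb.holds_pair hX hY (r := balanced (bimod 0) (bimod 1) ((bimod 0).split (bimod 1)))
    [(.ax (.bimod 0 .actRCoactR), 0, 0), (.ax (.bimod 0 .actRCoactR), 4, 0),
      (.ax .mulAnti, 7, 2), (.ax .coassoc, 1, 2), (.ax (.bimod 0 .actRMul), 12, 0),
      (.ax (.bimod 0 .coactRComul), 0, 0), (.inv .assoc, 11, 1), (.inv .coassoc, 1, 2),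
      (.ax .antiRight, 2, 2), (.natR 0 .one, 3, 1), (.ax .oneMul, 3, 1),
      (.ax .counitComul, 1, 2)]
    [(.ax (.bimod 0 .coactRComul), 1, 0), (.ax (.bimod 1 .mulActL), 0, 0)] (by decide +kernel)

theorem exchange_isBalanced (hX : X.IsHopfBimodule) (hY : Y.IsHopfBimodule) :
    X.IsBalanced Y (X.exchange Y) :=
  Hb.holds_pair hX hY (r := balanced (bimod 0) (bimod 1) ((bimod 0).exchange (bimod 1)))
    [(.ax (.bimod 0 .actRCoactR), 0, 0), (.natL .mul 0, 3, 2),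
      (.ax (.bimod 0 .actRMul), 3, 0)]
    [(.ax (.bimod 1 .actLCoactL), 0, 1), (.natR 0 .mul, 3, 0),
      (.ax (.bimod 1 .mulActL), 3, 2)] (by decide +kernel)

theorem exchange_isCobalanced (hX : X.IsHopfBimodule) (hY : Y.IsHopfBimodule) :
    X.IsCobalanced Y (X.exchange Y) :=
  Hb.holds_pair hX hY (r := cobalanced (bimod 0) (bimod 1) ((bimod 0).exchange (bimod 1)))
    [(.ax (.bimod 0 .actRCoactR), 3, 0), (.ax (.bimod 0 .coactRComul), 0, 0)]
    [(.ax (.bimod 1 .actLCoactL), 4, 1), (.ax (.bimod 1 .coactLComul), 1, 2)] (by decide +kernel)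

theorem theta_isBalanced (hX : X.IsHopfBimodule) (hY : Y.IsHopfBimodule) :
    X.IsBalanced Y (X.theta Y) :=
  Hb.holds_pair hX hY (r := balanced (bimod 0) (bimod 1) ((bimod 0).theta (bimod 1)))
    [(.ax (.bimod 0 .actRCoactL), 0, 0), (.natL (.actR 0) 3, 4, 1),
      (.ax (.bimod 0 .actRMul), 7, 2)]
    [(.ax (.bimod 1 .actLCoactR), 0, 1), (.natR 2 (.actL 1), 4, 0),
      (.ax (.bimod 1 .mulActL), 7, 0)] (by decide +kernel)

theorem theta_isCobalanced (hX : X.IsHopfBimodule) (hY : Y.IsHopfBimodule) :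
    Y.IsCobalanced X (X.theta Y) :=
  Hb.holds_pair hX hY (r := cobalanced (bimod 1) (bimod 0) ((bimod 0).theta (bimod 1)))
    [(.ax (.bimod 1 .actLCoactR), 3, 0), (.ax (.bimod 1 .coactRComul), 1, 2)]
    [(.ax (.bimod 0 .actRCoactL), 4, 1), (.ax (.bimod 0 .coactLComul), 0, 0)] (by decide +kernel)

/-- With `coinv_exchange`, this relates the tensor product over `H`, the image of `split`, to the
cotensor product over `H`, the image of `cosplit`. -/
theorem exchange_coinv (hX : X.IsHopfBimodule) (hY : Y.IsHopfBimodule) :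
    X.exchange Y ≫ X.coinv ▷ Y.pt = X.split Y :=
  Hb.holds_pair hX hY
    (r := ⟨_, _, (bimod 0).exchange (bimod 1) ≫ᵗ (bimod 0).coinv ▷ᵗ Hb.X 1,
      (bimod 0).split (bimod 1)⟩)
    [(.ax (.bimod 0 .actRCoactR), 3, 0), (.ax .mulAnti, 6, 2),
      (.ax (.bimod 0 .actRMul), 10, 0), (.ax (.bimod 0 .coactRComul), 0, 0),
      (.inv .assoc, 9, 1), (.ax .antiRight, 4, 2), (.natR 0 .one, 5, 1), (.ax .oneMul, 5, 1),
      (.ax (.bimod 1 .coactLCounit), 2, 3)]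
    [(.ax (.bimod 0 .coactRComul), 0, 0)] (by decide +kernel)

theorem coinv_exchange (hX : X.IsHopfBimodule) (hY : Y.IsHopfBimodule) :
    X.coinv ▷ Y.pt ≫ X.exchange Y = X.cosplit Y :=
  Hb.holds_pair hX hY
    (r := ⟨_, _, (bimod 0).coinv ▷ᵗ Hb.X 1 ≫ᵗ (bimod 0).exchange (bimod 1),
      (bimod 0).cosplit (bimod 1)⟩)
    [(.ax (.bimod 0 .actRCoactR), 2, 0), (.natL .mul 0, 5, 2), (.ax .comulAnti, 1, 1),
      (.ax (.bimod 0 .actRMul), 7, 0), (.ax (.bimod 0 .coactRComul), 0, 0),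
      (.inv .coassoc, 1, 1), (.ax .antiRight, 2, 1), (.natL .one 0, 3, 1),
      (.natL .one 0, 3, 2), (.ax .counitComul, 1, 1), (.ax (.bimod 1 .oneActL), 3, 3)]
    [(.ax (.bimod 0 .actRMul), 2, 0)] (by decide +kernel)

theorem exchange_isHom (hX : X.IsHopfBimodule) (hY : Y.IsHopfBimodule) :
    (X.odot Y).IsHom (X.boxdot Y) (X.exchange Y) := by
  have h k s t hc := Hb.holds_pair hX hY (r := hom ((bimod 0).odot (bimod 1))
    ((bimod 0).boxdot (bimod 1)) ((bimod 0).exchange (bimod 1)) k) s t hc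
  constructor
  · exact h .actL
      [(.ax (.bimod 0 .actLCoactR), 0, 0), (.natL .mul 0, 3, 2),
        (.ax (.bimod 0 .actLActR), 3, 0)]
      [(.natR 0 (.actR 0), 3, 0), (.ax (.bimod 1 .mulActL), 3, 2)] (by decide +kernel)
  · exact h .actR
      [(.ax (.bimod 1 .actRCoactL), 0, 1)]
      [(.natL (.actL 1) 0, 4, 1), (.ax (.bimod 0 .actRMul), 3, 0),
        (.ax (.bimod 1 .actLActR), 6, 3)] (by decide +kernel)
  · exact h .coactL
      [(.ax (.bimod 0 .actRCoactL), 3, 0)]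
      [(.ax (.bimod 0 .coactLCoactR), 0, 0), (.ax (.bimod 1 .coactLComul), 2, 3)]
      (by decide +kernel)
  · exact h .coactR
      [(.ax (.bimod 1 .actLCoactR), 4, 1), (.ax (.bimod 1 .coactLCoactR), 1, 2)]
      [(.ax (.bimod 0 .coactRComul), 0, 0)] (by decide +kernel)

theorem IsHopfBimodule.odot (hX : X.IsHopfBimodule) (hY : Y.IsHopfBimodule) :
    (X.odot Y).IsHopfBimodule := by
  have h k s t hc := Hb.holds_pair hX hY (r := bimodAx bialgH ((bimod 0).odot (bimod 1)) k) s t hc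
  constructor
  · exact h .oneActL
      [(.ax (.bimod 0 .oneActL), 0, 0)]
      [] (by decide +kernel)
  · exact (h .mulActL
      [(.ax (.bimod 0 .mulActL), 0, 0)]
      [] (by decide +kernel)).symm
  · exact h .actROne
      [(.ax (.bimod 1 .actROne), 0, 1)]
      [] (by decide +kernel)
  · exact (h .actRMul
      [(.ax (.bimod 1 .actRMul), 0, 1)]
      [] (by decide +kernel)).symm
  · exact h .actLActR
      []
      [] (by decide +kernel)
  · exact h .coactLCounit
      [(.ax .mulCounit, 3, 0), (.ax (.bimod 0 .coactLCounit), 0, 0),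
        (.ax (.bimod 1 .coactLCounit), 0, 1)]
      [] (by decide +kernel)
  · exact (h .coactLComul
      [(.ax (.bimod 0 .coactLComul), 0, 0), (.ax (.bimod 1 .coactLComul), 2, 3)]
      [(.ax .mulComul, 3, 0)] (by decide +kernel)).symm
  · exact h .coactRCounit
      [(.ax .mulCounit, 3, 2), (.ax (.bimod 0 .coactRCounit), 0, 0),
        (.ax (.bimod 1 .coactRCounit), 0, 1)]
      [] (by decide +kernel)
  · exact (h .coactRComul
      [(.ax (.bimod 0 .coactRComul), 0, 0), (.ax (.bimod 1 .coactRComul), 2, 3)]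
      [(.ax .mulComul, 3, 2)] (by decide +kernel)).symm
  · exact h .coactLCoactR
      [(.ax (.bimod 0 .coactLCoactR), 0, 0), (.ax (.bimod 1 .coactLCoactR), 2, 3)]
      [] (by decide +kernel)
  · exact h .actLCoactL
      [(.ax (.bimod 0 .actLCoactL), 0, 0), (.ax .assoc, 3, 0)]
      [] (by decide +kernel)
  · exact h .actLCoactR
      [(.ax (.bimod 0 .actLCoactR), 0, 0), (.natL .mul 3, 3, 2), (.ax .assoc, 7, 2)]
      [] (by decide +kernel)
  · exact h .actRCoactL
      [(.ax (.bimod 1 .actRCoactL), 0, 1)]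
      [(.ax .assoc, 3, 0)] (by decide +kernel)
  · exact h .actRCoactR
      [(.ax (.bimod 1 .actRCoactR), 0, 1)]
      [(.natL .mul 0, 3, 2), (.ax .assoc, 6, 3)] (by decide +kernel)

end

section
open Hb
variable {V : 𝒞} {f : X.pt ⊗ Y.pt ⟶ V}

/-- The calculus of a balanced morphism. -/
theorem IsBalanced.holds (hf : X.IsBalanced Y f) (hX : X.IsHopfBimodule) (hY : Y.IsHopfBimodule)
    {r : Rule (HbOp ToBox)} (s t : Script (Ax Unit) (HbOp ToBox))
    (h : r.check (ax toAx) (allowed 2 fun _ => true) s t = true) :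
    (Hb.model (β := ToBox) V (Hb.pair X Y) (fun | .f => f)).Holds r :=
  Hb.holds_of_check (β := ToBox) (V := V) (X := Hb.pair X Y) (m := fun | .f => f)
    (extra := toAx) (ok := fun _ => true) (fun i _ => pair_isHopfBimodule hX hY i)
    (fun _ _ => hf) s t h

theorem IsBalanced.split_comp (hf : X.IsBalanced Y f) (hX : X.IsHopfBimodule)
    (hY : Y.IsHopfBimodule) : X.split Y ≫ f = f :=
  hf.holds hX hY (r := ⟨_, _, (bimod 0).split (bimod 1) ≫ᵗ toBox, toBox⟩)
    [(.ax (.extra ()), 3, 0), (.ax (.bimod 0 .coactRComul), 0, 0),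
      (.ax (.bimod 1 .mulActL), 3, 1), (.ax .antiLeft, 1, 1),
      (.ax (.bimod 0 .coactRCounit), 0, 0), (.ax (.bimod 1 .oneActL), 0, 1)]
    [] (by decide +kernel)

theorem IsBalanced.split_actL (hf : X.IsBalanced Y f) (hX : X.IsHopfBimodule)
    (hY : Y.IsHopfBimodule) : H ◁ X.split Y ≫ (X.odot Y).actL ≫ f = (X.odot Y).actL ≫ f :=
  hf.holds hX hY (r := ⟨_, _, Hb.H ◁ᵗ (bimod 0).split (bimod 1) ≫ᵗ
    ((bimod 0).odot (bimod 1)).actL ≫ᵗ toBox, ((bimod 0).odot (bimod 1)).actL ≫ᵗ toBox⟩)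
    [(.ax (.bimod 0 .coactRComul), 0, 1), (.inv (.bimod 0 .actLActR), 3, 0),
      (.ax (.extra ()), 4, 0), (.ax (.bimod 1 .mulActL), 4, 1), (.ax .antiLeft, 1, 2),
      (.ax (.bimod 0 .coactRCounit), 0, 1), (.ax (.bimod 1 .oneActL), 0, 2)]
    [] (by decide +kernel)

theorem IsBalanced.split_actR (hf : X.IsBalanced Y f) (hX : X.IsHopfBimodule)
    (hY : Y.IsHopfBimodule) : X.split Y ▷ H ≫ (X.odot Y).actR ≫ f = (X.odot Y).actR ≫ f :=
  hf.holds hX hY (r := ⟨_, _, (bimod 0).split (bimod 1) ▷ᵗ Hb.H ≫ᵗ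
    ((bimod 0).odot (bimod 1)).actR ≫ᵗ toBox, ((bimod 0).odot (bimod 1)).actR ≫ᵗ toBox⟩)
    [(.ax (.extra ()), 3, 0), (.ax (.bimod 0 .coactRComul), 0, 0),
      (.ax (.bimod 1 .actLActR), 3, 2), (.ax (.bimod 1 .mulActL), 4, 1),
      (.ax .antiLeft, 1, 1), (.ax (.bimod 0 .coactRCounit), 0, 0),
      (.ax (.bimod 1 .oneActL), 0, 1)]
    [] (by decide +kernel)

theorem IsBalanced.split_coactL (hf : X.IsBalanced Y f) (hX : X.IsHopfBimodule)
    (hY : Y.IsHopfBimodule) : X.split Y ≫ (X.odot Y).coactL ≫ H ◁ f = (X.odot Y).coactL ≫ H ◁ f :=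
  hf.holds hX hY (r := ⟨_, _, (bimod 0).split (bimod 1) ≫ᵗ ((bimod 0).odot (bimod 1)).coactL ≫ᵗ
    Hb.H ◁ᵗ toBox, ((bimod 0).odot (bimod 1)).coactL ≫ᵗ Hb.H ◁ᵗ toBox⟩)
    [(.ax (.bimod 0 .actRCoactL), 3, 0), (.natL (.actR 0) 0, 7, 1),
      (.ax (.extra ()), 11, 2), (.ax .comulAnti, 2, 1), (.ax (.bimod 1 .actLCoactL), 9, 3),
      (.natR 0 .mul, 12, 2), (.natR 2 .mul, 14, 1), (.ax .assoc, 8, 0),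
      (.ax (.bimod 0 .coactRComul), 0, 0), (.ax .coassoc, 1, 1),
      (.ax (.bimod 1 .mulActL), 16, 4), (.inv .assoc, 15, 1), (.inv .coassoc, 2, 2),
      (.ax .antiLeft, 3, 2), (.natR 0 .one, 4, 1), (.natR 2 .one, 4, 0), (.ax .oneMul, 11, 1),
      (.ax .counitComul, 2, 2), (.ax .antiLeft, 1, 1), (.natL .one 0, 2, 1),
      (.ax (.bimod 0 .coactRCounit), 0, 0), (.ax (.bimod 1 .oneActL), 2, 3)]
    [] (by decide +kernel)

theorem IsBalanced.split_coactR (hf : X.IsBalanced Y f) (hX : X.IsHopfBimodule)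
    (hY : Y.IsHopfBimodule) : X.split Y ≫ (X.odot Y).coactR ≫ f ▷ H = (X.odot Y).coactR ≫ f ▷ H :=
  hf.holds hX hY (r := ⟨_, _, (bimod 0).split (bimod 1) ≫ᵗ ((bimod 0).odot (bimod 1)).coactR ≫ᵗ
    toBox ▷ᵗ Hb.H, ((bimod 0).odot (bimod 1)).coactR ≫ᵗ toBox ▷ᵗ Hb.H⟩)
    [(.ax (.bimod 0 .actRCoactR), 3, 0), (.ax (.extra ()), 7, 0), (.ax .comulAnti, 2, 1),
      (.ax (.bimod 1 .actLCoactR), 8, 4), (.natR 0 (.actL 1), 12, 3),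
      (.natR 0 (.actL 1), 14, 2), (.ax .assoc, 17, 3), (.ax (.bimod 0 .coactRComul), 0, 0),
      (.ax .coassoc, 1, 1), (.ax (.bimod 0 .coactRComul), 0, 0),
      (.ax (.bimod 1 .mulActL), 16, 1), (.inv .coassoc, 3, 3), (.ax .antiLeft, 4, 3),
      (.natR 0 .one, 5, 2), (.ax .counitComul, 3, 3), (.ax (.bimod 1 .oneActL), 3, 1),
      (.inv .assoc, 6, 3), (.ax .antiLeft, 2, 2), (.natL .one 3, 3, 2), (.ax .oneMul, 4, 3),
      (.ax .comulCounit, 1, 1)]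
    [] (by decide +kernel)

theorem IsCobalanced.comp_cosplit {g : V ⟶ X.pt ⊗ Y.pt} (hg : X.IsCobalanced Y g)
    (hX : X.IsHopfBimodule) (hY : Y.IsHopfBimodule) : g ≫ X.cosplit Y = g :=
  Hb.holds_of_check (β := FromBox) (V := V) (X := Hb.pair X Y) (m := fun | .g => g)
    (extra := fromAx) (n := 2) (ok := fun _ => true)
    (r := ⟨_, _, fromBox ≫ᵗ (bimod 0).cosplit (bimod 1), fromBox⟩)
    (fun i _ => pair_isHopfBimodule hX hY i) (fun _ _ => hg)
    [(.ax (.extra ()), 0, 0), (.ax (.bimod 0 .actRMul), 3, 0),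
      (.ax (.bimod 1 .coactLComul), 1, 1), (.ax .antiLeft, 2, 1),
      (.ax (.bimod 0 .actROne), 3, 0), (.ax (.bimod 1 .coactLCounit), 1, 1)]
    [] (by decide +kernel)

end

/-! ### Morphisms of Hopf bimodules -/

section
open Hb
variable {Z : HopfBimoduleData H} {q : X.pt ⟶ Y.pt}

/-- The calculus of a morphism of Hopf bimodules. The axioms of its target are not used. -/
theorem IsHom.holds (hq : X.IsHom Y q) (hX : X.IsHopfBimodule) {r : Rule (HbOp HomBox)}
    (s t : Script (Ax HomAx) (HbOp HomBox))
    (h : r.check (ax homAx) (allowed 1 fun _ => true) s t = true) :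
    (Hb.model (β := HomBox) (𝟙_ 𝒞) (Hb.pair X Y) (fun | .q => q)).Holds r := by
  refine Hb.holds_of_check (n := 1) (extra := homAx) (ok := fun _ => true) (fun i hi => ?_)
    (fun k _ => ?_) s t h
  · obtain rfl : i = 0 := by omega
    exact hX
  · cases k
    · exact hq.actL
    · exact hq.actR
    · exact hq.coactL
    · exact hq.coactR

/-- The axioms of a Hopf bimodule descend along a morphism that has a section as a morphism
of `𝒞`. -/
theorem IsHopfBimodule.of_section (hX : X.IsHopfBimodule) (hq : X.IsHom Y q) {s : Y.pt ⟶ X.pt}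
    (h : s ≫ q = 𝟙 Y.pt) : Y.IsHopfBimodule := by
  have : IsSplitEpi q := ⟨⟨s, h⟩⟩
  have hl (A : 𝒞) : IsSplitEpi (A ◁ q) := inferInstanceAs (IsSplitEpi ((tensorLeft A).map q))
  have hr (A : 𝒞) : IsSplitEpi (q ▷ A) := inferInstanceAs (IsSplitEpi ((tensorRight A).map q))
  have hlr : IsSplitEpi ((H ◁ q) ▷ H) := inferInstanceAs (IsSplitEpi ((tensorRight H).map (H ◁ q)))
  have hd {A : Ob} (k : BimodAx) (p : Tm (HbOp HomBox) A (bimodAx bialgH (bimod 1) k).dom) s t hc :=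
    hq.holds hX (r := ⟨_, _, p ≫ᵗ (bimodAx bialgH (bimod 1) k).lhs,
      p ≫ᵗ (bimodAx bialgH (bimod 1) k).rhs⟩) s t hc
  constructor
  -- each axiom of `Y` is checked after composition with the epimorphism that is induced by `q`
  · rw [← cancel_epi (𝟙_ 𝒞 ◁ q), whisker_exchange_assoc]
    refine (hq.holds hX (r := ⟨_, _, eH ▷ᵗ Hb.X 0 ≫ᵗ Hb.H ◁ᵗ homBox ≫ᵗ (bimod 1).actL,
      .left _ ≫ᵗ homBox⟩)
      [(.inv (.extra .actL), 1, 0), (.ax (.bimod 0 .oneActL), 0, 0)]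
      [] (by decide +kernel)).trans (leftUnitor_naturality q).symm
  · rw [← cancel_epi ((H ⊗ H) ◁ q)]
    exact (hd .mulActL ((Hb.H ⊗ᵒ Hb.H) ◁ᵗ homBox)
      [(.inv (.extra .actL), 0, 1), (.inv (.extra .actL), 1, 0),
        (.ax (.bimod 0 .mulActL), 0, 0)]
      [(.inv (.extra .actL), 0, 1)] (by decide +kernel)).symm
  · rw [← cancel_epi (q ▷ 𝟙_ 𝒞), ← whisker_exchange_assoc]
    refine (hq.holds hX (r := ⟨_, _, Hb.X 0 ◁ᵗ eH ≫ᵗ homBox ▷ᵗ Hb.H ≫ᵗ (bimod 1).actR,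
      .right _ ≫ᵗ homBox⟩)
      [(.inv (.extra .actR), 1, 0), (.ax (.bimod 0 .actROne), 0, 0)]
      [] (by decide +kernel)).trans (rightUnitor_naturality q).symm
  · rw [← cancel_epi (q ▷ (H ⊗ H))]
    exact (hd .actRMul (homBox ▷ᵗ (Hb.H ⊗ᵒ Hb.H))
      [(.inv (.extra .actR), 0, 0), (.inv (.extra .actR), 1, 0),
        (.ax (.bimod 0 .actRMul), 0, 0)]
      [(.inv (.extra .actR), 0, 0)] (by decide +kernel)).symm
  · rw [← cancel_epi ((H ◁ q) ▷ H)]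
    exact hd .actLActR ((Hb.H ◁ᵗ homBox) ▷ᵗ Hb.H)
      [(.inv (.extra .actL), 0, 0), (.inv (.extra .actR), 1, 0),
        (.ax (.bimod 0 .actLActR), 0, 0)]
      [(.inv (.extra .actR), 0, 1), (.inv (.extra .actL), 1, 0)] (by decide +kernel)
  · rw [← cancel_epi q]
    exact hd .coactLCounit homBox
      [(.ax (.extra .coactL), 0, 0), (.ax (.bimod 0 .coactLCounit), 0, 0)]
      [] (by decide +kernel)
  · rw [← cancel_epi q]
    exact (hd .coactLComul homBox
      [(.ax (.extra .coactL), 0, 0), (.ax (.extra .coactL), 1, 1),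
        (.ax (.bimod 0 .coactLComul), 0, 0)]
      [(.ax (.extra .coactL), 0, 0)] (by decide +kernel)).symm
  · rw [← cancel_epi q]
    exact hd .coactRCounit homBox
      [(.ax (.extra .coactR), 0, 0), (.ax (.bimod 0 .coactRCounit), 0, 0)]
      [] (by decide +kernel)
  · rw [← cancel_epi q]
    exact (hd .coactRComul homBox
      [(.ax (.extra .coactR), 0, 0), (.ax (.extra .coactR), 1, 0),
        (.ax (.bimod 0 .coactRComul), 0, 0)]
      [(.ax (.extra .coactR), 0, 0)] (by decide +kernel)).symm
  · rw [← cancel_epi q]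
    exact hd .coactLCoactR homBox
      [(.ax (.extra .coactL), 0, 0), (.ax (.extra .coactR), 1, 1),
        (.ax (.bimod 0 .coactLCoactR), 0, 0)]
      [(.ax (.extra .coactR), 0, 0), (.ax (.extra .coactL), 1, 0)] (by decide +kernel)
  · rw [← cancel_epi (H ◁ q)]
    exact hd .actLCoactL (Hb.H ◁ᵗ homBox)
      [(.inv (.extra .actL), 0, 0), (.ax (.extra .coactL), 1, 0),
        (.ax (.bimod 0 .actLCoactL), 0, 0)]
      [(.ax (.extra .coactL), 0, 1), (.inv (.extra .actL), 1, 1)] (by decide +kernel)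
  · rw [← cancel_epi (H ◁ q)]
    exact hd .actLCoactR (Hb.H ◁ᵗ homBox)
      [(.inv (.extra .actL), 0, 0), (.ax (.extra .coactR), 1, 0),
        (.ax (.bimod 0 .actLCoactR), 0, 0)]
      [(.ax (.extra .coactR), 0, 1), (.natR 0 (.box .q), 1, 0), (.inv (.extra .actL), 3, 0)]
      (by decide +kernel)
  · rw [← cancel_epi (q ▷ H)]
    exact hd .actRCoactL (homBox ▷ᵗ Hb.H)
      [(.inv (.extra .actR), 0, 0), (.ax (.extra .coactL), 1, 0),
        (.ax (.bimod 0 .actRCoactL), 0, 0)]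
      [(.ax (.extra .coactL), 0, 0), (.natL (.box .q) 0, 1, 1), (.inv (.extra .actR), 3, 2)]
      (by decide +kernel)
  · rw [← cancel_epi (q ▷ H)]
    exact hd .actRCoactR (homBox ▷ᵗ Hb.H)
      [(.inv (.extra .actR), 0, 0), (.ax (.extra .coactR), 1, 0),
        (.ax (.bimod 0 .actRCoactR), 0, 0)]
      [(.ax (.extra .coactR), 0, 0), (.inv (.extra .actR), 1, 0)] (by decide +kernel)

/-- The calculus of a morphism of Hopf bimodules and of a third Hopf bimodule, whose axioms are not
used. -/
theorem IsHom.holds_exchange (hq : X.IsHom Y q) (Z : HopfBimoduleData H) {r : Rule (HbOp HomBox)}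
    (s t : Script (Ax HomAx) (HbOp HomBox))
    (h : r.check (ax homAx) (allowed 0 fun _ => true) s t = true) :
    (Hb.model (β := HomBox) (𝟙_ 𝒞) (fun | 0 => X | 1 => Y | _ => Z) (fun | .q => q)).Holds r := by
  refine Hb.holds_of_check (n := 0) (extra := homAx) (ok := fun _ => true) (fun i hi => ?_)
    (fun k _ => ?_) s t h
  · omega
  · cases k
    · exact hq.actL
    · exact hq.actR
    · exact hq.coactL
    · exact hq.coactR

theorem IsHom.whiskerRight_exchange (hq : X.IsHom Y q) (Z : HopfBimoduleData H) :
    q ▷ Z.pt ≫ Y.exchange Z = X.exchange Z ≫ q ▷ Z.pt :=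
  hq.holds_exchange Z (r := ⟨_, _, homBox ▷ᵗ Hb.X 2 ≫ᵗ (bimod 1).exchange (bimod 2),
      (bimod 0).exchange (bimod 2) ≫ᵗ homBox ▷ᵗ Hb.X 2⟩)
    [(.ax (.extra .coactR), 0, 0), (.inv (.extra .actR), 1, 0)]
    [] (by decide +kernel)

theorem IsHom.whiskerLeft_exchange (hq : X.IsHom Y q) (Z : HopfBimoduleData H) :
    Z.pt ◁ q ≫ Z.exchange Y = Z.exchange X ≫ Z.pt ◁ q :=
  hq.holds_exchange Z (r := ⟨_, _, Hb.X 2 ◁ᵗ homBox ≫ᵗ (bimod 2).exchange (bimod 1),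
      (bimod 2).exchange (bimod 0) ≫ᵗ Hb.X 2 ◁ᵗ homBox⟩)
    [(.ax (.extra .coactL), 0, 1), (.inv (.extra .actL), 1, 1)]
    [] (by decide +kernel)

end

end HopfBimoduleData

end

section

variable {H : 𝒞} [HopfObj H]

/-! ### Existence of tensor products and braidings -/

lemma HopfBimoduleData.IsHom.of_comp {X Y Z : HopfBimoduleData H} {q : X.pt ⟶ Y.pt}
    {r : Y.pt ⟶ Z.pt} (hq' : Epi q) (hq : X.IsHom Y q) (hl : ∀ A : 𝒞, Epi (A ◁ q))
    (hr : ∀ A : 𝒞, Epi (q ▷ A)) (hqr : X.IsHom Z (q ≫ r)) : Y.IsHom Z r := by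
  constructor
  · rw [← cancel_epi (H ◁ q), ← Category.assoc, ← hq.actL, Category.assoc, hqr.actL,
      ← whiskerLeft_comp_assoc]
  · rw [← cancel_epi (q ▷ H), ← Category.assoc, ← hq.actR, Category.assoc, hqr.actR,
      ← comp_whiskerRight_assoc]
  · rw [← cancel_epi q, ← Category.assoc, hqr.coactL, reassoc_of% hq.coactL, ← whiskerLeft_comp]
  · rw [← cancel_epi q, ← Category.assoc, hqr.coactR, reassoc_of% hq.coactR, ← comp_whiskerRight]

lemma HopfBimoduleData.IsHom.of_comp_mono {X Y Z : HopfBimoduleData H} {q : Y.pt ⟶ Z.pt}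
    {r : X.pt ⟶ Y.pt} (hq' : Mono q) (hq : Y.IsHom Z q) (hl : ∀ A : 𝒞, Mono (A ◁ q))
    (hr : ∀ A : 𝒞, Mono (q ▷ A)) (hqr : X.IsHom Z (r ≫ q)) : X.IsHom Y r := by
  constructor
  · rw [← cancel_mono q, Category.assoc, hqr.actL, Category.assoc, hq.actL,
      whiskerLeft_comp_assoc]
  · rw [← cancel_mono q, Category.assoc, hqr.actR, Category.assoc, hq.actR,
      comp_whiskerRight_assoc]
  · rw [← cancel_mono (H ◁ q), Category.assoc, ← hq.coactL, ← Category.assoc, hqr.coactL,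
      Category.assoc, whiskerLeft_comp]
  · rw [← cancel_mono (q ▷ H), Category.assoc, ← hq.coactR, ← Category.assoc, hqr.coactR,
      Category.assoc, comp_whiskerRight]

namespace HopfTensor

variable {X Y : HopfBimoduleData H} {P : HopfTensor X Y}

/-- A Hopf bimodule with a morphism `lam` that splits the idempotent `split`, and for which the
other conditions of a tensor product that do not involve universal properties hold, is a tensor
product. -/
theorem isTensor_of_section (hX : X.IsHopfBimodule) (hY : Y.IsHopfBimodule)
    (s : P.obj.pt ⟶ X.pt ⊗ Y.pt) (hs : s ≫ P.lam = 𝟙 _) (hs' : P.lam ≫ s = X.split Y)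
    (hom : (X.odot Y).IsHom P.obj P.lam) (hrho : P.lam ≫ P.rho = X.exchange Y) : P.IsTensor := by
  have hepi : Epi P.lam := ⟨fun a b hab => by
    rw [← Category.id_comp a, ← hs, Category.assoc, hab, ← Category.assoc, hs, Category.id_comp]⟩
  have hl (A : 𝒞) : Epi (A ◁ P.lam) := ⟨fun a b hab => by
    have := A ◁ s ≫= hab
    simpa only [← Category.assoc, ← whiskerLeft_comp, hs, whiskerLeft_id, Category.id_comp]
      using this⟩
  have hr (A : 𝒞) : Epi (P.lam ▷ A) := ⟨fun a b hab => by
    have := s ▷ A ≫= hab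
    simpa only [← Category.assoc, ← comp_whiskerRight, hs, id_whiskerRight, Category.id_comp]
      using this⟩
  have hlam : X.split Y ≫ P.lam = P.lam := by rw [← hs', Category.assoc, hs, Category.comp_id]
  have hbal : X.IsBalanced Y P.lam := by
    have h := HopfBimoduleData.split_isBalanced hX hY
    rw [HopfBimoduleData.IsBalanced] at h ⊢
    rw [← hlam, reassoc_of% h]
  have hcobal : X.IsCobalanced Y P.rho := by
    have h := HopfBimoduleData.exchange_isCobalanced hX hY
    rw [HopfBimoduleData.IsCobalanced] at h ⊢
    rw [← cancel_epi P.lam, reassoc_of% hrho, reassoc_of% hrho, h]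
  have hex := HopfBimoduleData.exchange_isHom hX hY
  have hret : P.rho ≫ X.coinv ▷ Y.pt ≫ P.lam = 𝟙 _ := by
    rw [← cancel_epi P.lam, reassoc_of% hrho, ← Category.assoc,
      HopfBimoduleData.exchange_coinv hX hY, hlam, Category.comp_id]
  refine ⟨(hX.odot hY).of_section hom hs, hbal, fun f hf => ⟨s ≫ f, ?_, fun g hg => ?_⟩, hom,
    hcobal, fun f hf => ⟨f ≫ X.coinv ▷ Y.pt ≫ P.lam, ?_, fun g hg => ?_⟩, ?_, hrho⟩
  · change P.lam ≫ s ≫ f = f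
    rw [← Category.assoc, hs', HopfBimoduleData.IsBalanced.split_comp hf hX hY]
  · rw [← hg, ← Category.assoc, hs, Category.id_comp]
  · change (f ≫ X.coinv ▷ Y.pt ≫ P.lam) ≫ P.rho = f
    rw [Category.assoc, Category.assoc, hrho, HopfBimoduleData.coinv_exchange hX hY,
      HopfBimoduleData.IsCobalanced.comp_cosplit hf hX hY]
  · rw [← hg, Category.assoc, hret, Category.comp_id]
  · exact hom.of_comp hepi hl hr (hrho ▸ hex)

/-- The tensor product of two Hopf bimodules is the image of the idempotent `split`. -/
theorem exists_isTensor [IsIdempotentComplete 𝒞] (hX : X.IsHopfBimodule) (hY : Y.IsHopfBimodule) :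
    ∃ P : HopfTensor X Y, P.IsTensor := by
  have hbal := HopfBimoduleData.split_isBalanced hX hY
  obtain ⟨Z, s, p, hs, hp⟩ := IsIdempotentComplete.idempotents_split _ (X.split Y)
    (hbal.split_comp hX hY)
  have hb : X.IsBalanced Y p := by
    rw [HopfBimoduleData.IsBalanced] at hbal ⊢
    have : X.split Y ≫ p = p := by rw [← hp, Category.assoc, hs, Category.comp_id]
    rw [← this, reassoc_of% hbal]
  let P : HopfTensor X Y :=
    { obj :=
        { pt := Z
          actL := H ◁ s ≫ (X.odot Y).actL ≫ p
          actR := s ▷ H ≫ (X.odot Y).actR ≫ p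
          coactL := s ≫ (X.odot Y).coactL ≫ H ◁ p
          coactR := s ≫ (X.odot Y).coactR ≫ p ▷ H }
      lam := p
      rho := s ≫ X.exchange Y }
  refine ⟨P, isTensor_of_section hX hY s hs hp ⟨?_, ?_, ?_, ?_⟩ ?_⟩
  · change _ = H ◁ p ≫ H ◁ s ≫ _
    rw [← whiskerLeft_comp_assoc, hp, hb.split_actL hX hY]
  · change _ = p ▷ H ≫ s ▷ H ≫ _
    rw [← comp_whiskerRight_assoc, hp, hb.split_actR hX hY]
  · change p ≫ s ≫ _ = _
    rw [← Category.assoc, hp, hb.split_coactL hX hY]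
  · change p ≫ s ≫ _ = _
    rw [← Category.assoc, hp]
    exact hb.split_coactR hX hY
  · change p ≫ s ≫ _ = _
    rw [← Category.assoc, hp,
      (HopfBimoduleData.exchange_isBalanced hX hY).split_comp hX hY]

namespace IsTensor

lemma epi_lam (hP : P.IsTensor) : Epi P.lam :=
  ⟨fun a b hab => (hP.lam_universal (P.lam ≫ a)
    (by rw [← Category.assoc, hP.balanced]; simp)).unique rfl hab.symm⟩

lemma mono_rho (hP : P.IsTensor) : Mono P.rho :=
  ⟨fun a b hab => (hP.rho_universal (a ≫ P.rho)
    (by rw [Category.assoc, hP.cobalanced]; simp)).unique rfl hab.symm⟩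

/-- Every tensor product over `H` splits the idempotent `split`. -/
theorem exists_section (hP : P.IsTensor) (hX : X.IsHopfBimodule) (hY : Y.IsHopfBimodule) :
    ∃ s : P.obj.pt ⟶ X.pt ⊗ Y.pt, s ≫ P.lam = 𝟙 _ ∧ P.lam ≫ s = X.split Y := by
  obtain ⟨s, hs, -⟩ := hP.lam_universal (X.split Y) (HopfBimoduleData.split_isBalanced hX hY)
  have := hP.epi_lam
  have hb : X.IsBalanced Y P.lam := hP.balanced
  refine ⟨s, ?_, hs⟩
  rw [← cancel_epi P.lam, reassoc_of% hs, hb.split_comp hX hY, Category.comp_id]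

/-- A balanced and cobalanced morphism induces a morphism between the tensor products. -/
theorem exists_desc_lift {X' Y' : HopfBimoduleData H} {Q : HopfTensor X' Y'} (hP : P.IsTensor)
    (hQ : Q.IsTensor) {f : X.pt ⊗ Y.pt ⟶ X'.pt ⊗ Y'.pt} (hf : X.IsBalanced Y f)
    (hf' : X'.IsCobalanced Y' f) : ∃ g, P.lam ≫ g ≫ Q.rho = f := by
  obtain ⟨g, hg, -⟩ := hP.lam_universal f hf
  have := hP.epi_lam
  obtain ⟨k, hk, -⟩ := hQ.rho_universal g (by
    rw [← cancel_epi P.lam, reassoc_of% hg, reassoc_of% hg]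
    exact hf')
  exact ⟨k, by rw [hk, hg]⟩

theorem exists_isBraiding {Q : HopfTensor Y X} (hP : P.IsTensor) (hQ : Q.IsTensor)
    (hX : X.IsHopfBimodule) (hY : Y.IsHopfBimodule) : ∃ ψ, P.IsBraiding Q ψ :=
  hP.exists_desc_lift hQ (HopfBimoduleData.theta_isBalanced hX hY)
    (HopfBimoduleData.theta_isCobalanced hX hY)

/-- The tensor product of morphisms of Hopf bimodules is induced by the tensor product in `𝒞` also
on the cotensor products. -/
theorem rho_tensorHom {X' Y' : HopfBimoduleData H} {Q : HopfTensor X' Y'} (hP : P.IsTensor)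
    (hQ : Q.IsTensor) {f : X.pt ⟶ X'.pt} {g : Y.pt ⟶ Y'.pt} (hf : X.IsHom X' f) (hg : Y.IsHom Y' g)
    {F : P.obj.pt ⟶ Q.obj.pt} (hF : P.IsTensorHom Q f g F) : F ≫ Q.rho = P.rho ≫ (f ⊗ₘ g) := by
  have := hP.epi_lam
  rw [HopfTensor.IsTensorHom] at hF
  rw [← cancel_epi P.lam, reassoc_of% hF, hQ.lam_rho, reassoc_of% hP.lam_rho,
    MonoidalCategory.tensorHom_def,
    Category.assoc, hg.whiskerLeft_exchange, ← Category.assoc, hf.whiskerRight_exchange,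
    Category.assoc]

lemma isHom_of_lam (hP : P.IsTensor) (hX : X.IsHopfBimodule) (hY : Y.IsHopfBimodule)
    {Z : HopfBimoduleData H} {f : P.obj.pt ⟶ Z.pt} (hf : (X.odot Y).IsHom Z (P.lam ≫ f)) :
    P.obj.IsHom Z f := by
  obtain ⟨s, hs, -⟩ := hP.exists_section hX hY
  refine hP.lam_hom.of_comp hP.epi_lam (fun A => ⟨fun a b hab => ?_⟩) (fun A => ⟨fun a b hab => ?_⟩)
    hf
  · have : A ◁ s ≫ A ◁ P.lam ≫ a = A ◁ s ≫ A ◁ P.lam ≫ b := A ◁ s ≫= hab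
    rwa [← whiskerLeft_comp_assoc, ← whiskerLeft_comp_assoc, hs, whiskerLeft_id, Category.id_comp,
      Category.id_comp] at this
  · have : s ▷ A ≫ P.lam ▷ A ≫ a = s ▷ A ≫ P.lam ▷ A ≫ b := s ▷ A ≫= hab
    rwa [← comp_whiskerRight_assoc, ← comp_whiskerRight_assoc, hs, id_whiskerRight,
      Category.id_comp, Category.id_comp] at this

/-- The canonical morphism `ρ` has a retraction. -/
lemma rho_coinv_lam (hP : P.IsTensor) (hX : X.IsHopfBimodule) (hY : Y.IsHopfBimodule) :
    P.rho ≫ X.coinv ▷ Y.pt ≫ P.lam = 𝟙 P.obj.pt := by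
  have := hP.epi_lam
  have hb : X.IsBalanced Y P.lam := hP.balanced
  rw [← cancel_epi P.lam, reassoc_of% hP.lam_rho, ← Category.assoc,
    HopfBimoduleData.exchange_coinv hX hY, hb.split_comp hX hY, Category.comp_id]

lemma isHom_of_rho (hP : P.IsTensor) (hX : X.IsHopfBimodule) (hY : Y.IsHopfBimodule)
    {Z : HopfBimoduleData H} {f : Z.pt ⟶ P.obj.pt} (hf : Z.IsHom (X.boxdot Y) (f ≫ P.rho)) :
    Z.IsHom P.obj f := by
  have hr := hP.rho_coinv_lam hX hY
  refine hP.rho_hom.of_comp_mono hP.mono_rho (fun A => ⟨fun a b hab => ?_⟩)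
    (fun A => ⟨fun a b hab => ?_⟩) hf
  · have : (a ≫ A ◁ P.rho) ≫ A ◁ (X.coinv ▷ Y.pt ≫ P.lam)
        = (b ≫ A ◁ P.rho) ≫ A ◁ (X.coinv ▷ Y.pt ≫ P.lam) := hab =≫ _
    rwa [Category.assoc, Category.assoc, ← whiskerLeft_comp, hr, whiskerLeft_id, Category.comp_id,
      Category.comp_id] at this
  · have : (a ≫ P.rho ▷ A) ≫ (X.coinv ▷ Y.pt ≫ P.lam) ▷ A
        = (b ≫ P.rho ▷ A) ≫ (X.coinv ▷ Y.pt ≫ P.lam) ▷ A := hab =≫ _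
    rwa [Category.assoc, Category.assoc, ← comp_whiskerRight, hr, id_whiskerRight,
      Category.comp_id, Category.comp_id] at this

theorem exists_tensorHom {X' Y' : HopfBimoduleData H} {Q : HopfTensor X' Y'} (hP : P.IsTensor)
    (hQ : Q.IsTensor) {f : X.pt ⟶ X'.pt} {g : Y.pt ⟶ Y'.pt} (hf : X.IsHom X' f)
    (hg : Y.IsHom Y' g) : ∃ F, P.IsTensorHom Q f g F := by
  obtain ⟨F, hF, -⟩ := hP.lam_universal ((f ⊗ₘ g) ≫ Q.lam) (by
    have h₁ : X.actR ▷ Y.pt ≫ (f ⊗ₘ g) = (f ▷ H ▷ Y.pt) ≫ ((X'.pt ⊗ H) ◁ g) ≫ X'.actR ▷ Y'.pt := by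
      rw [MonoidalCategory.tensorHom_def, ← comp_whiskerRight_assoc, hf.actR,
        comp_whiskerRight_assoc, whisker_exchange]
    have h₂ : X.pt ◁ Y.actL ≫ (f ⊗ₘ g) = f ▷ (H ⊗ Y.pt) ≫ X'.pt ◁ H ◁ g ≫ X'.pt ◁ Y'.actL := by
      rw [MonoidalCategory.tensorHom_def', ← whiskerLeft_comp_assoc, hg.actL,
        whiskerLeft_comp_assoc, whisker_exchange, whisker_exchange_assoc]
    rw [reassoc_of% h₁, reassoc_of% h₂, hQ.balanced]
    simp)
  exact ⟨F, hF⟩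

end IsTensor

/-! ### The middle interchange -/

section
open Hb

variable {X' Y' : HopfBimoduleData H}

/-- The interpretation of four Hopf bimodules and four of their tensor products. -/
@[reducible] def quad (X Y X' Y' A B A' B' : HopfBimoduleData H) : ℕ → HopfBimoduleData H
  | 0 => X
  | 1 => Y
  | 2 => X'
  | 3 => Y'
  | 4 => A
  | 5 => B
  | 6 => A'
  | _ => B'

variable {XY : HopfTensor X Y} {X'Y' : HopfTensor X' Y'} {XX' : HopfTensor X X'}
  {YY' : HopfTensor Y Y'}

/-- `(x ⊗ y) ⊗ (x' ⊗ y') ↦ λ(x ⊗ x') ⊗ λ(y ⊗ y')` on cotensor products over `H`. -/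
def interchange (XY : HopfTensor X Y) (X'Y' : HopfTensor X' Y') (XX' : HopfTensor X X')
    (YY' : HopfTensor Y Y') : XY.obj.pt ⊗ X'Y'.obj.pt ⟶ XX'.obj.pt ⊗ YY'.obj.pt :=
  (XY.rho ⊗ₘ X'Y'.rho) ≫ tensorμ X.pt Y.pt X'.pt Y'.pt ≫ (XX'.lam ⊗ₘ YY'.lam)

/-- The calculus of the Hopf bimodules `X`, `Y`, `X'`, `Y'` and of four of their tensor products. -/
theorem holds_quad (hX : X.IsHopfBimodule) (hY : Y.IsHopfBimodule) (hX' : X'.IsHopfBimodule)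
    (hY' : Y'.IsHopfBimodule) (hXY : XY.IsTensor) (hX'Y' : X'Y'.IsTensor) (hXX' : XX'.IsTensor)
    (hYY' : YY'.IsTensor) {r : Rule (HbOp QuadBox)} (s t : Script (Ax QuadAx) (HbOp QuadBox))
    (h : r.check (ax quadAx) (allowed 8 fun _ => true) s t = true) :
    (Hb.model (β := QuadBox) (𝟙_ 𝒞) (quad X Y X' Y' XY.obj X'Y'.obj XX'.obj YY'.obj)
      (fun | .rho => XY.rho | .rho' => X'Y'.rho | .lam => XX'.lam | .lam' => YY'.lam)).Holds r := by
  refine Hb.holds_of_check (n := 8) (extra := quadAx) (ok := fun _ => true) (fun i hi => ?_)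
    (fun k _ => ?_) s t h
  · match i, hi with
    | 0, _ => exact hX
    | 1, _ => exact hY
    | 2, _ => exact hX'
    | 3, _ => exact hY'
    | 4, _ => exact hXY.isHopfBimodule
    | 5, _ => exact hX'Y'.isHopfBimodule
    | 6, _ => exact hXX'.isHopfBimodule
    | 7, _ => exact hYY'.isHopfBimodule
  · rcases k with (k | k | k | k | _ | _ | _ | _)
    · cases k
      exacts [hXY.rho_hom.actL, hXY.rho_hom.actR, hXY.rho_hom.coactL, hXY.rho_hom.coactR]
    · cases k
      exacts [hX'Y'.rho_hom.actL, hX'Y'.rho_hom.actR, hX'Y'.rho_hom.coactL, hX'Y'.rho_hom.coactR]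
    · cases k
      exacts [hXX'.lam_hom.actL, hXX'.lam_hom.actR, hXX'.lam_hom.coactL, hXX'.lam_hom.coactR]
    · cases k
      exacts [hYY'.lam_hom.actL, hYY'.lam_hom.actR, hYY'.lam_hom.coactL, hYY'.lam_hom.coactR]
    exacts [hXY.cobalanced, hX'Y'.cobalanced, hXX'.balanced, hYY'.balanced]

theorem interchange_isBalanced (hX : X.IsHopfBimodule) (hY : Y.IsHopfBimodule)
    (hX' : X'.IsHopfBimodule) (hY' : Y'.IsHopfBimodule) (hXY : XY.IsTensor)
    (hX'Y' : X'Y'.IsTensor) (hXX' : XX'.IsTensor) (hYY' : YY'.IsTensor) :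
    XY.obj.IsBalanced X'Y'.obj (interchange XY X'Y' XX' YY') :=
  holds_quad hX hY hX' hY' hXY hX'Y' hXX' hYY' (r := balanced (bimod 4) (bimod 5) Hb.interchange)
    [(.ax (.extra (.rhoHom .actR)), 0, 0), (.ax (.extra .balanced), 3, 0),
      (.natL (.actR 1) 4, 3, 2), (.ax (.extra .balanced'), 6, 3)]
    [(.ax (.extra (.rhoHom' .actL)), 0, 1)] (by decide +kernel)

theorem interchange_isCobalanced (hX : X.IsHopfBimodule) (hY : Y.IsHopfBimodule)
    (hX' : X'.IsHopfBimodule) (hY' : Y'.IsHopfBimodule) (hXY : XY.IsTensor)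
    (hX'Y' : X'Y'.IsTensor) (hXX' : XX'.IsTensor) (hYY' : YY'.IsTensor) :
    XX'.obj.IsCobalanced YY'.obj (interchange XY X'Y' XX' YY') :=
  holds_quad hX hY hX' hY' hXY hX'Y' hXX' hYY' (r := cobalanced (bimod 6) (bimod 7) Hb.interchange)
    [(.ax (.extra (.lamHom .coactR)), 3, 0), (.ax (.extra .cobalanced), 0, 0),
      (.ax (.extra .cobalanced'), 2, 3)]
    [(.ax (.extra (.lamHom' .coactL)), 4, 1)] (by decide +kernel)

/-- The middle factor of the exchange of `X ⊗_H X'` and `Y ⊗_H Y'` is the exchange of `X'` and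
`Y`, that of the middle interchange is `Θ`; the outer factors agree. -/
theorem exists_outer (hX : X.IsHopfBimodule) (hY : Y.IsHopfBimodule)
    (hX' : X'.IsHopfBimodule) (hY' : Y'.IsHopfBimodule) (hXY : XY.IsTensor)
    (hX'Y' : X'Y'.IsTensor) (hXX' : XX'.IsTensor) (hYY' : YY'.IsTensor) :
    ∃ u : X.pt ⊗ ((X'.pt ⊗ Y.pt) ⊗ Y'.pt) ⟶ XX'.obj.pt ⊗ YY'.obj.pt,
      (XX'.lam ⊗ₘ YY'.lam) ≫ XX'.obj.exchange YY'.obj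
        = 𝟙 ((X.pt ⊗ X'.pt) ⊗ (Y.pt ⊗ Y'.pt)) ⊗≫ X.pt ◁ (X'.exchange Y ▷ Y'.pt) ≫ u ∧
      X.pt ◁ (Y.theta X' ▷ Y'.pt) ≫ u
        = 𝟙 (X.pt ⊗ ((Y.pt ⊗ X'.pt) ⊗ Y'.pt)) ⊗≫ (X.exchange Y ⊗ₘ X'.exchange Y') ≫
          tensorμ X.pt Y.pt X'.pt Y'.pt ≫ (XX'.lam ⊗ₘ YY'.lam) := by
  have h r s t hc := holds_quad hX hY hX' hY' hXY hX'Y' hXX' hYY' (r := r) s t hc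
  refine ⟨(Hb.model (β := QuadBox) (𝟙_ 𝒞) (quad X Y X' Y' XY.obj X'Y'.obj XX'.obj YY'.obj)
      (fun | .rho => XY.rho | .rho' => X'Y'.rho | .lam => XX'.lam | .lam' => YY'.lam)).den outer,
    ?_, ?_⟩
  · exact h ⟨_, _, (Hb.lam ⊗ᵗ lam') ≫ᵗ (bimod 6).exchange (bimod 7),
      .id ((Hb.X 0 ⊗ᵒ Hb.X 2) ⊗ᵒ (Hb.X 1 ⊗ᵒ Hb.X 3)) ⊗≫ᵗ
        Hb.X 0 ◁ᵗ ((bimod 2).exchange (bimod 1) ▷ᵗ Hb.X 3) ≫ᵗ outer⟩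
      [(.ax (.extra (.lamHom .coactR)), 0, 0), (.ax (.extra (.lamHom' .coactL)), 5, 2),
        (.inv (.extra (.lamHom .actR)), 4, 0), (.inv (.extra (.lamHom' .actL)), 8, 3),
        (.natL .mul 0, 3, 2), (.natR 0 .mul, 6, 3)]
      [(.natL (.actL 1) 0, 4, 2), (.natR 0 (.actR 2), 3, 0), (.ax (.bimod 1 .mulActL), 7, 4),
        (.ax (.bimod 2 .actRMul), 9, 1)] (by decide +kernel)
  · exact h ⟨_, _, Hb.X 0 ◁ᵗ ((bimod 1).theta (bimod 2) ▷ᵗ Hb.X 3) ≫ᵗ outer,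
      .id (Hb.X 0 ⊗ᵒ ((Hb.X 1 ⊗ᵒ Hb.X 2) ⊗ᵒ Hb.X 3)) ⊗≫ᵗ
        ((bimod 0).exchange (bimod 1) ⊗ᵗ (bimod 2).exchange (bimod 3)) ≫ᵗ
        .tensorμ (Hb.X 0) (Hb.X 1) (Hb.X 2) (Hb.X 3) ≫ᵗ (Hb.lam ⊗ᵗ lam')⟩
      [(.natL (.actR 1) 0, 4, 2), (.natR 0 (.actL 2), 3, 0), (.ax (.bimod 2 .actLActR), 10, 1),
        (.inv (.bimod 1 .actLActR), 7, 4), (.ax (.extra .balanced'), 14, 1)]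
      [(.ax (.extra .balanced), 3, 0), (.natL (.actL 1) 4, 3, 2), (.natR 3 (.actR 2), 6, 3)]
      (by decide +kernel)

end
end HopfTensor

end

section

variable {H : 𝒞} [HopfObj H]

namespace HopfTensor

variable {X Y X' Y' : HopfBimoduleData H} {XY : HopfTensor X Y} {X'Y' : HopfTensor X' Y'}
  {XX' : HopfTensor X X'} {YY' : HopfTensor Y Y'} {YX' : HopfTensor Y X'} {X'Y : HopfTensor X' Y}

/-- The morphism `id ⊗_H ψ ⊗_H id` for a braiding `ψ` is induced by the interchange in `𝒞` of the
middle factors. -/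
theorem exists_isMiddle (hX : X.IsHopfBimodule) (hY : Y.IsHopfBimodule)
    (hX' : X'.IsHopfBimodule) (hY' : Y'.IsHopfBimodule) (hXY : XY.IsTensor)
    (hX'Y' : X'Y'.IsTensor) (hXX' : XX'.IsTensor) (hYY' : YY'.IsTensor)
    (hX'Y : X'Y.IsTensor) {S : HopfTensor XY.obj X'Y'.obj} (hS : S.IsTensor)
    {T : HopfTensor XX'.obj YY'.obj} (hT : T.IsTensor) {ψ : YX'.obj.pt ⟶ X'Y.obj.pt}
    (hψ : YX'.IsBraiding X'Y ψ) :
    ∃ τ : S.obj.pt ⟶ T.obj.pt, HopfTensor.IsMiddle (XY := XY) (X'Y' := X'Y') S ψ T τ ∧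
      S.lam ≫ τ ≫ T.rho = interchange XY X'Y' XX' YY' := by
  obtain ⟨τ, hτ⟩ := hS.exists_desc_lift hT
    (interchange_isBalanced hX hY hX' hY' hXY hX'Y' hXX' hYY')
    (interchange_isCobalanced hX hY hX' hY' hXY hX'Y' hXX' hYY')
  obtain ⟨u, hu, hu'⟩ := exists_outer hX hY hX' hY' hXY hX'Y' hXX' hYY'
  obtain ⟨s, hs, hs'⟩ := hX'Y.exists_section hX' hY
  have := hT.mono_rho
  have key : (𝟙 (X.pt ⊗ ((X'.pt ⊗ Y.pt) ⊗ Y'.pt)) ⊗≫ (XX'.lam ⊗ₘ YY'.lam) ≫ T.lam) ≫ T.rho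
      = X.pt ◁ (X'.exchange Y ▷ Y'.pt) ≫ u := by
    simp only [monoidalComp, Category.assoc, Category.id_comp, hT.lam_rho, hu]
    simp only [← Category.assoc]
    congr 2
    simp
  refine ⟨τ, ⟨X.pt ◁ (s ▷ Y'.pt) ≫ (𝟙 (X.pt ⊗ ((X'.pt ⊗ Y.pt) ⊗ Y'.pt)) ⊗≫
    (XX'.lam ⊗ₘ YY'.lam) ≫ T.lam), ?_, ?_⟩, hτ⟩
  · rw [← cancel_mono T.rho, Category.assoc, Category.assoc, key, ← whiskerLeft_comp_assoc,
      ← comp_whiskerRight, hs', ← whiskerLeft_comp_assoc, ← comp_whiskerRight,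
      (HopfBimoduleData.exchange_isBalanced hX' hY).split_comp hX' hY]
  · have hr : s ≫ X'.exchange Y = X'Y.rho := by
      rw [← hX'Y.lam_rho, ← Category.assoc, hs, Category.id_comp]
    rw [← cancel_mono T.rho]
    simp only [monoidalComp, Category.assoc, Category.id_comp] at key ⊢
    rw [hτ, key, ← whiskerLeft_comp_assoc, ← whiskerLeft_comp_assoc, ← comp_whiskerRight,
      ← comp_whiskerRight, Category.assoc, Category.assoc, hr, hψ, hu', interchange,
      ← Category.assoc, MonoidalCategory.tensorHom_comp_tensorHom, hXY.lam_rho, hX'Y'.lam_rho]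
    simp [monoidalComp]

end HopfTensor

/-! ### Bialgebras in the category of Hopf bimodules -/

namespace HopfBialgData

variable {Z : HopfBimoduleData H} {P : HopfTensor Z Z}

/-- The compatibility of the multiplication and the comultiplication of a bialgebra in the category
of Hopf bimodules amounts to that of the associated structure morphisms in `𝒞`. -/
theorem exists_mul_comul [IsIdempotentComplete 𝒞] (hZ : Z.IsHopfBimodule) (hP : P.IsTensor)
    (b : HopfBialgData P) (hm : P.obj.IsHom Z b.mul) (hd : Z.IsHom P.obj b.comul)
    (h : b.toBialgData.mul ≫ b.toBialgData.comul
      = (b.toBialgData.comul ⊗ₘ b.toBialgData.comul) ≫ tensorμ Z.pt Z.pt Z.pt Z.pt ≫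
        (b.toBialgData.mul ⊗ₘ b.toBialgData.mul)) :
    ∃ (PP : HopfTensor P.obj P.obj) (ψ : P.obj.pt ⟶ P.obj.pt)
      (dd : P.obj.pt ⟶ PP.obj.pt) (τ : PP.obj.pt ⟶ PP.obj.pt) (mm : PP.obj.pt ⟶ P.obj.pt),
      PP.IsTensor ∧ P.IsBraiding P ψ ∧ P.IsTensorHom PP b.comul b.comul dd ∧
      HopfTensor.IsMiddle (XY := P) (X'Y' := P) PP (YX' := P) (X'Y := P) ψ
        (XX' := P) (YY' := P) PP τ ∧
      PP.IsTensorHom P b.mul b.mul mm ∧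
      b.mul ≫ b.comul = dd ≫ τ ≫ mm := by
  obtain ⟨PP, hPP⟩ := HopfTensor.exists_isTensor hP.isHopfBimodule hP.isHopfBimodule
  obtain ⟨ψ, hψ⟩ := hP.exists_isBraiding hP hZ hZ
  obtain ⟨dd, hdd⟩ := hP.exists_tensorHom hPP hd hd
  obtain ⟨mm, hmm⟩ := hPP.exists_tensorHom hP hm hm
  obtain ⟨τ, hτ, hτ'⟩ := HopfTensor.exists_isMiddle hZ hZ hZ hZ hP hP hP hP hP hPP hPP hψ
  refine ⟨PP, ψ, dd, τ, mm, hPP, hψ, hdd, hτ, hmm, ?_⟩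
  have := hP.epi_lam
  have := hP.mono_rho
  have hmm' := hPP.rho_tensorHom hP hm hm hmm
  rw [HopfTensor.IsTensorHom] at hdd
  rw [← cancel_epi P.lam, ← cancel_mono P.rho]
  simp only [toBialgData, Category.assoc] at h ⊢
  rw [h, hmm', reassoc_of% hdd, reassoc_of% hτ', HopfTensor.interchange]
  simp only [Category.assoc, MonoidalCategory.tensorHom_comp_tensorHom_assoc,
    MonoidalCategory.tensorHom_comp_tensorHom]

end HopfBialgData

end

section

/-! ### The calculus of bialgebras with a projection to `H` -/

/-- The generating morphisms of the calculus of a bialgebra `Z` with morphisms of bialgebras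
`i : H ⟶ Z` and `p : Z ⟶ H`. -/
inductive ProjOp
  | mulH | oneH | comulH | counitH | mul | one | comul | counit | incl | proj
  deriving DecidableEq

namespace Proj

/-- The Hopf algebra has colour `0`. -/
abbrev H : Ob := .of 0
/-- The bialgebra `Z` has colour `1`. -/
abbrev Z : Ob := .of 1

open ProjOp in
/-- The sources of the generating morphisms. -/
@[reducible] def dom : ProjOp → Ob
  | mulH => H ⊗ᵒ H | oneH => .one | comulH => H | counitH => H
  | mul => Z ⊗ᵒ Z | one => .one | comul => Z | counit => Z
  | incl => H | proj => Z

open ProjOp in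
/-- The targets of the generating morphisms. -/
@[reducible] def cod : ProjOp → Ob
  | mulH => H | oneH => H | comulH => H ⊗ᵒ H | counitH => .one
  | mul => Z | one => Z | comul => Z ⊗ᵒ Z | counit => .one
  | incl => Z | proj => H

end Proj

instance : Signature ProjOp := ⟨Proj.dom, Proj.cod⟩

namespace Proj

abbrev bialgH : Bialg ProjOp H :=
  ⟨.gen (.op ProjOp.mulH), .gen (.op ProjOp.oneH), .gen (.op ProjOp.comulH),
    .gen (.op ProjOp.counitH)⟩
abbrev bialgZ : Bialg ProjOp Z :=
  ⟨.gen (.op ProjOp.mul), .gen (.op ProjOp.one), .gen (.op ProjOp.comul),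
    .gen (.op ProjOp.counit)⟩
abbrev incl : Tm ProjOp H Z := .gen (.op ProjOp.incl)
abbrev proj : Tm ProjOp Z H := .gen (.op ProjOp.proj)

/-- The Hopf bimodule structure of `Z` that is induced by `i` and `p`. -/
abbrev bimod : Bimod ProjOp H where
  pt := Z
  actL := incl ▷ᵗ Z ≫ᵗ bialgZ.mul
  actR := Z ◁ᵗ incl ≫ᵗ bialgZ.mul
  coactL := bialgZ.comul ≫ᵗ proj ▷ᵗ Z
  coactR := bialgZ.comul ≫ᵗ Z ◁ᵗ proj

end Proj

/-- Labels for the ten axioms of a bialgebra. -/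
inductive BialgAx
  | assoc | oneMul | mulOne | coassoc | counitComul | comulCounit
  | mulComul | oneComul | mulCounit | oneCounit

/-- The ten axioms of a bialgebra. -/
abbrev Diagram.bialgAx {G : Type} [Signature G] {A : Ob} (D : Bialg G A) : BialgAx → Rule G
  | .assoc => .mulAssoc D.mul
  | .oneMul => .oneMul D.mul D.one
  | .mulOne => .mulOne D.mul D.one
  | .coassoc => .comulAssoc D.comul
  | .counitComul => .counitComul D.comul D.counit
  | .comulCounit => .comulCounit D.comul D.counit
  | .mulComul => .mulComul D.mul D.comul
  | .oneComul => .oneComul D.one D.comul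
  | .mulCounit => .mulCounit D.mul D.counit
  | .oneCounit => .oneCounit D.one D.counit

/-- Labels for the equations that say that `H` and `Z` are bialgebras, that `i` and `p` are
morphisms of bialgebras, and that `p ∘ i = id`. -/
inductive ProjAx
  | bialgH (k : BialgAx) | bialgZ (k : BialgAx)
  | mulIncl | oneIncl | inclComul | inclCounit
  | mulProj | oneProj | projComul | projCounit
  | inclProj

namespace Proj

/-- The equations with the given labels. -/
@[reducible] def ax : ProjAx → Rule ProjOp
  | .bialgH k => bialgAx bialgH k
  | .bialgZ k => bialgAx bialgZ k
  | .mulIncl => ⟨_, _, bialgH.mul ≫ᵗ incl, (incl ⊗ᵗ incl) ≫ᵗ bialgZ.mul⟩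
  | .oneIncl => ⟨_, _, bialgH.one ≫ᵗ incl, bialgZ.one⟩
  | .inclComul => ⟨_, _, incl ≫ᵗ bialgZ.comul, bialgH.comul ≫ᵗ (incl ⊗ᵗ incl)⟩
  | .inclCounit => ⟨_, _, incl ≫ᵗ bialgZ.counit, bialgH.counit⟩
  | .mulProj => ⟨_, _, bialgZ.mul ≫ᵗ proj, (proj ⊗ᵗ proj) ≫ᵗ bialgH.mul⟩
  | .oneProj => ⟨_, _, bialgZ.one ≫ᵗ proj, bialgH.one⟩
  | .projComul => ⟨_, _, proj ≫ᵗ bialgH.comul, bialgZ.comul ≫ᵗ (proj ⊗ᵗ proj)⟩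
  | .projCounit => ⟨_, _, proj ≫ᵗ bialgH.counit, bialgZ.counit⟩
  | .inclProj => ⟨_, _, incl ≫ᵗ proj, .id H⟩

end Proj

section
variable {A : 𝒞} {D : BialgData A}

/-- A bialgebra satisfies the formal axioms under every interpretation by it. The equation `hE` is
heterogeneous since the interpretation of the colour `a` need not be `A` by definition. -/
theorem BialgData.IsBialgebra.holds (hD : D.IsBialgebra) {G : Type} [Signature G] {a : ℕ}
    {E : Bialg G (.of a)} {S : Model G 𝒞} (hA : S.obj a = A)
    (hE : HEq (E.data S) D) (k : BialgAx) : S.Holds (bialgAx E k) := by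
  subst hA
  obtain rfl := eq_of_heq hE
  obtain ⟨_, hm, ho, hd, hc⟩ := hD
  have hm : μ[S.obj a] = S.den E.mul := hm
  have ho : η[S.obj a] = S.den E.one := ho
  have hd : Δ[S.obj a] = S.den E.comul := hd
  have hc : ε[S.obj a] = S.den E.counit := hc
  cases k <;> simp only [Model.Holds, bialgAx, Model.den, ← hm, ← ho, ← hd, ← hc]
  case assoc => exact MonObj.mul_assoc _
  case oneMul => exact MonObj.one_mul _
  case mulOne => exact MonObj.mul_one _
  case coassoc => simp
  case counitComul => exact ComonObj.counit_comul _
  case comulCounit => exact ComonObj.comul_counit _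
  case mulComul => exact BimonObj.mul_comul _
  case oneComul => exact BimonObj.one_comul _
  case mulCounit => exact BimonObj.mul_counit _
  case oneCounit => exact BimonObj.one_counit _

end

variable {H : 𝒞} [HopfObj H]

theorem BialgData.of_isBialgebra : (BialgData.of H).IsBialgebra :=
  ⟨inferInstance, rfl, rfl, rfl, rfl⟩

namespace Proj

/-- The interpretation of the colours. -/
@[reducible] def objects (H Z : 𝒞) : ℕ → 𝒞
  | 0 => H
  | _ => Z

/-- The interpretation of the generating morphisms. -/
@[reducible] def model {Z : 𝒞} (D : BialgData Z) (i : H ⟶ Z) (p : Z ⟶ H) : Model ProjOp 𝒞 where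
  obj := objects H Z
  mor := fun
    | .mulH => μ[H] | .oneH => η[H] | .comulH => Δ[H] | .counitH => ε[H]
    | .mul => D.mul | .one => D.one | .comul => D.comul | .counit => D.counit
    | .incl => i | .proj => p

/-- Equations that can be derived from those of `H`, `Z`, `i` and `p` hold. -/
theorem holds_of_check {Z : 𝒞} {D : BialgData Z} {i : H ⟶ Z} {p : Z ⟶ H} (hD : D.IsBialgebra)
    (hi : (BialgData.of H).IsBialgHom D i) (hp : D.IsBialgHom (BialgData.of H) p)
    (hip : i ≫ p = 𝟙 H) {r : Rule ProjOp} (s t : Script ProjAx ProjOp)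
    (h : r.check ax (fun _ => true) s t = true) :
    (model D i p).Holds r := by
  refine (model D i p).holds_of_check (fun k _ => ?_) s t h
  cases k
  case bialgH k =>
    exact BialgData.IsBialgebra.holds (S := model D i p) (E := Proj.bialgH) (D := BialgData.of H)
      BialgData.of_isBialgebra rfl HEq.rfl k
  case bialgZ k =>
    exact hD.holds (S := model D i p) (E := Proj.bialgZ) rfl HEq.rfl k
  case mulIncl => exact hi.1.1
  case oneIncl => exact hi.1.2
  case inclComul => exact hi.2.1
  case inclCounit => exact hi.2.2
  case mulProj => exact hp.1.1
  case oneProj => exact hp.1.2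
  case projComul => exact hp.2.1
  case projCounit => exact hp.2.2
  case inclProj => exact hip

end Proj

end

section

variable {H : 𝒞} [HopfObj H]

/-! ### Bialgebras with a projection to `H` -/

/-- The Hopf bimodule structure of `Z` is induced by morphisms of bialgebras `i : H ⟶ Z` and
`p : Z ⟶ H` with `p ∘ i = id`. -/
structure IsBialgebraOver (Z : HopfBimoduleData H) (D : BialgData Z.pt) (i : H ⟶ Z.pt)
    (p : Z.pt ⟶ H) : Prop where
  isBialgebra : D.IsBialgebra
  incl_hom : (BialgData.of H).IsBialgHom D i
  proj_hom : D.IsBialgHom (BialgData.of H) p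
  incl_proj : i ≫ p = 𝟙 H
  actL : Z.actL = i ▷ Z.pt ≫ D.mul
  actR : Z.actR = Z.pt ◁ i ≫ D.mul
  coactL : Z.coactL = D.comul ≫ p ▷ Z.pt
  coactR : Z.coactR = D.comul ≫ Z.pt ◁ p

namespace IsBialgebraOver

open Proj

variable {Z : HopfBimoduleData H} {D : BialgData Z.pt} {i : H ⟶ Z.pt} {p : Z.pt ⟶ H}

/-- Morphisms of bialgebras `i : H ⟶ Z` and `p : Z ⟶ H` with `p ∘ i = id` make `Z` a Hopf
bimodule. -/
theorem isHopfBimodule (h : IsBialgebraOver Z D i p) : Z.IsHopfBimodule := by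
  have hh r s t hc := Proj.holds_of_check h.isBialgebra h.incl_hom h.proj_hom h.incl_proj
    (r := r) s t hc
  constructor <;> simp only [h.actL, h.actR, h.coactL, h.coactR]
  · exact hh (bimodAx bialgH bimod .oneActL)
      [(.ax .oneIncl, 0, 0), (.ax (.bialgZ .oneMul), 0, 0)]
      [] (by decide +kernel)
  · exact (hh (bimodAx bialgH bimod .mulActL)
      []
      [(.ax .mulIncl, 0, 0), (.ax (.bialgZ .assoc), 2, 0)] (by decide +kernel)).symm
  · exact hh (bimodAx bialgH bimod .actROne)
      [(.ax .oneIncl, 0, 1), (.ax (.bialgZ .mulOne), 0, 0)]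
      [] (by decide +kernel)
  · exact (hh (bimodAx bialgH bimod .actRMul)
      [(.ax (.bialgZ .assoc), 1, 0)]
      [(.ax .mulIncl, 0, 1)] (by decide +kernel)).symm
  · exact hh (bimodAx bialgH bimod .actLActR)
      [(.ax (.bialgZ .assoc), 1, 0)]
      [] (by decide +kernel)
  · exact hh (bimodAx bialgH bimod .coactLCounit)
      [(.ax .projCounit, 1, 0), (.ax (.bialgZ .counitComul), 0, 0)]
      [] (by decide +kernel)
  · exact (hh (bimodAx bialgH bimod .coactLComul)
      []
      [(.ax .projComul, 1, 0), (.ax (.bialgZ .coassoc), 0, 0)] (by decide +kernel)).symm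
  · exact hh (bimodAx bialgH bimod .coactRCounit)
      [(.ax .projCounit, 1, 1), (.ax (.bialgZ .comulCounit), 0, 0)]
      [] (by decide +kernel)
  · exact (hh (bimodAx bialgH bimod .coactRComul)
      [(.ax (.bialgZ .coassoc), 0, 0)]
      [(.ax .projComul, 1, 1)] (by decide +kernel)).symm
  · exact hh (bimodAx bialgH bimod .coactLCoactR)
      []
      [(.ax (.bialgZ .coassoc), 0, 0)] (by decide +kernel)
  · exact hh (bimodAx bialgH bimod .actLCoactL)
      [(.ax (.bialgZ .mulComul), 1, 0), (.ax .inclComul, 0, 0), (.ax .mulProj, 5, 0),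
        (.ax .inclProj, 1, 0)]
      [] (by decide +kernel)
  · exact hh (bimodAx bialgH bimod .actLCoactR)
      [(.ax (.bialgZ .mulComul), 1, 0), (.ax .inclComul, 0, 0), (.ax .mulProj, 5, 2),
        (.ax .inclProj, 1, 1)]
      [] (by decide +kernel)
  · exact hh (bimodAx bialgH bimod .actRCoactL)
      [(.ax (.bialgZ .mulComul), 1, 0), (.ax .inclComul, 0, 1), (.ax .mulProj, 5, 0),
        (.ax .inclProj, 1, 1)]
      [] (by decide +kernel)
  · exact hh (bimodAx bialgH bimod .actRCoactR)
      [(.ax (.bialgZ .mulComul), 1, 0), (.ax .inclComul, 0, 1), (.ax .mulProj, 5, 2),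
        (.ax .inclProj, 1, 2)]
      [] (by decide +kernel)

theorem mul_isBalanced (h : IsBialgebraOver Z D i p) : Z.IsBalanced Z D.mul := by
  have hh r s t hc := Proj.holds_of_check h.isBialgebra h.incl_hom h.proj_hom h.incl_proj
    (r := r) s t hc
  rw [HopfBimoduleData.IsBalanced, h.actL, h.actR]
  exact hh (balanced bimod bimod bialgZ.mul)
    [(.ax (.bialgZ .assoc), 1, 0)]
    [] (by decide +kernel)

theorem comul_isCobalanced (h : IsBialgebraOver Z D i p) : Z.IsCobalanced Z D.comul := by
  have hh r s t hc := Proj.holds_of_check h.isBialgebra h.incl_hom h.proj_hom h.incl_proj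
    (r := r) s t hc
  rw [HopfBimoduleData.IsCobalanced, h.coactL, h.coactR]
  exact hh (cobalanced bimod bimod bialgZ.comul)
    [(.ax (.bialgZ .coassoc), 0, 0)]
    [] (by decide +kernel)

theorem mul_isHom (h : IsBialgebraOver Z D i p) : (Z.odot Z).IsHom Z D.mul := by
  have hh r s t hc := Proj.holds_of_check h.isBialgebra h.incl_hom h.proj_hom h.incl_proj
    (r := r) s t hc
  constructor <;> simp only [HopfBimoduleData.odot, h.actL, h.actR, h.coactL, h.coactR]
  · exact hh (hom (.odot bialgH.mul bimod bimod) bimod bialgZ.mul .actL)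
      [(.ax (.bialgZ .assoc), 1, 0)]
      [] (by decide +kernel)
  · exact hh (hom (.odot bialgH.mul bimod bimod) bimod bialgZ.mul .actR)
      []
      [(.ax (.bialgZ .assoc), 0, 0)] (by decide +kernel)
  · exact hh (hom (.odot bialgH.mul bimod bimod) bimod bialgZ.mul .coactL)
      [(.ax (.bialgZ .mulComul), 0, 0), (.ax .mulProj, 3, 0)]
      [] (by decide +kernel)
  · exact hh (hom (.odot bialgH.mul bimod bimod) bimod bialgZ.mul .coactR)
      [(.ax (.bialgZ .mulComul), 0, 0), (.ax .mulProj, 3, 2)]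
      [] (by decide +kernel)

theorem comul_isHom (h : IsBialgebraOver Z D i p) : Z.IsHom (Z.boxdot Z) D.comul := by
  have hh r s t hc := Proj.holds_of_check h.isBialgebra h.incl_hom h.proj_hom h.incl_proj
    (r := r) s t hc
  constructor <;> simp only [HopfBimoduleData.boxdot, h.actL, h.actR, h.coactL, h.coactR]
  · exact hh (hom bimod (.boxdot bialgH.comul bimod bimod) bialgZ.comul .actL)
      [(.ax (.bialgZ .mulComul), 1, 0), (.ax .inclComul, 0, 0)]
      [] (by decide +kernel)
  · exact hh (hom bimod (.boxdot bialgH.comul bimod bimod) bialgZ.comul .actR)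
      [(.ax (.bialgZ .mulComul), 1, 0), (.ax .inclComul, 0, 1)]
      [] (by decide +kernel)
  · exact hh (hom bimod (.boxdot bialgH.comul bimod bimod) bialgZ.comul .coactL)
      [(.ax (.bialgZ .coassoc), 0, 0)]
      [] (by decide +kernel)
  · exact hh (hom bimod (.boxdot bialgH.comul bimod bimod) bialgZ.comul .coactR)
      []
      [(.ax (.bialgZ .coassoc), 0, 0)] (by decide +kernel)

theorem one_isHom (h : IsBialgebraOver Z D i p) : (HopfBimoduleData.unit H).IsHom Z i := by
  have hh r s t hc := Proj.holds_of_check h.isBialgebra h.incl_hom h.proj_hom h.incl_proj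
    (r := r) s t hc
  constructor <;> simp only [HopfBimoduleData.unit, h.actL, h.actR, h.coactL, h.coactR]
  · exact hh (hom (.unit bialgH) bimod incl .actL)
      [(.ax .mulIncl, 0, 0)]
      [] (by decide +kernel)
  · exact hh (hom (.unit bialgH) bimod incl .actR)
      [(.ax .mulIncl, 0, 0)]
      [] (by decide +kernel)
  · exact hh (hom (.unit bialgH) bimod incl .coactL)
      [(.ax .inclComul, 0, 0), (.ax .inclProj, 1, 0)]
      [] (by decide +kernel)
  · exact hh (hom (.unit bialgH) bimod incl .coactR)
      [(.ax .inclComul, 0, 0), (.ax .inclProj, 1, 1)]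
      [] (by decide +kernel)

theorem counit_isHom (h : IsBialgebraOver Z D i p) : Z.IsHom (HopfBimoduleData.unit H) p := by
  have hh r s t hc := Proj.holds_of_check h.isBialgebra h.incl_hom h.proj_hom h.incl_proj
    (r := r) s t hc
  constructor <;> simp only [HopfBimoduleData.unit, h.actL, h.actR, h.coactL, h.coactR]
  · exact hh (hom bimod (.unit bialgH) proj .actL)
      [(.ax .mulProj, 1, 0), (.ax .inclProj, 0, 0)]
      [] (by decide +kernel)
  · exact hh (hom bimod (.unit bialgH) proj .actR)
      [(.ax .mulProj, 1, 0), (.ax .inclProj, 0, 1)]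
      [] (by decide +kernel)
  · exact hh (hom bimod (.unit bialgH) proj .coactL)
      [(.ax .projComul, 0, 0)]
      [] (by decide +kernel)
  · exact hh (hom bimod (.unit bialgH) proj .coactR)
      [(.ax .projComul, 0, 0)]
      [] (by decide +kernel)

/-- A bialgebra in `𝒞` with a projection to `H` is one in the category of Hopf bimodules: its
multiplication is balanced, its comultiplication is cobalanced, and both are morphisms of Hopf
bimodules. -/
theorem exists_isBialgebra [IsIdempotentComplete 𝒞] (h : IsBialgebraOver Z D i p)
    {P : HopfTensor Z Z} (hP : P.IsTensor) :
    ∃ b : HopfBialgData P, b.IsBialgebra ∧ b.toBialgData = D ∧ b.one = i ∧ b.counit = p := by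
  have hZ := h.isHopfBimodule
  obtain ⟨m, hm, -⟩ := hP.lam_universal D.mul h.mul_isBalanced
  obtain ⟨d, hd, -⟩ := hP.rho_universal D.comul h.comul_isCobalanced
  have h1 : η[H] ≫ i = D.one := h.incl_hom.1.2
  have h2 : p ≫ ε[H] = D.counit := h.proj_hom.2.2
  let b : HopfBialgData P := ⟨m, i, d, p⟩
  have hb : b.toBialgData = D := by
    obtain ⟨mul, one, comul, counit⟩ := D
    exact congr (congr (congr (congrArg BialgData.mk hm) h1) hd) h2
  have hmh : P.obj.IsHom Z m := hP.isHom_of_lam hZ hZ (hm ▸ h.mul_isHom)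
  have hdh : Z.IsHom P.obj d := hP.isHom_of_rho hZ hZ (hd ▸ h.comul_isHom)
  obtain ⟨_, rm, ro, rd, rc⟩ := h.isBialgebra
  refine ⟨b, ⟨hmh, h.one_isHom, hdh, h.counit_isHom, ?_, ?_, ?_, ?_, ?_, ?_, h.incl_proj, ?_, ?_,
    ?_⟩, hb, rfl, rfl⟩
  · change (P.lam ≫ m) ▷ _ ≫ P.lam ≫ m = _ ≫ _ ◁ (P.lam ≫ m) ≫ P.lam ≫ m
    rw [hm, ← rm]
    exact MonObj.mul_assoc _
  · change i ▷ _ ≫ P.lam ≫ m = _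
    rw [hm, h.actL]
  · change _ ◁ i ≫ P.lam ≫ m = _
    rw [hm, h.actR]
  · change (d ≫ P.rho) ≫ (d ≫ P.rho) ▷ _ ≫ _ = (d ≫ P.rho) ≫ _ ◁ (d ≫ P.rho)
    rw [hd, ← rd]
    simp
  · change (d ≫ P.rho) ≫ p ▷ _ = _
    rw [hd, h.coactL]
  · change (d ≫ P.rho) ≫ _ ◁ p = _
    rw [hd, h.coactR]
  · change P.lam ≫ m ≫ p = _
    rw [← Category.assoc, hm]
    exact h.proj_hom.1.1
  · change i ≫ d ≫ P.rho = _
    rw [hd]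
    exact h.incl_hom.2.1
  · refine HopfBialgData.exists_mul_comul hZ hP b hmh hdh ?_
    rw [hb, ← rm, ← rd]
    exact BimonObj.mul_comul _

end IsBialgebraOver

end

/-! ### Tensor products of bialgebras in the category of Hopf bimodules -/

namespace HopfBialgData

variable {H : 𝒞} [HopfObj H] {X Y : HopfBimoduleData H} {PX : HopfTensor X X}
  {PY : HopfTensor Y Y} {Q : HopfTensor Y X} {PZ : HopfTensor Q.obj Q.obj}

/-- A bialgebra on `Y ⊗_H X` is the tensor product of `Y` and `X` when its structure morphisms in
`𝒞` are obtained from the componentwise ones on the cotensor product and on the tensor product. -/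
theorem isTensorProduct [IsIdempotentComplete 𝒞] (hX : X.IsHopfBimodule) (hY : Y.IsHopfBimodule)
    (hPX : PX.IsTensor) (hPY : PY.IsTensor) (hQ : Q.IsTensor) (hPZ : PZ.IsTensor)
    {bY : HopfBialgData PY} {bX : HopfBialgData PX} {bZ : HopfBialgData PZ}
    (hbY : bY.IsBialgebra) (hbX : bX.IsBialgebra)
    (mul : bZ.toBialgData.mul ≫ Q.rho = (Q.rho ⊗ₘ Q.rho) ≫ tensorμ Y.pt X.pt Y.pt X.pt ≫
      (bY.toBialgData.mul ⊗ₘ bX.toBialgData.mul))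
    (comul : Q.lam ≫ bZ.toBialgData.comul = (bY.toBialgData.comul ⊗ₘ bX.toBialgData.comul) ≫
      tensorμ Y.pt Y.pt X.pt X.pt ≫ (Q.lam ⊗ₘ Q.lam))
    (one : μ[H] ≫ bZ.one = (bY.one ⊗ₘ bX.one) ≫ Q.lam)
    (counit : bZ.counit ≫ Δ[H] = Q.rho ≫ (bY.counit ⊗ₘ bX.counit)) :
    bY.IsTensorProduct bX bZ := by
  obtain ⟨P, hP⟩ := HopfTensor.exists_isTensor hX hY
  obtain ⟨ψ, hψ⟩ := hP.exists_isBraiding hQ hX hY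
  obtain ⟨ψ', hψ'⟩ := hQ.exists_isBraiding hP hY hX
  obtain ⟨R, hR⟩ := HopfTensor.exists_isTensor hPY.isHopfBimodule hPX.isHopfBimodule
  obtain ⟨τ, hτ, hτ'⟩ := HopfTensor.exists_isMiddle (XY := Q) (X'Y' := Q) (XX' := PY) (YY' := PX)
    hY hX hY hX hQ hQ hPY hPX hQ hPZ hR hψ
  obtain ⟨σ, hσ, hσ'⟩ := HopfTensor.exists_isMiddle (XY := PY) (X'Y' := PX) (XX' := Q) (YY' := Q)
    hY hY hX hX hPY hPX hQ hQ hP hR hPZ hψ'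
  obtain ⟨mm, hmm⟩ := hR.exists_tensorHom hQ hbY.mul_hom hbX.mul_hom
  obtain ⟨dd, hdd⟩ := hQ.exists_tensorHom hR hbY.comul_hom hbX.comul_hom
  have := hPZ.epi_lam
  have := hPZ.mono_rho
  have := hQ.epi_lam
  have := hQ.mono_rho
  refine ⟨⟨P, ψ, ψ', R, τ, mm, dd, σ, hP, hψ, hψ', hR, hτ, hmm, ?_, hdd, hσ, ?_⟩, one, counit⟩
  · have h := hR.rho_tensorHom hQ hbY.mul_hom hbX.mul_hom hmm
    rw [← cancel_epi PZ.lam, ← cancel_mono Q.rho]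
    refine mul.trans ?_
    rw [Category.assoc, Category.assoc, h, reassoc_of% hτ', HopfTensor.interchange, Category.assoc,
      Category.assoc, tensorHom_comp_tensorHom]
    rfl
  · rw [HopfTensor.IsTensorHom] at hdd
    rw [← cancel_epi Q.lam, ← cancel_mono PZ.rho]
    rw [Category.assoc, Category.assoc, Category.assoc]
    refine comul.trans ?_
    rw [reassoc_of% hdd, hσ', HopfTensor.interchange, tensorHom_comp_tensorHom_assoc]
    rfl

end HopfBialgData

section Double

variable {H : 𝒞} [HopfObj H] {B C : 𝒞} [MonObj B] [ComonObj B] [MonObj C] [ComonObj C]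
variable {M : RightCrossedModule H B} {N : LeftCrossedModule H C}

open Dbl

/-- The model in which both pairings are the trivial one; it serves for equations in which pairings
do not occur. -/
@[reducible] def Dbl.trivialModel (M : RightCrossedModule H B) (N : LeftCrossedModule H C)
    (t : H ⟶ H) : Model DblOp 𝒞 :=
  model M N ((ε[B] ⊗ₘ ε[C]) ≫ (λ_ (𝟙_ 𝒞)).hom) ((ε[B] ⊗ₘ ε[C]) ≫ (λ_ (𝟙_ 𝒞)).hom) t

/-- Equations without pairings and without the inverse of the antipode that can be derived from
those of `B` and `C` hold. -/
theorem trivialModel_holds (hB : M.IsBialgebra) (hC : N.IsBialgebra) (r : Rule DblOp)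
    (s s' : Script DblAx DblOp) (h : r.check ax crossedAx s s' = true) :
    (trivialModel M N (𝟙 H)).Holds r :=
  holds_of_check hB hC s s' h

/-! ### The biproducts as bialgebras over `H` -/

/-- `H ⋉ B` is a bialgebra with a projection to `H`. -/
theorem biproduct_isBialgebraOver (hB : M.IsBialgebra) (hC : N.IsBialgebra) :
    IsBialgebraOver M.hopfBimodule M.biproduct ((ρ_ H).inv ≫ H ◁ η[B])
      (H ◁ ε[B] ≫ (ρ_ H).hom) where
  isBialgebra := biproduct_isBialgebra hB hC
  incl_hom := by
    have h k s t hc := trivialModel_holds hB hC (bialgHom bialgH biproductB inclB k) s t hc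
    exact ⟨⟨h .mul
        []
        [(.natL .oneB 0, 0, 1), (.ax .mulOneB, 0, 1), (.ax .oneActB, 1, 2),
          (.ax .comulCounitH, 0, 1)] (by decide +kernel), h .one
        []
        [] (by decide +kernel)⟩, h .comul
        [(.ax .oneComulB, 0, 1), (.ax .oneCoactB, 0, 1), (.natR 0 .oneB, 0, 0),
          (.ax .mulOneH, 0, 0)]
        [] (by decide +kernel), h .counit
        [(.ax .oneCounitB, 0, 1)]
        [] (by decide +kernel)⟩
  proj_hom := by
    have h k s t hc := trivialModel_holds hB hC (bialgHom biproductB bialgH projB k) s t hc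
    exact ⟨⟨h .mul
        [(.ax .mulCounitB, 4, 1), (.ax .actCounitB, 3, 1), (.ax .comulCounitH, 0, 2)]
        [] (by decide +kernel), h .one
        [(.ax .oneCounitB, 1, 1)]
        [] (by decide +kernel)⟩, h .comul
        []
        [(.ax .comulCounitB, 0, 1), (.ax .coactComulCounitB, 1, 2), (.ax .mulOneH, 2, 1)]
        (by decide +kernel), h .counit
        []
        [] (by decide +kernel)⟩
  incl_proj := trivialModel_holds hB hC ⟨_, _, inclB ≫ᵗ projB, .id Dbl.H⟩
    [(.ax .oneCounitB, 0, 1)]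
    [] (by decide +kernel)
  actL := trivialModel_holds hB hC ⟨_, _, bimodB.actL, inclB ▷ᵗ bimodB.pt ≫ᵗ biproductB.mul⟩
    []
    [(.natL .oneB 0, 0, 1), (.ax .oneActB, 1, 2), (.ax .comulCounitH, 0, 1),
      (.ax .oneMulB, 0, 2)] (by decide +kernel)
  actR := trivialModel_holds hB hC ⟨_, _, bimodB.actR, bimodB.pt ◁ᵗ inclB ≫ᵗ biproductB.mul⟩
    []
    [(.ax .mulOneB, 0, 2)] (by decide +kernel)
  coactL := trivialModel_holds hB hC ⟨_, _, bimodB.coactL, biproductB.comul ≫ᵗ projB ▷ᵗ bimodB.pt⟩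
    []
    [(.ax .coactComulCounitB, 2, 2), (.ax .mulOneH, 3, 1), (.ax .counitComulB, 0, 1)]
    (by decide +kernel)
  coactR := trivialModel_holds hB hC ⟨_, _, bimodB.coactR, biproductB.comul ≫ᵗ bimodB.pt ◁ᵗ projB⟩
    []
    [(.ax .comulCounitB, 0, 1)] (by decide +kernel)

/-- `C ⋊ H` is a bialgebra with a projection to `H`. -/
theorem biproduct_isBialgebraOver' (hB : M.IsBialgebra) (hC : N.IsBialgebra) :
    IsBialgebraOver N.hopfBimodule N.biproduct ((λ_ H).inv ≫ η[C] ▷ H)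
      (ε[C] ▷ H ≫ (λ_ H).hom) where
  isBialgebra := biproductC_isBialgebra hB hC ((ε[B] ⊗ₘ ε[C]) ≫ (λ_ (𝟙_ 𝒞)).hom)
    ((ε[B] ⊗ₘ ε[C]) ≫ (λ_ (𝟙_ 𝒞)).hom) (𝟙 H)
  incl_hom := by
    have h k s t hc := trivialModel_holds hB hC (bialgHom bialgH biproductC inclC k) s t hc
    exact ⟨⟨h .mul
        []
        [(.natR 0 .oneC, 1, 1), (.ax .oneMulC, 0, 0), (.ax .oneActC, 1, 0),
          (.ax .counitComulH, 0, 0)]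
          (by decide +kernel),
          (Model.holds_symm _ _).1 (trivialModel_holds hB hC
        (bialgHom bialgH biproductC inclC .one).symm
        []
        [] (by decide +kernel))⟩, h .comul
        [(.ax .oneComulC, 0, 0), (.ax .oneCoactC, 1, 1), (.natL .oneC 0, 2, 2),
          (.ax .oneMulH, 1, 1)]
        [] (by decide +kernel), h .counit
        [(.ax .oneCounitC, 0, 0)]
        [] (by decide +kernel)⟩
  proj_hom := by
    have h k s t hc := trivialModel_holds hB hC (bialgHom biproductC bialgH projC k) s t hc
    exact ⟨⟨h .mul
        [(.ax .mulCounitC, 4, 0), (.ax .actCounitC, 2, 1), (.ax .counitComulH, 0, 1)]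
        [] (by decide +kernel), h .one
        [(.ax .oneCounitC, 0, 0)]
        [] (by decide +kernel)⟩, h .comul
        []
        [(.ax .counitComulC, 0, 0), (.ax .coactComulCounitC, 0, 0), (.ax .oneMulH, 1, 0)]
        (by decide +kernel), h .counit
        []
        [] (by decide +kernel)⟩
  incl_proj := trivialModel_holds hB hC ⟨_, _, inclC ≫ᵗ projC, .id Dbl.H⟩
    [(.ax .oneCounitC, 0, 0)]
    [] (by decide +kernel)
  actL := trivialModel_holds hB hC ⟨_, _, bimodC.actL, inclC ▷ᵗ bimodC.pt ≫ᵗ biproductC.mul⟩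
    []
    [(.ax .oneMulC, 0, 0)] (by decide +kernel)
  actR := trivialModel_holds hB hC ⟨_, _, bimodC.actR, bimodC.pt ◁ᵗ inclC ≫ᵗ biproductC.mul⟩
    []
    [(.natR 0 .oneC, 0, 1), (.ax .oneActC, 1, 1), (.ax .counitComulH, 0, 1),
      (.ax .mulOneC, 0, 0)] (by decide +kernel)
  coactL := trivialModel_holds hB hC ⟨_, _, bimodC.coactL, biproductC.comul ≫ᵗ projC ▷ᵗ bimodC.pt⟩
    []
    [(.ax .counitComulC, 0, 0)] (by decide +kernel)
  coactR := trivialModel_holds hB hC ⟨_, _, bimodC.coactR, biproductC.comul ≫ᵗ bimodC.pt ◁ᵗ projC⟩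
    []
    [(.ax .coactComulCounitC, 1, 1), (.ax .oneMulH, 2, 1), (.ax .comulCounitC, 0, 0)]
    (by decide +kernel)

/-! ### The tensor product of the biproducts -/

theorem secZ_lamZ (hB : M.IsBialgebra) (hC : N.IsBialgebra) (t : H ⟶ H) :
    (trivialModel M N t).den secZ ≫ (doubleTensor M N).lam = 𝟙 _ :=
  holds_of_check hB hC (r := ⟨_, _, secZ ≫ᵗ lamZ, .id _⟩)
    [(.ax .oneMulH, 0, 1)]
    [] (by decide +kernel)

theorem rhoZ_retZ (hB : M.IsBialgebra) (hC : N.IsBialgebra) (t : H ⟶ H) :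
    (doubleTensor M N).rho ≫ (trivialModel M N t).den retZ = 𝟙 _ :=
  holds_of_check hB hC (r := ⟨_, _, rhoZ ≫ᵗ retZ, .id _⟩)
    [(.ax .counitComulH, 0, 1)]
    [] (by decide +kernel)

/-- The tensor product `Y ⊗_H X` is realized on `C ⊗ H ⊗ B`. This needs no condition on `B` and `C`,
and `secZ` splits the idempotent `split`. -/
theorem doubleTensor_isTensor (hB : M.IsBialgebra) (hC : N.IsBialgebra) :
    (doubleTensor M N).IsTensor := by
  have h k s t hc := trivialModel_holds hB hC (hom (.odot mH bimodC bimodB) bimodZ lamZ k) s t hc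
  refine HopfTensor.isTensor_of_section (biproduct_isBialgebraOver' hB hC).isHopfBimodule
    (biproduct_isBialgebraOver hB hC).isHopfBimodule _ (secZ_lamZ hB hC (𝟙 H)) ?_
    ⟨?_, ?_, ?_, ?_⟩ ?_
  · exact trivialModel_holds hB hC ⟨_, _, lamZ ≫ᵗ secZ, Bimod.split sH bimodC bimodB⟩
      []
      [(.ax .coassocH, 0, 1), (.inv .coassocH, 0, 1), (.ax .antiRight, 1, 1),
        (.ax .counitComulH, 0, 1)] (by decide +kernel)
  · exact h .actL
      [(.ax .assocH, 3, 1)]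
      [] (by decide +kernel)
  · exact h .actR
      []
      [(.ax .assocH, 0, 1)] (by decide +kernel)
  · exact h .coactL
      [(.ax .mulComulH, 0, 1)]
      [(.ax .assocH, 3, 0)] (by decide +kernel)
  · exact h .coactR
      [(.ax .mulComulH, 0, 1), (.natL .mulH 1, 4, 2), (.ax .assocH, 7, 3)]
      [] (by decide +kernel)
  · exact trivialModel_holds hB hC ⟨_, _, lamZ ≫ᵗ rhoZ, bimodC.exchange bimodB⟩
      [(.ax .mulComulH, 0, 1)]
      [] (by decide +kernel)

/-- `C ⊗ H ⊗ B` is a bialgebra with a projection to `H`, which induces the Hopf bimodule structure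
of `Y ⊗_H X`. -/
theorem double_isBialgebraOver (hB : M.IsBialgebra) (hC : N.IsBialgebra)
    (hM : (trivialModel M N (𝟙 H)).Holds (ax .commute)) :
    IsBialgebraOver (doubleTensor M N).obj (doubleBialgData M N)
      (((λ_ H).inv ≫ η[C] ▷ H) ≫ C ◁ ((ρ_ H).inv ≫ H ◁ η[B]))
      (C ◁ (H ◁ ε[B] ≫ (ρ_ H).hom) ≫ ε[C] ▷ H ≫ (λ_ H).hom) where
  isBialgebra := double_isBialgebra hB hC _ _ _ hM
  incl_hom := by
    have h k s t hc := trivialModel_holds hB hC (bialgHom bialgH double inclZ k) s t hc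
    have h' k s t hc := (Model.holds_symm _ _).1
      (trivialModel_holds hB hC (bialgHom bialgH double inclZ k).symm s t hc)
    exact ⟨⟨h .mul
        []
        [(.natL .oneB 2, 1, 2), (.natL .oneB 0, 5, 4), (.natR 0 .oneC, 1, 1), (.ax .mulOneB, 1, 2),
          (.ax .oneActB, 3, 4), (.ax .comulCounitH, 1, 2), (.ax .oneMulC, 0, 0),
          (.ax .oneActC, 2, 0), (.ax .counitComulH, 0, 0)] (by decide +kernel), h' .one
        []
        [] (by decide +kernel)⟩, h' .comul
        []
        [(.ax .oneComulB, 1, 2), (.ax .oneCoactB, 1, 2), (.natR 0 .oneB, 1, 1),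
          (.natR 2 .oneB, 8, 2), (.ax .mulOneH, 1, 1), (.ax .oneComulC, 0, 0),
          (.ax .oneCoactC, 1, 1), (.natL .oneC 0, 2, 2), (.ax .oneMulH, 1, 1)]
          (by decide +kernel), h .counit
        [(.ax .oneCounitB, 1, 2), (.ax .oneCounitC, 0, 0)]
        [] (by decide +kernel)⟩
  proj_hom := by
    have h k s t hc := trivialModel_holds hB hC (bialgHom double bialgH projZ k) s t hc
    exact ⟨⟨h .mul
        [(.ax .mulCounitB, 9, 2), (.ax .actCounitB, 7, 3), (.ax .comulCounitH, 0, 4),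
          (.ax .mulCounitC, 7, 0), (.ax .actCounitC, 4, 1), (.ax .counitComulH, 0, 1)]
        [] (by decide +kernel), h .one
        [(.ax .oneCounitB, 2, 2), (.ax .oneCounitC, 0, 0)]
        [] (by decide +kernel)⟩, h .comul
        []
        [(.natR 2 .mulH, 7, 0), (.ax .comulCounitB, 1, 3), (.natR 2 .mulH, 10, 3),
          (.ax .coactComulCounitB, 3, 5), (.natR 2 .mulH, 11, 1), (.natR 2 .oneH, 4, 4),
          (.natR 2 .oneH, 10, 2), (.ax .mulOneH, 10, 1), (.ax .counitComulC, 0, 0),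
          (.ax .coactComulCounitC, 0, 0), (.ax .oneMulH, 1, 0)] (by decide +kernel), h .counit
        []
        [] (by decide +kernel)⟩
  incl_proj := trivialModel_holds hB hC ⟨_, _, inclZ ≫ᵗ projZ, .id Dbl.H⟩
    [(.ax .oneCounitB, 1, 2), (.ax .oneCounitC, 0, 0)]
    [] (by decide +kernel)
  actL := trivialModel_holds hB hC ⟨_, _, bimodZ.actL, inclZ ▷ᵗ bimodZ.pt ≫ᵗ double.mul⟩
    []
    [(.natL .oneB 2, 1, 2), (.natL .oneB 0, 1, 3), (.ax .oneActB, 6, 3),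
      (.ax .comulCounitH, 1, 3), (.ax .oneMulB, 5, 3), (.ax .oneMulC, 0, 0)] (by decide +kernel)
  actR := trivialModel_holds hB hC ⟨_, _, bimodZ.actR, bimodZ.pt ◁ᵗ inclZ ≫ᵗ double.mul⟩
    []
    [(.natR 1 .oneC, 0, 2), (.natR 0 .oneC, 0, 1), (.ax .mulOneB, 0, 3), (.ax .oneActC, 4, 1),
      (.ax .counitComulH, 0, 1), (.ax .mulOneC, 3, 0)] (by decide +kernel)
  coactL := trivialModel_holds hB hC ⟨_, _, bimodZ.coactL, double.comul ≫ᵗ projZ ▷ᵗ bimodZ.pt⟩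
    []
    [(.ax .coactComulCounitB, 4, 5), (.ax .mulOneH, 5, 4), (.ax .counitComulB, 1, 3),
      (.ax .counitComulC, 0, 0)] (by decide +kernel)
  coactR := trivialModel_holds hB hC ⟨_, _, bimodZ.coactR, double.comul ≫ᵗ bimodZ.pt ◁ᵗ projZ⟩
    []
    [(.ax .comulCounitB, 1, 3), (.ax .coactComulCounitC, 1, 1), (.ax .oneMulH, 2, 1),
      (.ax .comulCounitC, 0, 0)] (by decide +kernel)

/-- On the cotensor product, the multiplication of `C ⊗ H ⊗ B` is the componentwise one. -/
theorem doubleBialgData_mul_rho (hB : M.IsBialgebra) (hC : N.IsBialgebra) :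
    (doubleBialgData M N).mul ≫ (doubleTensor M N).rho
      = ((doubleTensor M N).rho ⊗ₘ (doubleTensor M N).rho) ≫
        tensorμ (C ⊗ H) (H ⊗ B) (C ⊗ H) (H ⊗ B) ≫ (N.biproduct.mul ⊗ₘ M.biproduct.mul) :=
  trivialModel_holds hB hC ⟨_, _, double.mul ≫ᵗ rhoZ,
      (rhoZ ⊗ᵗ rhoZ) ≫ᵗ .tensorμ _ _ _ _ ≫ᵗ (biproductC.mul ⊗ᵗ biproductB.mul)⟩
    [(.ax .mulComulH, 6, 2), (.ax .coassocH, 0, 4)]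
    [(.ax .coassocH, 0, 1)] (by decide +kernel)

/-- On the tensor product, the comultiplication of `C ⊗ H ⊗ B` is the componentwise one. -/
theorem doubleBialgData_lam_comul (hB : M.IsBialgebra) (hC : N.IsBialgebra) :
    (doubleTensor M N).lam ≫ (doubleBialgData M N).comul
      = (N.biproduct.comul ⊗ₘ M.biproduct.comul) ≫
        tensorμ (C ⊗ H) (C ⊗ H) (H ⊗ B) (H ⊗ B) ≫
        ((doubleTensor M N).lam ⊗ₘ (doubleTensor M N).lam) :=
  trivialModel_holds hB hC ⟨_, _, lamZ ≫ᵗ double.comul,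
      (biproductC.comul ⊗ᵗ biproductB.comul) ≫ᵗ .tensorμ _ _ _ _ ≫ᵗ (lamZ ⊗ᵗ lamZ)⟩
    [(.ax .mulComulH, 0, 1), (.natL .mulH 1, 4, 2), (.natR 2 .mulH, 3, 0), (.ax .assocH, 9, 6)]
    [(.ax .assocH, 4, 1)] (by decide +kernel)

/-- `X`, `Y` and `C ⊗ H ⊗ B` are bialgebras in the category of Hopf bimodules, and the last is the
tensor product of the others. -/
theorem exists_isTensorProduct [IsIdempotentComplete 𝒞] (hB : M.IsBialgebra) (hC : N.IsBialgebra)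
    (hM : (trivialModel M N (𝟙 H)).Holds (ax .commute)) :
    ∃ (PX : HopfTensor M.hopfBimodule M.hopfBimodule)
      (PY : HopfTensor N.hopfBimodule N.hopfBimodule)
      (PZ : HopfTensor (doubleTensor M N).obj (doubleTensor M N).obj)
      (bX : HopfBialgData PX) (bY : HopfBialgData PY) (bZ : HopfBialgData PZ),
      PX.IsTensor ∧ PY.IsTensor ∧ PZ.IsTensor ∧
      bX.IsBialgebra ∧ bY.IsBialgebra ∧ bZ.IsBialgebra ∧
      bX.toBialgData = M.biproduct ∧ bX.one = (ρ_ H).inv ≫ H ◁ η[B] ∧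
      bX.counit = H ◁ ε[B] ≫ (ρ_ H).hom ∧
      bY.toBialgData = N.biproduct ∧ bY.one = (λ_ H).inv ≫ η[C] ▷ H ∧
      bY.counit = ε[C] ▷ H ≫ (λ_ H).hom ∧
      bY.IsTensorProduct bX bZ ∧ bZ.toBialgData = doubleBialgData M N := by
  have oX := biproduct_isBialgebraOver hB hC
  have oY := biproduct_isBialgebraOver' hB hC
  have oZ := double_isBialgebraOver hB hC hM
  obtain ⟨PX, hPX⟩ := HopfTensor.exists_isTensor oX.isHopfBimodule oX.isHopfBimodule
  obtain ⟨PY, hPY⟩ := HopfTensor.exists_isTensor oY.isHopfBimodule oY.isHopfBimodule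
  obtain ⟨PZ, hPZ⟩ := HopfTensor.exists_isTensor oZ.isHopfBimodule oZ.isHopfBimodule
  obtain ⟨bX, hbX, hX, hX₁, hX₂⟩ := oX.exists_isBialgebra hPX
  obtain ⟨bY, hbY, hY, hY₁, hY₂⟩ := oY.exists_isBialgebra hPY
  obtain ⟨bZ, hbZ, hZ, hZ₁, hZ₂⟩ := oZ.exists_isBialgebra hPZ
  refine ⟨PX, PY, PZ, bX, bY, bZ, hPX, hPY, hPZ, hbX, hbY, hbZ, hX, hX₁, hX₂, hY, hY₁, hY₂, ?_,
    hZ⟩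
  refine HopfBialgData.isTensorProduct oX.isHopfBimodule oY.isHopfBimodule hPX hPY
    (doubleTensor_isTensor hB hC) hPZ hbY hbX ?_ ?_ ?_ ?_
  · rw [hX, hY, hZ]
    exact doubleBialgData_mul_rho hB hC
  · rw [hX, hY, hZ]
    exact doubleBialgData_lam_comul hB hC
  · rw [hX₁, hY₁, hZ₁]
    exact trivialModel_holds hB hC ⟨_, _, mH ≫ᵗ inclZ, (inclC ⊗ᵗ inclB) ≫ᵗ lamZ⟩
      []
      [] (by decide +kernel)
  · rw [hX₂, hY₂, hZ₂]
    exact trivialModel_holds hB hC ⟨_, _, projZ ≫ᵗ dH, rhoZ ≫ᵗ (projC ⊗ᵗ projB)⟩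
      []
      [] (by decide +kernel)

end Double

/-! ### The inverse of the antipode -/

section Antipode

variable (H : 𝒞) [HopfObj H] [IsIso 𝒮[H]]

/-- The inverse of the antipode is an antipode for the opposite comultiplication. -/
lemma inv_antipode_left :
    Δ[H] ≫ (β_ H H).inv ≫ H ◁ inv 𝒮[H] ≫ μ[H] = ε[H] ≫ η[H] := by
  rw [← cancel_mono 𝒮[H]]
  simp only [Category.assoc, HopfObj.mul_antipode, HopfObj.one_antipode]
  rw [MonoidalCategory.tensorHom_def', ← Category.assoc (H ◁ inv 𝒮[H]), ← whiskerLeft_comp_assoc,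
    IsIso.inv_hom_id, whiskerLeft_id, Category.id_comp,
    BraidedCategory.braiding_naturality_left_assoc, Iso.inv_hom_id_assoc,
    HopfObj.antipode_right]

lemma inv_antipode_right :
    Δ[H] ≫ (β_ H H).inv ≫ inv 𝒮[H] ▷ H ≫ μ[H] = ε[H] ≫ η[H] := by
  rw [← cancel_mono 𝒮[H]]
  simp only [Category.assoc, HopfObj.mul_antipode, HopfObj.one_antipode]
  rw [MonoidalCategory.tensorHom_def, ← Category.assoc (inv 𝒮[H] ▷ H), ← comp_whiskerRight_assoc,
    IsIso.inv_hom_id, id_whiskerRight, Category.id_comp,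
    BraidedCategory.braiding_naturality_right_assoc, Iso.inv_hom_id_assoc,
    HopfObj.antipode_left]

lemma mul_inv_antipode :
    μ[H] ≫ inv 𝒮[H] = (inv 𝒮[H] ⊗ₘ inv 𝒮[H]) ≫ (β_ H H).inv ≫ μ[H] := by
  rw [← cancel_mono 𝒮[H]]
  simp only [Category.assoc, HopfObj.mul_antipode, IsIso.inv_hom_id, Category.comp_id]
  rw [← BraidedCategory.braiding_inv_naturality_assoc, Iso.inv_hom_id_assoc,
    tensorHom_comp_tensorHom_assoc, IsIso.inv_hom_id]
  simp

end Antipode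

section Double

variable {H : 𝒞} [HopfObj H] {B C : 𝒞} [MonObj B] [ComonObj B] [MonObj C] [ComonObj C]
variable {M : RightCrossedModule H B} {N : LeftCrossedModule H C}

open Dbl

/-- The equations of the inverse of the antipode. -/
def antipodeAx : DblAx → Bool
  | .antiInvLeft | .antiInvRight | .mulAntiInv => true
  | _ => false

/-- The version of `trivialModel_holds` with the inverse of the antipode. -/
theorem trivialModel_holds_antipode [IsIso 𝒮[H]] (hB : M.IsBialgebra) (hC : N.IsBialgebra)
    (r : Rule DblOp) (s s' : Script DblAx DblOp)
    (h : r.check ax (fun k => crossedAx k || antipodeAx k) s s' = true) :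
    (trivialModel M N (inv 𝒮[H])).Holds r :=
  holds_of_check_extra hB hC (extra := antipodeAx) (fun k hk => by
    cases k
    case antiInvLeft => exact inv_antipode_left H
    case antiInvRight => exact inv_antipode_right H
    case mulAntiInv => exact mul_inv_antipode H
    all_goals cases hk) s s' h

/-! ### The braiding of the biproducts -/

/-- A morphism `f` that coequalizes `a` and `b` absorbs `m ≫ a`, when `m` is a section of `b`. -/
lemma comp_eq_of_coequalizes {U V W Z Z' : 𝒞} {m : U ⟶ W} {a b : W ⟶ U} {f : U ⟶ V} {θ : U ⟶ Z'}
    {r : Z' ⟶ Z} {s : Z ⟶ U} (h : m ≫ a = θ ≫ r ≫ s) (h' : m ≫ b = 𝟙 U) {b' : W ⟶ V}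
    (hf : a ≫ f = b') (hb : b ≫ f = b') : θ ≫ r ≫ s ≫ f = f := by
  rw [← Category.assoc r, ← Category.assoc θ, ← h, Category.assoc, hf, ← hb, ← Category.assoc, h',
    Category.id_comp]

/-- Here `ψ` and `ψ'` are morphisms between quotients `lam`, `lam'` which are induced by `θ` and
`θ'`, and `g` induces a left inverse of `ψ`. If `ψ'` is a right inverse of `ψ`, then it is induced
by `g`, and `θ` and `θ'` compose to `lam ≫ rho`. -/
lemma comp_eq_of_inverse {U U' P Z : 𝒞} {lam : U ⟶ P} {rho : P ⟶ U} {ψ : P ⟶ Z} {ψ' : Z ⟶ P}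
    {lam' : U' ⟶ Z} {rho' : Z ⟶ U'} {θ : U ⟶ U'} {θ' : U' ⟶ U} {r : U' ⟶ Z} {s : Z ⟶ U'}
    {g : Z ⟶ U} [Epi lam] (hψ : lam ≫ ψ ≫ rho' = θ) (hψ' : lam' ≫ ψ' ≫ rho = θ')
    (hr : rho' ≫ r = 𝟙 Z) (hs : s ≫ lam' = 𝟙 Z) (h : ψ' ≫ ψ = 𝟙 Z) (hg : θ ≫ r ≫ g ≫ lam = lam) :
    θ ≫ r ≫ s ≫ θ' = lam ≫ rho := by
  have h₁ : θ ≫ r = lam ≫ ψ := by rw [← hψ, Category.assoc, Category.assoc, hr, Category.comp_id]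
  have h₂ : ψ ≫ g ≫ lam = 𝟙 P := by
    rw [← cancel_epi lam, ← Category.assoc, ← h₁, Category.assoc, hg, Category.comp_id]
  have h₃ : ψ' = g ≫ lam := by rw [← Category.comp_id ψ', ← h₂, reassoc_of% h]
  rw [← Category.assoc, h₁, ← hψ', Category.assoc, reassoc_of% hs, h₃, ← Category.assoc ψ, h₂,
    Category.id_comp]

/-- The morphism `secBraid` induces a left inverse of the braiding `X ⊗_H Y ⟶ Y ⊗_H X`, without any
assumption on the braidings: a morphism `f` that is balanced over `H` absorbs the composite of the
two, since the middle factor of `midBraid` may act on either side. -/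
theorem theta_retZ_secBraid [IsIso 𝒮[H]] (hB : M.IsBialgebra) (hC : N.IsBialgebra) {V : 𝒞}
    {f : (H ⊗ B) ⊗ (C ⊗ H) ⟶ V} (hf : M.hopfBimodule.IsBalanced N.hopfBimodule f) :
    M.hopfBimodule.theta N.hopfBimodule ≫ (trivialModel M N (inv 𝒮[H])).den retZ ≫
      (trivialModel M N (inv 𝒮[H])).den secBraid ≫ f = f := by
  let S := trivialModel M N (inv 𝒮[H])
  have h₁ : S.den midBraid ≫ M.hopfBimodule.actR ▷ (C ⊗ H)
      = M.hopfBimodule.theta N.hopfBimodule ≫ S.den retZ ≫ S.den secBraid :=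
    trivialModel_holds_antipode hB hC ⟨_, _, midBraid ≫ᵗ bimodB.actR ▷ᵗ (Dbl.C ⊗ᵒ Dbl.H),
        bimodB.theta bimodC ≫ᵗ retZ ≫ᵗ secBraid⟩
      [(.negL .actC 0, 3, 2), (.inv .coassocH, 0, 3)]
      [(.cancel true 0 2, 7, 1), (.cancel true 0 0, 5, 2), (.cancel true 0 2, 4, 1),
        (.cancel true 1 2, 2, 2), (.cancel true 1 0, 3, 2), (.ax .mulCounitH, 11, 2),
        (.ax .counitComulH, 0, 3), (.ax .comulCounitH, 1, 0), (.ax .mulComulH, 7, 0),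
        (.cancel true 0 0, 9, 1), (.ax .mulAntiInv, 10, 1), (.negL .antiInvH 0, 10, 1),
        (.negL .antiInvH 0, 11, 2), (.negL .antiInvH 0, 13, 1), (.negL .antiInvH 1, 12, 3),
        (.negL .antiInvH 0, 13, 4), (.negL .antiInvH 1, 14, 2), (.negL .actC 0, 3, 2),
        (.ax .actAssocC, 5, 2), (.ax .assocH, 21, 3), (.negRInv 0 .comulH, 1, 0),
        (.negRInv 0 .comulH, 6, 3), (.negRInv 0 .comulH, 7, 3), (.cancel true 1 0, 11, 2),
        (.inv .coassocH, 0, 0), (.ax .antiInvRight, 1, 0), (.ax .counitComulH, 0, 0),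
        (.negL .oneH 0, 0, 0), (.negL .oneH 1, 0, 1), (.negL .oneH 0, 0, 2),
        (.negL .oneH 0, 4, 4), (.ax .mulOneH, 4, 4), (.negRInv 2 .comulH, 0, 2)] (by decide +kernel)
  have h₂ : S.den midBraid ≫ (α_ (H ⊗ B) H (C ⊗ H)).hom ≫ (H ⊗ B) ◁ N.hopfBimodule.actL = 𝟙 _ :=
    trivialModel_holds_antipode hB hC ⟨_, _, midBraid ≫ᵗ .assoc _ _ _ ≫ᵗ
        (Dbl.H ⊗ᵒ Dbl.B) ◁ᵗ bimodC.actL, .id _⟩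
      [(.negR 2 .comulH, 0, 2), (.negL .antiInvH 0, 2, 2), (.natR 0 .antiInvH, 3, 2),
        (.ax .mulOneH, 3, 4), (.ax .actAssocC, 7, 2), (.negRInv 0 .comulH, 2, 2),
        (.cancel false 0 0, 4, 3), (.inv .coassocH, 1, 2), (.ax .antiInvLeft, 2, 2),
        (.cancel false 0 2, 0, 2), (.ax .counitComulH, 0, 3), (.ax .actOneC, 0, 2)]
      [] (by decide +kernel)
  exact comp_eq_of_coequalizes h₁ h₂ hf (Category.assoc _ _ _)

/-- If the braidings of `X` and `Y` are inverse to each other then the exchange of `X` and `Y` is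
the composite of `Θ` for `X`, `Y` and `Θ` for `Y`, `X`, over the realization of `Y ⊗_H X`. -/
theorem exchange_eq_of_braidingInvolutive [IsIdempotentComplete 𝒞] [IsIso 𝒮[H]]
    (hB : M.IsBialgebra) (hC : N.IsBialgebra)
    (hinv : BraidingInvolutive M.hopfBimodule N.hopfBimodule) :
    (trivialModel M N (𝟙 H)).Holds ⟨_, _,
      bimodB.theta bimodC ≫ᵗ retZ ≫ᵗ secZ ≫ᵗ bimodC.theta bimodB,
      bimodB.exchange bimodC⟩ := by
  have hX := (biproduct_isBialgebraOver hB hC).isHopfBimodule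
  have hY := (biproduct_isBialgebraOver' hB hC).isHopfBimodule
  have hQ := doubleTensor_isTensor hB hC
  obtain ⟨P, hP⟩ := HopfTensor.exists_isTensor hX hY
  obtain ⟨ψ, hψ⟩ := hP.exists_isBraiding hQ hX hY
  obtain ⟨ψ', hψ'⟩ := hQ.exists_isBraiding hP hY hX
  have := hP.epi_lam
  exact (comp_eq_of_inverse hψ hψ' (rhoZ_retZ hB hC (𝟙 H)) (secZ_lamZ hB hC (𝟙 H))
    (hinv P _ ψ ψ' hP hQ hψ hψ') (theta_retZ_secBraid hB hC hP.balanced)).trans hP.lam_rho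

/-- If the braidings of `X` and `Y` are inverse to each other then the double braiding of `B` and
`C` is given by the coactions and actions of `H`. This is the restriction of
`exchange_eq_of_braidingInvolutive` to `(1 ⊗ b) ⊗ (c ⊗ 1)`. -/
theorem commute_of_braidingInvolutive [IsIdempotentComplete 𝒞] [IsIso 𝒮[H]]
    (hB : M.IsBialgebra) (hC : N.IsBialgebra)
    (hinv : BraidingInvolutive M.hopfBimodule N.hopfBimodule) :
    (trivialModel M N (𝟙 H)).Holds (ax .commute) := by
  let S := trivialModel M N (𝟙 H)
  have h : S.den (bimodB.theta bimodC ≫ᵗ retZ ≫ᵗ secZ ≫ᵗ bimodC.theta bimodB)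
      = S.den (bimodB.exchange bimodC) := exchange_eq_of_braidingInvolutive hB hC hinv
  have h₁ : S.den unitBC ≫ S.den (bimodB.exchange bimodC) ≫ S.den counitBC
      = S.den (ax .commute).lhs :=
    trivialModel_holds hB hC ⟨_, _, unitBC ≫ᵗ bimodB.exchange bimodC ≫ᵗ counitBC,
        (ax .commute).lhs⟩
      [(.ax .oneComulH, 0, 0), (.ax .oneMulH, 0, 0), (.ax .counitComulH, 10, 1),
        (.ax .oneComulH, 0, 2), (.ax .mulOneH, 1, 2), (.ax .comulCounitH, 10, 1),
        (.natL .oneH 1, 1, 0), (.ax .oneMulH, 4, 1), (.natR 2 .oneH, 0, 1), (.ax .mulOneH, 2, 2)]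
      [] (by decide +kernel)
  have h₂ : S.den unitBC ≫ S.den (bimodB.theta bimodC ≫ᵗ retZ ≫ᵗ secZ ≫ᵗ bimodC.theta bimodB) ≫
      S.den counitBC = S.den (ax .commute).rhs :=
    trivialModel_holds hB hC ⟨_, _, unitBC ≫ᵗ
        (bimodB.theta bimodC ≫ᵗ retZ ≫ᵗ secZ ≫ᵗ bimodC.theta bimodB) ≫ᵗ counitBC,
        (ax .commute).rhs⟩
      [(.ax .oneComulH, 0, 0), (.ax .oneComulH, 0, 0), (.ax .oneComulH, 0, 2),
        (.ax .oneComulH, 1, 3), (.ax .oneComulH, 17, 1), (.ax .mulCounitH, 12, 1),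
        (.ax .mulCounitH, 30, 0), (.ax .counitComulH, 22, 3), (.ax .mulCounitH, 21, 0),
        (.ax .mulCounitH, 28, 2), (.ax .mulCounitH, 25, 3), (.ax .mulCounitH, 15, 1),
        (.ax .oneCounitH, 0, 2), (.ax .oneCounitH, 0, 2), (.ax .oneCounitH, 2, 1),
        (.ax .oneCounitH, 2, 1), (.ax .oneCounitH, 5, 1), (.ax .oneCounitH, 5, 1),
        (.ax .actOneB, 0, 1), (.ax .coactCounitB, 4, 2), (.ax .actOneC, 0, 0),
        (.ax .coactCounitC, 1, 0)]
      [] (by decide +kernel)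
  exact h₁.symm.trans ((congrArg (S.den unitBC ≫ · ≫ S.den counitBC) h).symm.trans h₂)

/-! ### The canonical morphisms -/

theorem biproduct_double_isBialgHom (hB : M.IsBialgebra) (hC : N.IsBialgebra) :
    M.biproduct.IsBialgHom (doubleBialgData M N) ((λ_ (H ⊗ B)).inv ≫ η[C] ▷ (H ⊗ B)) := by
  have h k s t hc := trivialModel_holds hB hC (bialgHom biproductB double
    (.leftInv (Dbl.H ⊗ᵒ Dbl.B) ≫ᵗ eC ▷ᵗ (Dbl.H ⊗ᵒ Dbl.B)) k) s t hc
  exact ⟨⟨h .mul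
    []
    [(.natR 1 .oneC, 1, 2), (.natR 0 .oneC, 1, 1), (.ax .oneMulC, 0, 0), (.ax .oneActC, 5, 0),
      (.ax .counitComulH, 0, 0)]
      (by decide +kernel),
      (Model.holds_symm _ _).1 (trivialModel_holds hB hC
    (bialgHom biproductB double (.leftInv (Dbl.H ⊗ᵒ Dbl.B) ≫ᵗ eC ▷ᵗ (Dbl.H ⊗ᵒ Dbl.B)) .one).symm
    []
    [] (by decide +kernel))⟩, h .comul
    [(.ax .oneComulC, 0, 0), (.ax .oneCoactC, 1, 1), (.natL .oneC 0, 2, 2),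
      (.natL .oneC 1, 7, 3), (.ax .oneMulH, 1, 1)]
    [] (by decide +kernel), h .counit
    [(.ax .oneCounitC, 0, 0)]
    [] (by decide +kernel)⟩

theorem biproduct_double_isBialgHom' (hB : M.IsBialgebra) (hC : N.IsBialgebra) :
    N.biproduct.IsBialgHom (doubleBialgData M N) (C ◁ ((ρ_ H).inv ≫ H ◁ η[B])) := by
  have h k s t hc := trivialModel_holds hB hC (bialgHom biproductC double (Dbl.C ◁ᵗ inclB) k) s t hc
  exact ⟨⟨h .mul
    []
    [(.natL .oneB 2, 0, 2), (.natL .oneB 0, 0, 3), (.ax .mulOneB, 0, 3), (.ax .oneActB, 5, 3),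
      (.ax .comulCounitH, 0, 3)] (by decide +kernel), h .one
    []
    [] (by decide +kernel)⟩, h .comul
    [(.ax .oneComulB, 0, 2), (.ax .oneCoactB, 0, 2), (.natR 0 .oneB, 0, 1),
      (.natR 2 .oneB, 7, 2), (.ax .mulOneH, 0, 1)]
    [] (by decide +kernel), h .counit
    [(.ax .oneCounitB, 0, 2)]
    [] (by decide +kernel)⟩

theorem double_biproduct_isBialgHom (hB : M.IsBialgebra) (hC : N.IsBialgebra) :
    (doubleBialgData M N).IsBialgHom M.biproduct (ε[C] ▷ (H ⊗ B) ≫ (λ_ (H ⊗ B)).hom) := by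
  have h k s t hc := trivialModel_holds hB hC (bialgHom double biproductB
    (cC ▷ᵗ (Dbl.H ⊗ᵒ Dbl.B) ≫ᵗ .left (Dbl.H ⊗ᵒ Dbl.B)) k) s t hc
  exact ⟨⟨h .mul
    [(.ax .mulCounitC, 8, 0), (.ax .actCounitC, 5, 1), (.ax .counitComulH, 0, 1)]
    [] (by decide +kernel), h .one
    [(.ax .oneCounitC, 0, 0)]
    [] (by decide +kernel)⟩, h .comul
    []
    [(.natR 2 .mulH, 7, 0), (.ax .counitComulC, 0, 0), (.ax .coactComulCounitC, 1, 0),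
      (.ax .oneMulH, 2, 0)] (by decide +kernel), h .counit
    []
    [] (by decide +kernel)⟩

theorem double_biproduct_isBialgHom' (hB : M.IsBialgebra) (hC : N.IsBialgebra) :
    (doubleBialgData M N).IsBialgHom N.biproduct (C ◁ (H ◁ ε[B] ≫ (ρ_ H).hom)) := by
  have h k s t hc := trivialModel_holds hB hC (bialgHom double biproductC (Dbl.C ◁ᵗ projB) k) s t hc
  exact ⟨⟨h .mul
    [(.ax .mulCounitB, 9, 2), (.ax .actCounitB, 7, 3), (.ax .comulCounitH, 0, 4)]
    [] (by decide +kernel), h .one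
    [(.ax .oneCounitB, 2, 2)]
    [] (by decide +kernel)⟩, h .comul
    []
    [(.ax .comulCounitB, 1, 3), (.ax .coactComulCounitB, 3, 5), (.ax .mulOneH, 4, 4)]
    (by decide +kernel), h .counit
    []
    [] (by decide +kernel)⟩

theorem tensor_double_isAlgHom (hB : M.IsBialgebra) (hC : N.IsBialgebra) :
    ((BialgData.of C).tensor (BialgData.of B)).IsAlgHom (doubleBialgData M N)
      (C ◁ ((λ_ B).inv ≫ η[H] ▷ B)) := by
  exact ⟨trivialModel_holds hB hC (bialgHom (bialgC.tensor bialgB) double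
      (Dbl.C ◁ᵗ (.leftInv Dbl.B ≫ᵗ eH ▷ᵗ Dbl.B)) .mul)
    []
    [(.ax .oneComulH, 0, 1), (.natL .oneH 2, 1, 2), (.ax .oneMulH, 7, 3),
      (.ax .oneComulH, 0, 3), (.natR 1 .oneH, 0, 2), (.ax .actOneB, 0, 2), (.ax .actOneC, 0, 1)]
      (by decide +kernel),
      (Model.holds_symm _ _).1 (trivialModel_holds hB hC
      (bialgHom (bialgC.tensor bialgB) double (Dbl.C ◁ᵗ (.leftInv Dbl.B ≫ᵗ eH ▷ᵗ Dbl.B)) .one).symm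
    []
    [] (by decide +kernel))⟩

theorem double_tensor_isCoalgHom (hB : M.IsBialgebra) (hC : N.IsBialgebra) :
    (doubleBialgData M N).IsCoalgHom ((BialgData.of C).tensor (BialgData.of B))
      (C ◁ (ε[H] ▷ B ≫ (λ_ B).hom)) := by
  have h k s t hc := trivialModel_holds hB hC (bialgHom double (bialgC.tensor bialgB)
      (Dbl.C ◁ᵗ (cH ▷ᵗ Dbl.B ≫ᵗ .left Dbl.B)) k) s t hc
  exact ⟨h .comul
    []
    [(.natL .mulH 1, 7, 1), (.natL .mulH 1, 8, 5), (.ax .mulCounitH, 10, 6),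
      (.ax .comulCounitH, 3, 3), (.ax .mulCounitH, 7, 1), (.ax .coactCounitB, 3, 4),
      (.ax .coactCounitC, 2, 1)] (by decide +kernel), h .counit
    []
    [] (by decide +kernel)⟩

theorem incl_proj_of_isBialgebra (hC : N.IsBialgebra) :
    ((λ_ (H ⊗ B)).inv ≫ η[C] ▷ (H ⊗ B)) ≫ ε[C] ▷ (H ⊗ B) ≫ (λ_ (H ⊗ B)).hom = 𝟙 _ := by
  rw [Category.assoc, ← comp_whiskerRight_assoc, hC.one_counit, id_whiskerRight, Category.id_comp,
    Iso.inv_hom_id]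

theorem incl_proj_of_isBialgebra' (hB : M.IsBialgebra) :
    (C ◁ ((ρ_ H).inv ≫ H ◁ η[B])) ≫ (C ◁ (H ◁ ε[B] ≫ (ρ_ H).hom)) = 𝟙 _ := by
  rw [← whiskerLeft_comp, Category.assoc, ← whiskerLeft_comp_assoc, hB.one_counit, whiskerLeft_id,
    Category.id_comp, Iso.inv_hom_id, whiskerLeft_id]

variable (H B C) in
theorem incl_proj :
    (C ◁ ((λ_ B).inv ≫ η[H] ▷ B)) ≫ (C ◁ (ε[H] ▷ B ≫ (λ_ B).hom)) = 𝟙 _ := by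
  rw [← whiskerLeft_comp, Category.assoc, ← comp_whiskerRight_assoc, BimonObj.one_counit,
    id_whiskerRight, Category.id_comp, Iso.inv_hom_id, whiskerLeft_id]

lemma mono_of_comp {X Y : 𝒞} {f : X ⟶ Y} {g : Y ⟶ X} (h : f ≫ g = 𝟙 X) : Mono f :=
  (SplitMono.mk g h).mono

lemma epi_of_comp {X Y : 𝒞} {f : X ⟶ Y} {g : Y ⟶ X} (h : f ≫ g = 𝟙 X) : Epi g :=
  (SplitEpi.mk f h).epi

end Double

/-! ### Convolution -/

namespace BialgData

variable {A V : 𝒞} {D : BialgData A}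

lemma convLeft_assoc (h : D.comul ≫ D.comul ▷ A ≫ (α_ A A A).hom = D.comul ≫ A ◁ D.comul)
    (χ ψ : A ⟶ 𝟙_ 𝒞) (f : A ⟶ V) :
    D.convLeft (D.convLeft χ ψ) f = D.convLeft χ (D.convLeft ψ f) := by
  have e₁ : D.convLeft (D.convLeft χ ψ) f
      = (D.comul ≫ D.comul ▷ A ≫ (α_ A A A).hom) ≫ (χ ⊗ₘ (ψ ⊗ₘ f)) ≫ (λ_ _).hom ≫ (λ_ V).hom := by
    simp only [convLeft, MonoidalCategory.tensorHom_def, comp_whiskerRight, Category.assoc,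
      whiskerLeft_comp, whiskerRight_tensor, id_whiskerLeft]
    simp
  rw [e₁, h]
  simp only [convLeft, MonoidalCategory.tensorHom_def', Category.assoc, whiskerLeft_comp]
  simp

lemma convLeft_counit (h : D.comul ≫ A ◁ D.counit = (ρ_ A).inv) (χ : A ⟶ 𝟙_ 𝒞) :
    D.convLeft χ D.counit = χ := by
  rw [convLeft, MonoidalCategory.tensorHom_def', Category.assoc, reassoc_of% h, unitors_equal]
  simp

lemma counit_convLeft (h : D.comul ≫ D.counit ▷ A = (λ_ A).inv) (f : A ⟶ V) :
    D.convLeft D.counit f = f := by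
  rw [convLeft, MonoidalCategory.tensorHom_def, Category.assoc, reassoc_of% h]
  simp

/-- A convolution idempotent that has a right inverse is trivial. -/
lemma eq_counit_of_idempotent
    (h : D.comul ≫ D.comul ▷ A ≫ (α_ A A A).hom = D.comul ≫ A ◁ D.comul)
    (hr : D.comul ≫ A ◁ D.counit = (ρ_ A).inv) {χ χ' : A ⟶ 𝟙_ 𝒞}
    (hχ : D.convLeft χ χ = χ) (hχ' : D.convLeft χ χ' = D.counit) : χ = D.counit := by
  rw [← hχ']
  nth_rw 2 [← hχ]
  rw [convLeft_assoc h, hχ', convLeft_counit hr]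

/-- Inverses for the convolution product are unique. -/
lemma convInverse_unique
    (h : D.comul ≫ D.comul ▷ A ≫ (α_ A A A).hom = D.comul ≫ A ◁ D.comul)
    (hl : D.comul ≫ D.counit ▷ A = (λ_ A).inv) (hr : D.comul ≫ A ◁ D.counit = (ρ_ A).inv)
    {χ φ ψ : A ⟶ 𝟙_ 𝒞} (hφ : D.convLeft φ χ = D.counit) (hψ : D.convLeft χ ψ = D.counit) :
    φ = ψ := by
  rw [← convLeft_counit hr φ, ← hψ, ← convLeft_assoc h, hφ, counit_convLeft hl]

/-- Inner factors that are inverse to each other cancel, and then the outer ones. -/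
lemma convLeft_cancel
    (h : D.comul ≫ D.comul ▷ A ≫ (α_ A A A).hom = D.comul ≫ A ◁ D.comul)
    (hl : D.comul ≫ D.counit ▷ A = (λ_ A).inv) {φ φ' χ χ' : A ⟶ 𝟙_ 𝒞}
    (hφ : D.convLeft φ φ' = D.counit) (hχ : D.convLeft χ χ' = D.counit) :
    D.convLeft (D.convLeft χ φ) (D.convLeft φ' χ') = D.counit := by
  rw [convLeft_assoc h, ← convLeft_assoc h φ, hφ, counit_convLeft hl, hχ]

end BialgData

/-! ### The two-cocycle that is given by a pairing -/

namespace Dbl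

/-- The pairing on `C ⊗ H ⊗ B` that is induced by a pairing of `B` and `C`. -/
abbrev hat (p : Tm DblOp (B ⊗ᵒ C) .one) :
    Tm DblOp ((C ⊗ᵒ (H ⊗ᵒ B)) ⊗ᵒ (C ⊗ᵒ (H ⊗ᵒ B))) .one :=
  ((cC ⊗ᵗ (cH ▷ᵗ B)) ⊗ᵗ (C ◁ᵗ (cH ⊗ᵗ cB))) ⊗≫ᵗ p

/-- `c ↦ p(1, c)`. -/
abbrev oneLeft (p : Tm DblOp (B ⊗ᵒ C) .one) : Tm DblOp C .one := .leftInv C ≫ᵗ eB ▷ᵗ C ≫ᵗ p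

/-- `b ↦ p(b, 1)`. -/
abbrev oneRight (p : Tm DblOp (B ⊗ᵒ C) .one) : Tm DblOp B .one := .rightInv B ≫ᵗ B ◁ᵗ eC ≫ᵗ p

/-- The multiplication of the double biproduct. -/
abbrev doubleBiproductMul :
    Tm DblOp ((C ⊗ᵒ (H ⊗ᵒ B)) ⊗ᵒ (C ⊗ᵒ (H ⊗ᵒ B))) (C ⊗ᵒ (H ⊗ᵒ B)) :=
  ((C ◁ᵗ (dH ⊗ᵗ dB)) ⊗ᵗ (dC ⊗ᵗ (dH ▷ᵗ B))) ⊗≫ᵗ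
  (C ⊗ᵒ H ⊗ᵒ H ⊗ᵒ B) ◁ᵗ (.braid B C ▷ᵗ (C ⊗ᵒ H ⊗ᵒ H ⊗ᵒ B)) ⊗≫ᵗ
  (C ⊗ᵒ H ⊗ᵒ H) ◁ᵗ (((nB ⊗ᵗ dC) ⊗ᵗ (dB ⊗ᵗ nC)) ▷ᵗ (H ⊗ᵒ H ⊗ᵒ B)) ⊗≫ᵗ
  (C ⊗ᵒ H ⊗ᵒ H ⊗ᵒ B) ◁ᵗ (((.braid H C ▷ᵗ C) ⊗ᵗ (B ◁ᵗ .braid B H)) ▷ᵗ (C ⊗ᵒ H ⊗ᵒ H ⊗ᵒ B)) ⊗≫ᵗ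
  (C ⊗ᵒ H ⊗ᵒ H) ◁ᵗ (((pr ⊗ᵗ (dH ▷ᵗ C)) ⊗ᵗ ((B ◁ᵗ dH) ⊗ᵗ pr')) ▷ᵗ (H ⊗ᵒ H ⊗ᵒ B)) ⊗≫ᵗ
  (C ⊗ᵒ H ⊗ᵒ H ⊗ᵒ H) ◁ᵗ ((.braid H C ⊗ᵗ .braid B H) ▷ᵗ (H ⊗ᵒ H ⊗ᵒ H ⊗ᵒ B)) ⊗≫ᵗ
  (C ⊗ᵒ H ⊗ᵒ H) ◁ᵗ ((aC ⊗ᵗ (mH ⊗ᵗ aB)) ▷ᵗ (H ⊗ᵒ H ⊗ᵒ B)) ⊗≫ᵗ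
  (C ⊗ᵒ H) ◁ᵗ ((.braid H C ⊗ᵗ (H ◁ᵗ .braid B H)) ▷ᵗ (H ⊗ᵒ B)) ⊗≫ᵗ
  ((C ◁ᵗ aC) ⊗ᵗ ((mH ▷ᵗ H) ⊗ᵗ (aB ▷ᵗ B))) ≫ᵗ
  (mC ⊗ᵗ (mH ⊗ᵗ mB))

end Dbl

section Double

variable {H : 𝒞} [HopfObj H] {B C : 𝒞} [MonObj B] [ComonObj B] [MonObj C] [ComonObj C]
variable {M : RightCrossedModule H B} {N : LeftCrossedModule H C}

open Dbl

/-- The compatibility of the pairing with the actions and with the multiplications. -/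
def pairingAx : DblAx → Bool
  | .pairAct | .pairMulRight | .pairMulLeft => true
  | _ => false

theorem holds_pairingAx {ρ : B ⊗ C ⟶ 𝟙_ 𝒞} (hρ : IsCompatiblePairing M N ρ)
    (ρ' : B ⊗ C ⟶ 𝟙_ 𝒞) (t : H ⟶ H) (k : DblAx) (hk : pairingAx k = true) :
    (model M N ρ ρ' t).Holds (ax k) := by
  cases k
  case pairAct => exact hρ.act.symm
  case pairMulRight => exact hρ.mul_right
  case pairMulLeft => exact hρ.mul_left
  all_goals cases hk

/-- The equations that say that the pairing is unital. -/
def pairingOneAx : DblAx → Bool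
  | .pairOneLeft | .pairOneRight => true
  | _ => false

/-- The equations that say that the two pairings are inverse to each other for the convolution
product. -/
def pairingConvAx : DblAx → Bool
  | .pairConv | .pairConv' => true
  | _ => false

theorem holds_pairingConvAx {ρ ρ' : B ⊗ C ⟶ 𝟙_ 𝒞}
    (h : ((BialgData.of B).tensor (BialgData.of C)).IsConvInverse ρ ρ') (t : H ⟶ H) (k : DblAx)
    (hk : pairingConvAx k = true) : (model M N ρ ρ' t).Holds (ax k) := by
  cases k
  case pairConv => exact h.1
  case pairConv' => exact h.2
  all_goals cases hk

set_option maxRecDepth 4000 in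
theorem hatPairing_cocycleIdentity (hB : M.IsBialgebra) (hC : N.IsBialgebra)
    {ρ : B ⊗ C ⟶ 𝟙_ 𝒞} (hρ : IsCompatiblePairing M N ρ) :
    (doubleBialgData M N).CocycleIdentity (hatPairing H ρ) :=
  holds_of_check_extra (ρ' := ρ) (t := 𝟙 H) hB hC (extra := pairingAx) (holds_pairingAx hρ _ _)
    (r := ⟨_, _, .assoc _ _ _ ≫ᵗ
        (Dbl.C ⊗ᵒ (Dbl.H ⊗ᵒ Dbl.B)) ◁ᵗ ((double.tensor double).convLeft (hat pr) double.mul) ≫ᵗ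
        hat pr,
      ((double.tensor double).convLeft (hat pr) double.mul) ▷ᵗ (Dbl.C ⊗ᵒ (Dbl.H ⊗ᵒ Dbl.B)) ≫ᵗ
        hat pr⟩)
    [(.ax .mulCounitH, 7, 4), (.ax .counitComulH, 3, 6), (.ax .mulCounitH, 15, 9),
      (.ax .counitComulH, 5, 11), (.ax .mulCounitH, 31, 5), (.ax .counitComulH, 25, 7),
      (.ax .comulCounitH, 13, 6), (.ax .mulCounitB, 29, 4), (.ax .comulCounitB, 1, 9),
      (.ax .actCounitB, 26, 5), (.ax .mulCounitH, 12, 12), (.ax .comulCounitB, 1, 6),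
      (.ax .coactCounitB, 2, 10), (.ax .counitComulC, 0, 3), (.ax .coactCounitC, 0, 3),
      (.ax .coactCounitC, 5, 7), (.natLInv .counitH 1, 5, 8), (.natRInv 2 .counitB, 6, 7),
      (.natL .mulH 2, 3, 5), (.natRInv 0 .pair, 1, 4), (.ax .pairMulRight, 10, 0),
      (.ax .pairAct, 9, 1), (.cancel true 0 2, 6, 4)]
    [(.ax .mulCounitH, 7, 1), (.ax .counitComulH, 3, 3), (.ax .mulCounitH, 15, 6),
      (.ax .counitComulH, 5, 8), (.ax .mulCounitH, 31, 2), (.ax .counitComulH, 25, 4),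
      (.ax .comulCounitH, 13, 3), (.ax .coactComulCounitB, 11, 9), (.ax .mulOneH, 7, 7),
      (.ax .counitComulB, 1, 6), (.ax .counitComulC, 0, 0), (.ax .mulCounitC, 17, 0),
      (.ax .coactCounitC, 1, 0), (.ax .coactCounitC, 6, 5), (.ax .actCounitC, 11, 1),
      (.ax .mulCounitH, 4, 2), (.ax .coactCounitB, 1, 2), (.ax .comulCounitC, 4, 3),
      (.natLInv .counitH 1, 1, 1), (.natLInv .counitC 1, 2, 0), (.ax .pairMulLeft, 6, 0),
      (.natL .actB 1, 5, 0), (.cancel true 1 1, 11, 0), (.cancel true 0 1, 10, 1),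
      (.negLInv .pair 2, 7, 3), (.ax .actAssocB, 9, 0), (.cancel true 1 2, 3, 1)]
      (by decide +kernel)

theorem hatPairing_isTwoCocycle (hB : M.IsBialgebra) (hC : N.IsBialgebra)
    {ρ : B ⊗ C ⟶ 𝟙_ 𝒞} (hρ : IsCompatiblePairing M N ρ) (hu : IsUnitalPairing ρ) :
    (doubleBialgData M N).IsTwoCocycle (hatPairing H ρ) := by
  have h k (hk : pairingOneAx k = true) : (model M N ρ ρ (𝟙 H)).Holds (ax k) := by
    cases k
    case pairOneLeft => exact hu.1
    case pairOneRight => exact hu.2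
    all_goals cases hk
  exact ⟨hatPairing_cocycleIdentity hB hC hρ,
    holds_of_check_extra hB hC (extra := pairingOneAx) h
      (r := ⟨_, _, double.one ▷ᵗ (Dbl.C ⊗ᵒ (Dbl.H ⊗ᵒ Dbl.B)) ≫ᵗ hat pr,
        .left (Dbl.C ⊗ᵒ (Dbl.H ⊗ᵒ Dbl.B)) ≫ᵗ double.counit⟩)
      [(.ax .oneCounitH, 1, 1), (.ax .oneCounitC, 0, 0), (.ax .pairOneLeft, 0, 0)]
      [] (by decide +kernel),
    holds_of_check_extra hB hC (extra := pairingOneAx) h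
      (r := ⟨_, _, (Dbl.C ⊗ᵒ (Dbl.H ⊗ᵒ Dbl.B)) ◁ᵗ double.one ≫ᵗ hat pr,
        .right (Dbl.C ⊗ᵒ (Dbl.H ⊗ᵒ Dbl.B)) ≫ᵗ double.counit⟩)
      [(.ax .oneCounitH, 1, 4), (.ax .oneCounitB, 1, 4), (.ax .pairOneRight, 0, 2)]
      [] (by decide +kernel)⟩

theorem hatPairing_isConvInverse (hB : M.IsBialgebra) (hC : N.IsBialgebra)
    {ρ ρ' : B ⊗ C ⟶ 𝟙_ 𝒞}
    (h : ((BialgData.of B).tensor (BialgData.of C)).IsConvInverse ρ ρ') :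
    ((doubleBialgData M N).tensor (doubleBialgData M N)).IsConvInverse
      (hatPairing H ρ) (hatPairing H ρ') :=
  ⟨holds_of_check_extra (t := 𝟙 H) hB hC (extra := pairingConvAx) (holds_pairingConvAx h _)
      (r := ⟨_, _, (double.tensor double).convLeft (hat pr) (hat pr'),
        (double.tensor double).counit⟩)
      [(.ax .mulCounitH, 7, 1), (.ax .counitComulH, 3, 3), (.ax .mulCounitH, 5, 4),
        (.ax .mulCounitH, 16, 5), (.ax .counitComulH, 5, 8), (.ax .mulCounitH, 14, 8),
        (.ax .comulCounitB, 1, 6), (.ax .coactCounitB, 3, 4), (.ax .coactCounitB, 4, 8),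
        (.ax .counitComulC, 0, 0), (.ax .coactCounitC, 1, 0), (.ax .coactCounitC, 5, 4),
        (.natLInv .counitH 1, 1, 1), (.natLInv .counitH 1, 4, 5), (.ax .pairConv, 0, 2)]
      [] (by decide +kernel),
    holds_of_check_extra (t := 𝟙 H) hB hC (extra := pairingConvAx) (holds_pairingConvAx h _)
      (r := ⟨_, _, (double.tensor double).convLeft (hat pr') (hat pr),
        (double.tensor double).counit⟩)
      [(.ax .mulCounitH, 7, 1), (.ax .counitComulH, 3, 3), (.ax .mulCounitH, 5, 4),
        (.ax .mulCounitH, 16, 5), (.ax .counitComulH, 5, 8), (.ax .mulCounitH, 14, 8),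
        (.ax .comulCounitB, 1, 6), (.ax .coactCounitB, 3, 4), (.ax .coactCounitB, 4, 8),
        (.ax .counitComulC, 0, 0), (.ax .coactCounitC, 1, 0), (.ax .coactCounitC, 5, 4),
        (.natLInv .counitH 1, 1, 1), (.natLInv .counitH 1, 4, 5), (.ax .pairConv', 0, 2)]
      [] (by decide +kernel)⟩

set_option maxRecDepth 4000 in
/-- The multiplication of the twist is given by the string diagram of the double biproduct, for
arbitrary morphisms `ρ` and `ρ'`. -/
theorem twist_mul (hB : M.IsBialgebra) (hC : N.IsBialgebra) (ρ ρ' : B ⊗ C ⟶ 𝟙_ 𝒞) :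
    ((doubleBialgData M N).twist (hatPairing H ρ) (hatPairing H ρ')).mul =
      doubleBiproductMul M N ρ ρ' :=
  holds_of_check (ρ := ρ) (ρ' := ρ') (t := 𝟙 H) hB hC (r := ⟨_, _, (double.tensor double).convRight
      ((double.tensor double).convLeft (hat pr) double.mul) (hat pr'), Dbl.doubleBiproductMul⟩)
    [(.ax .mulCounitH, 7, 5), (.ax .comulCounitH, 3, 3), (.ax .mulCounitH, 15, 10),
      (.ax .comulCounitH, 5, 8), (.ax .mulCounitH, 29, 1), (.ax .counitComulH, 13, 1),
      (.ax .mulCounitH, 37, 6), (.ax .counitComulH, 27, 8), (.ax .comulCounitB, 1, 6),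
      (.ax .coactCounitB, 3, 4), (.ax .coactCounitB, 8, 9), (.ax .coactComulCounitB, 28, 9),
      (.ax .mulOneH, 24, 7), (.ax .counitComulB, 1, 6), (.ax .counitComulC, 6, 0),
      (.ax .coactCounitC, 2, 0), (.ax .coactCounitC, 23, 5), (.ax .coactComulCounitC, 2, 1),
      (.ax .oneMulH, 3, 1), (.ax .comulCounitC, 0, 0), (.natR 1 .mulH, 4, 4),
      (.natL .mulH 2, 10, 2), (.natRInv 0 .pair, 8, 1), (.natLInv .pair' 0, 3, 5),
      (.ax .mulComulH, 12, 1), (.natL .mulH 2, 16, 2), (.ax .mulComulH, 22, 3),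
      (.ax .assocH, 18, 3), (.ax .coassocB, 0, 2), (.ax .coassocC, 2, 5),
      (.natRInv 1 .comulH, 10, 7)]
    [(.ax .assocH, 23, 2), (.ax .assocH, 18, 4), (.ax .coassocC, 2, 5), (.natR 0 .actC, 18, 2),
      (.ax .actAssocC, 20, 1), (.natL .actB 0, 22, 5), (.ax .actAssocB, 24, 6),
      (.natLInv .comulB 2, 5, 4)] (by decide +kernel)

/-- A pairing that is invertible for the convolution product is unital: its restrictions to the
units are idempotent, because of the compatibility with the multiplications, and invertible. -/
theorem isUnitalPairing_of_isConvInverse (hB : M.IsBialgebra) (hC : N.IsBialgebra)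
    {ρ ρ' : B ⊗ C ⟶ 𝟙_ 𝒞} (hρ : IsCompatiblePairing M N ρ)
    (h : ((BialgData.of B).tensor (BialgData.of C)).IsConvInverse ρ ρ') :
    IsUnitalPairing ρ := by
  let S := model M N ρ ρ' (𝟙 H)
  have K {X Y : Ob} (f g : Tm DblOp X Y) s t hr : S.den f = S.den g :=
    holds_of_check_extra hB hC (extra := fun k => pairingAx k || pairingConvAx k)
      (fun k hk => (Bool.or_eq_true_iff.1 hk).elim (holds_pairingAx hρ _ _ k)
        (holds_pairingConvAx h _ k)) (r := ⟨X, Y, f, g⟩) s t hr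
  constructor
  · have h₁ := K (.leftInv Dbl.C ≫ᵗ (.leftInv .one ≫ᵗ (eB ⊗ᵗ eB) ≫ᵗ mB) ▷ᵗ Dbl.C ≫ᵗ pr)
        (oneLeft pr)
      [(.ax .oneMulB, 0, 0)]
      [] (by decide +kernel)
    have h₂ := K (.leftInv Dbl.C ≫ᵗ (.leftInv .one ≫ᵗ (eB ⊗ᵗ eB) ≫ᵗ mB) ▷ᵗ Dbl.C ≫ᵗ pr)
        (bialgC.convLeft (oneLeft pr) (oneLeft pr))
      [(.ax .pairMulLeft, 2, 0), (.ax .oneCoactB, 1, 1), (.ax .actOneB, 2, 1),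
        (.natL .oneB 1, 0, 0), (.negRInv 2 .oneB, 2, 1)]
      [] (by decide +kernel)
    have h₃ := K (oneLeft ((bialgB.tensor bialgC).convLeft pr pr')) cC
      [(.ax .pairConv, 1, 0), (.ax .oneCounitB, 0, 0)]
      [] (by decide +kernel)
    have h₄ := K (oneLeft ((bialgB.tensor bialgC).convLeft pr pr'))
        (bialgC.convLeft (oneLeft pr) (oneLeft pr'))
      [(.ax .oneComulB, 0, 0), (.natL .oneB 2, 1, 1)]
      [] (by decide +kernel)
    exact (Iso.inv_comp_eq _).1 (BialgData.eq_counit_of_idempotent (D := BialgData.of C)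
      (holds_crossedAx hB hC ρ ρ' (𝟙 H) .coassocC rfl)
      (holds_crossedAx hB hC ρ ρ' (𝟙 H) .comulCounitC rfl) (h₂.symm.trans h₁) (h₄.symm.trans h₃))
  · have h₁ := K (.rightInv Dbl.B ≫ᵗ Dbl.B ◁ᵗ (.leftInv .one ≫ᵗ (eC ⊗ᵗ eC) ≫ᵗ mC) ≫ᵗ pr)
        (oneRight pr)
      [(.ax .oneMulC, 0, 1)]
      [] (by decide +kernel)
    have h₂ := K (.rightInv Dbl.B ≫ᵗ Dbl.B ◁ᵗ (.leftInv .one ≫ᵗ (eC ⊗ᵗ eC) ≫ᵗ mC) ≫ᵗ pr)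
        (bialgB.convLeft (oneRight pr) (oneRight pr))
      [(.ax .pairMulRight, 2, 0)]
      [(.negL .oneC 1, 1, 1)] (by decide +kernel)
    have h₃ := K (oneRight ((bialgB.tensor bialgC).convLeft pr pr')) cB
      [(.ax .pairConv, 1, 0), (.ax .oneCounitC, 0, 1)]
      [] (by decide +kernel)
    have h₄ := K (oneRight ((bialgB.tensor bialgC).convLeft pr pr'))
        (bialgB.convLeft (oneRight pr) (oneRight pr'))
      [(.ax .oneComulC, 0, 1), (.natR 1 .oneC, 0, 0)]
      [] (by decide +kernel)
    exact (Iso.inv_comp_eq _).1 (BialgData.eq_counit_of_idempotent (D := BialgData.of B)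
      (holds_crossedAx hB hC ρ ρ' (𝟙 H) .coassocB rfl)
      (holds_crossedAx hB hC ρ ρ' (𝟙 H) .comulCounitB rfl) (h₂.symm.trans h₁) (h₄.symm.trans h₃))

end Double

/-! ### The twist of a bialgebra by a two-cocycle -/

/-- The generating morphisms of the calculus of a bialgebra `A` with two pairings of `A` with
itself. -/
inductive TwistOp
  | mul | one | comul | counit | pair | pair'
  deriving DecidableEq

namespace Twist

/-- The bialgebra has colour `0`. -/
abbrev A : Ob := .of 0

open TwistOp in
/-- The sources of the generating morphisms. -/
@[reducible] def dom : TwistOp → Ob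
  | mul => A ⊗ᵒ A | one => .one | comul => A | counit => A | pair => A ⊗ᵒ A | pair' => A ⊗ᵒ A

open TwistOp in
/-- The targets of the generating morphisms. -/
@[reducible] def cod : TwistOp → Ob
  | mul => A | one => A | comul => A ⊗ᵒ A | counit => .one | pair => .one | pair' => .one

end Twist

instance : Signature TwistOp := ⟨Twist.dom, Twist.cod⟩

namespace Twist

abbrev pr : Tm TwistOp (A ⊗ᵒ A) .one := .gen (.op TwistOp.pair)
abbrev pr' : Tm TwistOp (A ⊗ᵒ A) .one := .gen (.op TwistOp.pair')

abbrev bialg : Bialg TwistOp A :=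
  ⟨.gen (.op TwistOp.mul), .gen (.op TwistOp.one), .gen (.op TwistOp.comul),
    .gen (.op TwistOp.counit)⟩

/-- The bialgebra `A ⊗ A`. -/
abbrev bialgTwo : Bialg TwistOp (A ⊗ᵒ A) := bialg.tensor bialg

/-- The bialgebra `A ⊗ A ⊗ A`. -/
abbrev bialgThree : Bialg TwistOp ((A ⊗ᵒ A) ⊗ᵒ A) := bialgTwo.tensor bialg

/-- The twisted multiplication `χ.m.χ'`. -/
abbrev mul : Tm TwistOp (A ⊗ᵒ A) A := bialgTwo.convRight (bialgTwo.convLeft pr bialg.mul) pr'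

/-- The bialgebra `A` with the twisted multiplication. -/
abbrev twist : Bialg TwistOp A := ⟨mul, bialg.one, bialg.comul, bialg.counit⟩

/-- One side of the cocycle identity, `χ ∘ (f ⊗ id)`. -/
abbrev left (f : Tm TwistOp (A ⊗ᵒ A) A) {X : Ob} (χ : Tm TwistOp (A ⊗ᵒ A) X) :
    Tm TwistOp ((A ⊗ᵒ A) ⊗ᵒ A) X :=
  f ▷ᵗ A ≫ᵗ χ

/-- The other side of the cocycle identity, `χ ∘ (id ⊗ f)`. -/
abbrev right (f : Tm TwistOp (A ⊗ᵒ A) A) {X : Ob} (χ : Tm TwistOp (A ⊗ᵒ A) X) :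
    Tm TwistOp ((A ⊗ᵒ A) ⊗ᵒ A) X :=
  .assoc A A A ≫ᵗ A ◁ᵗ f ≫ᵗ χ

/-- `χ ⊗ ε`. -/
abbrev padRight (χ : Tm TwistOp (A ⊗ᵒ A) .one) : Tm TwistOp ((A ⊗ᵒ A) ⊗ᵒ A) .one :=
  (χ ⊗ᵗ bialg.counit) ≫ᵗ .left .one

/-- `ε ⊗ χ`. -/
abbrev padLeft (χ : Tm TwistOp (A ⊗ᵒ A) .one) : Tm TwistOp ((A ⊗ᵒ A) ⊗ᵒ A) .one :=
  .assoc A A A ≫ᵗ (bialg.counit ⊗ᵗ χ) ≫ᵗ .left .one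

end Twist

/-- Labels for the axioms of the bialgebra, and for the equations that say that the two pairings are
inverse to each other for the convolution product and unital. The cocycle identity is not among
them; it is used only as an equation in `𝒞`. -/
inductive TwistAx
  | bialg (k : BialgAx) | conv | conv' | oneLeft | oneRight | oneLeft' | oneRight'

namespace Twist

/-- The equations with the given labels. -/
@[reducible] def ax : TwistAx → Rule TwistOp
  | .bialg k => bialgAx bialg k
  | .conv => ⟨_, _, bialgTwo.convLeft pr pr', bialgTwo.counit⟩
  | .conv' => ⟨_, _, bialgTwo.convLeft pr' pr, bialgTwo.counit⟩
  | .oneLeft => ⟨_, _, bialg.one ▷ᵗ A ≫ᵗ pr, .left A ≫ᵗ bialg.counit⟩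
  | .oneRight => ⟨_, _, A ◁ᵗ bialg.one ≫ᵗ pr, .right A ≫ᵗ bialg.counit⟩
  | .oneLeft' => ⟨_, _, bialg.one ▷ᵗ A ≫ᵗ pr', .left A ≫ᵗ bialg.counit⟩
  | .oneRight' => ⟨_, _, A ◁ᵗ bialg.one ≫ᵗ pr', .right A ≫ᵗ bialg.counit⟩

open TwistAx in
/-- The equations other than the unitality of the inverse pairing, which is derived from them. -/
def cocycleAx : TwistAx → Bool
  | oneLeft' | oneRight' => false
  | _ => true

variable {A : 𝒞} {D : BialgData A} {χ χ' : A ⊗ A ⟶ 𝟙_ 𝒞}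

/-- The interpretation of the generating morphisms. -/
@[reducible] def model (D : BialgData A) (χ χ' : A ⊗ A ⟶ 𝟙_ 𝒞) : Model TwistOp 𝒞 where
  obj := fun _ => A
  mor := fun
    | .mul => D.mul | .one => D.one | .comul => D.comul | .counit => D.counit
    | .pair => χ | .pair' => χ'

theorem holds_cocycleAx (hD : D.IsBialgebra) (hχ : D.IsTwoCocycle χ)
    (h : (D.tensor D).IsConvInverse χ χ') (k : TwistAx) (hk : cocycleAx k = true) :
    (model D χ χ').Holds (ax k) := by
  cases k
  case bialg k => exact hD.holds (S := model D χ χ') (E := Twist.bialg) rfl HEq.rfl k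
  case conv => exact h.1
  case conv' => exact h.2
  case oneLeft => exact hχ.2.1
  case oneRight => exact hχ.2.2
  all_goals cases hk

theorem holds_of_check_cocycleAx (hD : D.IsBialgebra) (hχ : D.IsTwoCocycle χ)
    (h : (D.tensor D).IsConvInverse χ χ') {r : Rule TwistOp} (s t : Script TwistAx TwistOp)
    (hr : r.check ax cocycleAx s t = true) : (model D χ χ').Holds r :=
  (model D χ χ').holds_of_check (holds_cocycleAx hD hχ h) s t hr

/-- The inverse of a unital pairing is unital on the left: restrict `χ.χ'` to `1 ⊗ a`. -/
theorem oneLeft' (hD : D.IsBialgebra) (hχ : D.IsTwoCocycle χ)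
    (h : (D.tensor D).IsConvInverse χ χ') : (model D χ χ').Holds (ax .oneLeft') := by
  have h₁ := holds_of_check_cocycleAx hD hχ h (r := ⟨_, _,
      bialg.one ▷ᵗ Twist.A ≫ᵗ bialgTwo.convLeft pr pr', bialg.one ▷ᵗ Twist.A ≫ᵗ pr'⟩)
    [(.ax (.bialg .oneComul), 0, 0), (.ax .oneLeft, 0, 0),
      (.ax (.bialg .counitComul), 0, 0)]
    [] (by decide +kernel)
  have h₂ := holds_of_check_cocycleAx hD hχ h (r := ⟨_, _,
      bialg.one ▷ᵗ Twist.A ≫ᵗ bialgTwo.convLeft pr pr', .left Twist.A ≫ᵗ bialg.counit⟩)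
    [(.ax .conv, 1, 0), (.ax (.bialg .oneCounit), 0, 0)]
    [] (by decide +kernel)
  exact h₁.symm.trans h₂

/-- The inverse of a unital pairing is unital on the right. -/
theorem oneRight' (hD : D.IsBialgebra) (hχ : D.IsTwoCocycle χ)
    (h : (D.tensor D).IsConvInverse χ χ') : (model D χ χ').Holds (ax .oneRight') := by
  have h₁ := holds_of_check_cocycleAx hD hχ h (r := ⟨_, _,
      Twist.A ◁ᵗ bialg.one ≫ᵗ bialgTwo.convLeft pr pr', Twist.A ◁ᵗ bialg.one ≫ᵗ pr'⟩)
    [(.ax (.bialg .oneComul), 0, 1), (.natR 0 .one, 0, 0), (.ax .oneRight, 2, 0),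
      (.ax (.bialg .counitComul), 1, 0)]
    [] (by decide +kernel)
  have h₂ := holds_of_check_cocycleAx hD hχ h (r := ⟨_, _,
      Twist.A ◁ᵗ bialg.one ≫ᵗ bialgTwo.convLeft pr pr', .right Twist.A ≫ᵗ bialg.counit⟩)
    [(.ax .conv, 1, 0), (.ax (.bialg .oneCounit), 0, 1)]
    [] (by decide +kernel)
  exact h₁.symm.trans h₂

theorem holds_of_check (hD : D.IsBialgebra) (hχ : D.IsTwoCocycle χ)
    (h : (D.tensor D).IsConvInverse χ χ') {r : Rule TwistOp} (s t : Script TwistAx TwistOp)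
    (hr : r.check ax (fun _ => true) s t = true) : (model D χ χ').Holds r := by
  refine (model D χ χ').holds_of_check (fun k _ => ?_) s t hr
  cases hk : cocycleAx k
  · cases k
    case oneLeft' => exact oneLeft' hD hχ h
    case oneRight' => exact oneRight' hD hχ h
    all_goals cases hk
  · exact holds_cocycleAx hD hχ h k hk

/-- The inverse of a two-cocycle satisfies the mirrored cocycle identity. Both sides are inverse to
the two sides of the cocycle identity, for the convolution product on `(A ⊗ A) ⊗ A`. -/
theorem inverse_cocycleIdentity (hD : D.IsBialgebra) (hχ : D.IsTwoCocycle χ)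
    (h : (D.tensor D).IsConvInverse χ χ') :
    (model D χ χ').Holds ⟨_, _, left (bialgTwo.convRight bialg.mul pr') pr',
      right (bialgTwo.convRight bialg.mul pr') pr'⟩ := by
  have H {X Y : Ob} (f g : Tm TwistOp X Y) s t hr : (model D χ χ').den f = (model D χ χ').den g :=
    holds_of_check hD hχ h (r := ⟨X, Y, f, g⟩) s t hr
  let E := bialgThree.data (model D χ χ')
  have coassoc := H (bialgThree.comul ≫ᵗ bialgThree.comul ▷ᵗ _ ≫ᵗ .assoc _ _ _)
    (bialgThree.comul ≫ᵗ _ ◁ᵗ bialgThree.comul)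
    [(.ax (.bialg .coassoc), 0, 0), (.ax (.bialg .coassoc), 0, 1),
      (.ax (.bialg .coassoc), 0, 2), (.natL .comul 0, 3, 2), (.natL .comul 0, 6, 1)]
    [] (by decide +kernel)
  have counitComul := H (bialgThree.comul ≫ᵗ bialgThree.counit ▷ᵗ _) (.leftInv _)
    [(.ax (.bialg .counitComul), 0, 0), (.ax (.bialg .counitComul), 0, 1),
      (.ax (.bialg .counitComul), 0, 2)]
    [] (by decide +kernel)
  have comulCounit := H (bialgThree.comul ≫ᵗ _ ◁ᵗ bialgThree.counit) (.rightInv _)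
    [(.ax (.bialg .comulCounit), 0, 0), (.ax (.bialg .comulCounit), 0, 1),
      (.ax (.bialg .comulCounit), 0, 2)]
    [] (by decide +kernel)
  have l := H (left (bialgTwo.convLeft pr bialg.mul) pr)
    (bialgThree.convLeft (padRight pr) (left bialg.mul pr))
    []
    [(.ax (.bialg .counitComul), 0, 2)] (by decide +kernel)
  have l' := H (left (bialgTwo.convRight bialg.mul pr') pr')
    (bialgThree.convLeft (left bialg.mul pr') (padRight pr'))
    []
    [(.ax (.bialg .comulCounit), 0, 2)] (by decide +kernel)
  have r := H (right (bialgTwo.convLeft pr bialg.mul) pr)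
    (bialgThree.convLeft (padLeft pr) (right bialg.mul pr))
    []
    [(.ax (.bialg .counitComul), 0, 0), (.natRInv 0 .pair, 1, 0)] (by decide +kernel)
  have r' := H (right (bialgTwo.convRight bialg.mul pr') pr')
    (bialgThree.convLeft (right bialg.mul pr') (padLeft pr'))
    []
    [(.ax (.bialg .comulCounit), 0, 0)] (by decide +kernel)
  have pad := H (bialgThree.convLeft (padRight pr') (padRight pr)) bialgThree.counit
    [(.ax .conv', 0, 0), (.ax (.bialg .counitComul), 0, 2)]
    [] (by decide +kernel)
  have pad' := H (bialgThree.convLeft (padLeft pr) (padLeft pr')) bialgThree.counit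
    [(.ax .conv, 0, 1), (.ax (.bialg .counitComul), 0, 0)]
    [] (by decide +kernel)
  have mul := H (bialgThree.convLeft (left bialg.mul pr') (left bialg.mul pr)) bialgThree.counit
    [(.inv (.bialg .mulComul), 0, 0), (.ax .conv', 1, 0), (.ax (.bialg .mulCounit), 0, 0)]
    [] (by decide +kernel)
  have mul' := H (bialgThree.convLeft (right bialg.mul pr) (right bialg.mul pr'))
      bialgThree.counit
    [(.natL .mul 0, 6, 1), (.natL .mul 0, 8, 2), (.inv (.bialg .mulComul), 0, 1),
      (.ax .conv, 1, 0), (.ax (.bialg .mulCounit), 0, 1)]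
    [] (by decide +kernel)
  have cocycle : (model D χ χ').den (left (bialgTwo.convLeft pr bialg.mul) pr)
      = (model D χ χ').den (right (bialgTwo.convLeft pr bialg.mul) pr) := hχ.1.symm
  refine BialgData.convInverse_unique (D := E) coassoc counitComul comulCounit
    (χ := (model D χ χ').den (left (bialgTwo.convLeft pr bialg.mul) pr)) ?_ ?_
  · exact (congrArg₂ E.convLeft l' l).trans
      (BialgData.convLeft_cancel coassoc counitComul pad mul)
  · exact (congrArg₂ E.convLeft (cocycle.trans r) r').trans
      (BialgData.convLeft_cancel coassoc counitComul mul' pad')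

set_option maxRecDepth 8000 in
/-- Both sides are convolution products on `(A ⊗ A) ⊗ A` of a side of the cocycle identity for `χ`,
the threefold multiplication of `A`, and a side of the mirrored cocycle identity for `χ'`. -/
theorem mul_assoc (hD : D.IsBialgebra) (hχ : D.IsTwoCocycle χ)
    (h : (D.tensor D).IsConvInverse χ χ') : (model D χ χ').Holds (bialgAx twist .assoc) := by
  have H {X Y : Ob} (f g : Tm TwistOp X Y) s t hr : (model D χ χ').den f = (model D χ χ').den g :=
    holds_of_check hD hχ h (r := ⟨X, Y, f, g⟩) s t hr
  let E := bialgThree.data (model D χ χ')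
  have hl := H (left mul mul) (bialgThree.convRight (bialgThree.convLeft
      (left (bialgTwo.convLeft pr bialg.mul) pr) (left bialg.mul bialg.mul))
      (left (bialgTwo.convRight bialg.mul pr') pr'))
    [(.ax (.bialg .mulComul), 7, 0), (.ax (.bialg .mulComul), 10, 0),
      (.natLInv .comul 0, 5, 1), (.natLInv .comul 0, 7, 1), (.natRInv 0 .comul, 2, 1),
      (.natRInv 0 .comul, 4, 2), (.natRInv 0 .comul, 5, 2), (.natRInv 0 .comul, 24, 2),
      (.natL .mul 0, 20, 1), (.natRInv 0 .pair', 20, 4), (.natL .mul 0, 21, 3),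
      (.natL .mul 0, 25, 4), (.natR 0 .mul, 27, 4), (.natR 0 .mul, 29, 3),
      (.natR 0 .mul, 31, 2), (.natR 0 .mul, 33, 1), (.natR 0 .mul, 35, 0),
      (.natL .mul 0, 19, 0), (.natL .mul 0, 44, 1), (.natL .mul 0, 46, 2),
      (.natR 0 .mul, 40, 5), (.natLInv .pair 0, 40, 4), (.natR 0 .mul, 46, 2),
      (.natLInv .pair' 0, 46, 1), (.natR 0 .mul, 47, 4), (.ax (.bialg .coassoc), 0, 0),
      (.ax (.bialg .coassoc), 0, 1), (.ax (.bialg .coassoc), 0, 2),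
      (.ax (.bialg .coassoc), 3, 2), (.ax (.bialg .coassoc), 3, 2),
      (.ax (.bialg .coassoc), 7, 1), (.ax (.bialg .coassoc), 7, 1),
      (.ax (.bialg .assoc), 46, 6), (.natR 0 .mul, 47, 5)]
    [(.natLInv .comul 0, 2, 1), (.natLInv .comul 0, 6, 4), (.natRInv 0 .comul, 3, 2),
      (.natRInv 0 .comul, 4, 2), (.natRInv 0 .comul, 13, 7), (.natL .mul 0, 33, 0),
      (.natL .mul 0, 32, 0), (.natL .mul 0, 38, 1), (.natL .mul 0, 37, 1),
      (.natL .mul 0, 41, 2), (.natL .mul 0, 40, 2), (.ax (.bialg .coassoc), 0, 0),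
      (.ax (.bialg .coassoc), 0, 0), (.ax (.bialg .coassoc), 0, 1),
      (.ax (.bialg .coassoc), 0, 1), (.ax (.bialg .coassoc), 0, 2),
      (.ax (.bialg .assoc), 30, 3), (.natL .mul 0, 30, 4), (.natL .mul 0, 32, 5),
      (.natL .mul 0, 34, 6), (.natL .mul 0, 36, 7), (.natL .mul 0, 38, 8),
      (.natR 0 .mul, 46, 7)] (by decide +kernel)
  have hr := H (right mul mul) (bialgThree.convRight (bialgThree.convLeft
      (right (bialgTwo.convLeft pr bialg.mul) pr) (right bialg.mul bialg.mul))
      (right (bialgTwo.convRight bialg.mul pr') pr'))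
    [(.ax (.bialg .mulComul), 7, 1), (.ax (.bialg .mulComul), 10, 1),
      (.natLInv .comul 0, 5, 2), (.natLInv .comul 0, 7, 2), (.natRInv 0 .comul, 2, 2),
      (.natRInv 0 .comul, 4, 3), (.natRInv 0 .comul, 5, 3), (.natRInv 0 .pair', 21, 4),
      (.natR 0 .mul, 19, 0), (.natR 0 .mul, 19, 2), (.natR 0 .mul, 25, 1),
      (.natL .mul 0, 27, 1), (.natL .mul 0, 29, 2), (.natL .mul 0, 31, 3),
      (.natL .mul 0, 33, 4), (.natL .mul 0, 35, 5), (.natR 0 .mul, 20, 4),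
      (.natL .mul 0, 40, 1), (.natRInv 0 .pair', 40, 2), (.natR 0 .mul, 42, 5),
      (.natR 0 .mul, 44, 4), (.natL .mul 0, 46, 4), (.natL .mul 0, 47, 1),
      (.ax (.bialg .coassoc), 0, 1), (.ax (.bialg .coassoc), 0, 0),
      (.ax (.bialg .coassoc), 0, 2), (.ax (.bialg .coassoc), 1, 3),
      (.ax (.bialg .coassoc), 1, 3), (.ax (.bialg .coassoc), 7, 4),
      (.ax (.bialg .coassoc), 7, 4)]
    [(.natLInv .comul 0, 4, 3), (.natRInv 0 .comul, 2, 1), (.natRInv 0 .comul, 3, 1),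
      (.natRInv 0 .comul, 9, 6), (.natRInv 0 .comul, 10, 6), (.natL .mul 0, 29, 1),
      (.natL .mul 0, 31, 2), (.natL .mul 0, 33, 3), (.natL .mul 0, 35, 4),
      (.natRInv 0 .pair', 35, 5), (.natL .mul 0, 38, 1), (.natRInv 0 .pair, 38, 2),
      (.ax (.bialg .coassoc), 0, 0), (.ax (.bialg .coassoc), 0, 1),
      (.ax (.bialg .coassoc), 0, 1), (.ax (.bialg .coassoc), 0, 2),
      (.ax (.bialg .coassoc), 0, 2)] (by decide +kernel)
  exact hl.trans ((congrArg₂ E.convRight (congrArg₂ E.convLeft hχ.1.symm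
    (holds_cocycleAx hD hχ h (.bialg .assoc) rfl)) (inverse_cocycleIdentity hD hχ h)).trans hr.symm)

set_option maxRecDepth 8000 in
/-- Both sides are equal to `(χ.m ⊗ m.χ') ∘ Δ`. -/
theorem mul_comul (hD : D.IsBialgebra) (hχ : D.IsTwoCocycle χ)
    (h : (D.tensor D).IsConvInverse χ χ') :
    (model D χ χ').Holds (bialgAx twist .mulComul) := by
  have H {X Y : Ob} (f g : Tm TwistOp X Y) s t hr : (model D χ χ').den f = (model D χ χ').den g :=
    holds_of_check hD hχ h (r := ⟨X, Y, f, g⟩) s t hr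
  have h₁ := H (bialgTwo.comul ≫ᵗ (mul ⊗ᵗ mul)) (bialgTwo.comul ≫ᵗ
      (bialgTwo.convLeft pr bialg.mul ⊗ᵗ
        bialgTwo.convLeft (bialgTwo.convLeft pr' pr) (bialgTwo.convRight bialg.mul pr')))
    [(.natLInv .comul 0, 2, 1), (.natLInv .comul 0, 4, 1), (.natRInv 0 .comul, 3, 2),
      (.natRInv 0 .comul, 4, 2), (.natRInv 0 .comul, 24, 3), (.natRInv 0 .pair', 21, 1),
      (.natL .mul 0, 22, 0), (.natRInv 0 .pair, 22, 1), (.natRInv 0 .pair', 27, 5),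
      (.ax (.bialg .coassoc), 0, 0), (.ax (.bialg .coassoc), 0, 0),
      (.ax (.bialg .coassoc), 0, 1), (.ax (.bialg .coassoc), 0, 1),
      (.ax (.bialg .coassoc), 3, 4), (.ax (.bialg .coassoc), 8, 3)]
    [(.natLInv .comul 0, 2, 1), (.natLInv .comul 0, 3, 2), (.natLInv .comul 0, 6, 1),
      (.natRInv 0 .comul, 4, 3), (.natRInv 0 .comul, 19, 4), (.natL .mul 0, 17, 0),
      (.natRInv 0 .pair', 17, 1), (.natRInv 0 .pair', 27, 5), (.ax (.bialg .coassoc), 0, 0),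
      (.ax (.bialg .coassoc), 0, 1), (.ax (.bialg .coassoc), 2, 3),
      (.ax (.bialg .coassoc), 6, 2)] (by decide +kernel)
  have h₂ := H (bialgTwo.comul ≫ᵗ (bialgTwo.convLeft pr bialg.mul ⊗ᵗ
        bialgTwo.convLeft (bialgTwo.convLeft pr' pr) (bialgTwo.convRight bialg.mul pr')))
      (bialgTwo.comul ≫ᵗ (bialgTwo.convLeft pr bialg.mul ⊗ᵗ bialgTwo.convRight bialg.mul pr'))
    [(.ax .conv', 11, 1), (.ax (.bialg .counitComul), 1, 1),
      (.ax (.bialg .counitComul), 3, 3)]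
    [] (by decide +kernel)
  have h₃ := H (mul ≫ᵗ bialg.comul) (bialgTwo.comul ≫ᵗ
      (bialgTwo.convLeft pr bialg.mul ⊗ᵗ bialgTwo.convRight bialg.mul pr'))
    [(.ax (.bialg .mulComul), 7, 0), (.natLInv .comul 0, 5, 1), (.natRInv 0 .comul, 2, 1),
      (.natRInv 0 .comul, 4, 2), (.ax (.bialg .coassoc), 0, 0),
      (.ax (.bialg .coassoc), 0, 1), (.ax (.bialg .coassoc), 1, 2),
      (.ax (.bialg .coassoc), 4, 1)]
    [(.natLInv .comul 0, 2, 1), (.natRInv 0 .comul, 3, 2), (.ax (.bialg .coassoc), 0, 0),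
      (.ax (.bialg .coassoc), 0, 1)] (by decide +kernel)
  exact h₃.trans ((h₁.trans h₂).symm.trans (Category.assoc _ _ _))

end Twist

/-- The twist of a bialgebra by an invertible two-cocycle is a bialgebra. -/
theorem twist_isBialgebra {A : 𝒞} {D : BialgData A} (hD : D.IsBialgebra) {χ χ' : A ⊗ A ⟶ 𝟙_ 𝒞}
    (hχ : D.IsTwoCocycle χ) (h : (D.tensor D).IsConvInverse χ χ') :
    (D.twist χ χ').IsBialgebra := by
  have H k := Twist.holds_cocycleAx hD hχ h (.bialg k) rfl
  exact Bialg.isBialgebra (D := Twist.twist) (S := Twist.model D χ χ') (Twist.mul_assoc hD hχ h)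
    (Twist.holds_of_check hD hχ h
      [(.ax (.bialg .oneComul), 0, 0), (.ax (.bialg .oneComul), 0, 0), (.natL .one 0, 1, 1),
        (.ax (.bialg .oneMul), 6, 2), (.natL .one 0, 1, 1), (.ax .oneLeft, 0, 0),
        (.ax (.bialg .counitComul), 2, 0), (.ax .oneLeft', 1, 1),
        (.ax (.bialg .comulCounit), 0, 0)]
      [] (by decide +kernel))
    (Twist.holds_of_check hD hχ h
      [(.ax (.bialg .oneComul), 0, 1), (.ax (.bialg .oneComul), 0, 1),
        (.ax .oneRight', 2, 2), (.ax (.bialg .comulCounit), 2, 0),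
        (.ax (.bialg .mulOne), 1, 1), (.natR 0 .one, 0, 0), (.ax .oneRight, 1, 0),
        (.ax (.bialg .counitComul), 0, 0)]
      [] (by decide +kernel))
    (H .coassoc) (H .counitComul) (H .comulCounit) (Twist.mul_comul hD hχ h) (H .oneComul)
    (Twist.holds_of_check hD hχ h
      [(.ax (.bialg .mulCounit), 7, 0), (.ax (.bialg .comulCounit), 1, 0),
        (.ax (.bialg .comulCounit), 3, 1), (.ax .conv, 0, 0)]
      [] (by decide +kernel))
    (H .oneCounit)

end CrossProd

open CrossProd in
theorem corollary3p5
    {𝒞 : Type*} [Category 𝒞] [MonoidalCategory 𝒞] [BraidedCategory 𝒞] [IsIdempotentComplete 𝒞]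
    (H : 𝒞) [HopfObj H] [IsIso 𝒮[H]]
    (B C : 𝒞) [MonObj B] [ComonObj B] [MonObj C] [ComonObj C]
    (M : RightCrossedModule H B) (hB : M.IsBialgebra)
    (N : LeftCrossedModule H C) (hC : N.IsBialgebra) :
    -- `X = H ⋉ B`, `Y = C ⋊ H` are Hopf bimodules, `Y ⊗_H X = C ⊗ H ⊗ B`, and the tensor product
    -- `X ⊗_H Y` and the braidings of `X` and `Y` exist
    (M.hopfBimodule.IsHopfBimodule ∧ N.hopfBimodule.IsHopfBimodule ∧
      (doubleTensor M N).IsTensor ∧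
      ∃ (P : HopfTensor M.hopfBimodule N.hopfBimodule)
        (ψ : P.obj.pt ⟶ (doubleTensor M N).obj.pt) (ψ' : (doubleTensor M N).obj.pt ⟶ P.obj.pt),
        P.IsTensor ∧ P.IsBraiding (doubleTensor M N) ψ ∧ (doubleTensor M N).IsBraiding P ψ') ∧
    (BraidingInvolutive M.hopfBimodule N.hopfBimodule →
      -- the tensor product bialgebra of `Y` and `X` in the category of Hopf bimodules, and the
      -- bialgebra in `𝒞` which it gives on `C ⊗ H ⊗ B`
      (∃ (PX : HopfTensor M.hopfBimodule M.hopfBimodule)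
        (PY : HopfTensor N.hopfBimodule N.hopfBimodule)
        (PZ : HopfTensor (doubleTensor M N).obj (doubleTensor M N).obj)
        (bX : HopfBialgData PX) (bY : HopfBialgData PY) (bZ : HopfBialgData PZ),
        PX.IsTensor ∧ PY.IsTensor ∧ PZ.IsTensor ∧
        bX.IsBialgebra ∧ bY.IsBialgebra ∧ bZ.IsBialgebra ∧
        bX.toBialgData = M.biproduct ∧ bX.one = (ρ_ H).inv ≫ H ◁ η[B] ∧
        bX.counit = H ◁ ε[B] ≫ (ρ_ H).hom ∧
        bY.toBialgData = N.biproduct ∧ bY.one = (λ_ H).inv ≫ η[C] ▷ H ∧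
        bY.counit = ε[C] ▷ H ≫ (λ_ H).hom ∧
        bY.IsTensorProduct bX bZ ∧
        bZ.toBialgData = doubleBialgData M N) ∧
      M.biproduct.IsBialgebra ∧ N.biproduct.IsBialgebra ∧ (doubleBialgData M N).IsBialgebra ∧
      -- the canonical morphisms
      (N.biproduct.IsBialgHom (doubleBialgData M N) (C ◁ ((ρ_ H).inv ≫ H ◁ η[B])) ∧
        Mono (C ◁ ((ρ_ H).inv ≫ H ◁ η[B]))) ∧
      (M.biproduct.IsBialgHom (doubleBialgData M N) ((λ_ (H ⊗ B)).inv ≫ η[C] ▷ (H ⊗ B)) ∧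
        Mono ((λ_ (H ⊗ B)).inv ≫ η[C] ▷ (H ⊗ B))) ∧
      ((doubleBialgData M N).IsBialgHom N.biproduct (C ◁ (H ◁ ε[B] ≫ (ρ_ H).hom)) ∧
        Epi (C ◁ (H ◁ ε[B] ≫ (ρ_ H).hom))) ∧
      ((doubleBialgData M N).IsBialgHom M.biproduct (ε[C] ▷ (H ⊗ B) ≫ (λ_ (H ⊗ B)).hom) ∧
        Epi (ε[C] ▷ (H ⊗ B) ≫ (λ_ (H ⊗ B)).hom)) ∧
      (((BialgData.of C).tensor (BialgData.of B)).IsAlgHom (doubleBialgData M N)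
          (C ◁ ((λ_ B).inv ≫ η[H] ▷ B)) ∧
        Mono (C ◁ ((λ_ B).inv ≫ η[H] ▷ B))) ∧
      ((doubleBialgData M N).IsCoalgHom ((BialgData.of C).tensor (BialgData.of B))
          (C ◁ (ε[H] ▷ B ≫ (λ_ B).hom)) ∧
        Epi (C ◁ (ε[H] ▷ B ≫ (λ_ B).hom))) ∧
      -- the pairing gives a two-cocycle
      (∀ ρ : B ⊗ C ⟶ 𝟙_ 𝒞, IsCompatiblePairing M N ρ →
        (doubleBialgData M N).CocycleIdentity (hatPairing H ρ) ∧
        (IsUnitalPairing ρ → (doubleBialgData M N).IsTwoCocycle (hatPairing H ρ))) ∧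
      -- an invertible pairing gives an invertible two-cocycle, and the twisted bialgebra is the
      -- double biproduct with the explicit multiplication
      (∀ ρ ρ' : B ⊗ C ⟶ 𝟙_ 𝒞, IsCompatiblePairing M N ρ →
        ((BialgData.of B).tensor (BialgData.of C)).IsConvInverse ρ ρ' →
        (doubleBialgData M N).IsTwoCocycle (hatPairing H ρ) ∧
        ((doubleBialgData M N).tensor (doubleBialgData M N)).IsConvInverse
          (hatPairing H ρ) (hatPairing H ρ') ∧
        ((doubleBialgData M N).twist (hatPairing H ρ) (hatPairing H ρ')).IsBialgebra ∧
        ((doubleBialgData M N).twist (hatPairing H ρ) (hatPairing H ρ')).mul =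
          doubleBiproductMul M N ρ ρ')) := by
  have oX := biproduct_isBialgebraOver hB hC
  have oY := biproduct_isBialgebraOver' hB hC
  have hQ := doubleTensor_isTensor hB hC
  have hX := oX.isHopfBimodule
  have hY := oY.isHopfBimodule
  refine ⟨⟨hX, hY, hQ, ?_⟩, fun hinv => ?_⟩
  · obtain ⟨P, hP⟩ := HopfTensor.exists_isTensor hX hY
    obtain ⟨ψ, hψ⟩ := hP.exists_isBraiding hQ hX hY
    obtain ⟨ψ', hψ'⟩ := hQ.exists_isBraiding hP hY hX
    exact ⟨P, ψ, ψ', hP, hψ, hψ'⟩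
  have hM := commute_of_braidingInvolutive hB hC hinv
  have hZ := (double_isBialgebraOver hB hC hM).isBialgebra
  refine ⟨exists_isTensorProduct hB hC hM, oX.isBialgebra, oY.isBialgebra, hZ,
    ⟨biproduct_double_isBialgHom' hB hC, mono_of_comp (incl_proj_of_isBialgebra' hB)⟩,
    ⟨biproduct_double_isBialgHom hB hC, mono_of_comp (incl_proj_of_isBialgebra hC)⟩,
    ⟨double_biproduct_isBialgHom' hB hC, epi_of_comp (incl_proj_of_isBialgebra' hB)⟩,
    ⟨double_biproduct_isBialgHom hB hC, epi_of_comp (incl_proj_of_isBialgebra hC)⟩,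
    ⟨tensor_double_isAlgHom hB hC, mono_of_comp (incl_proj H B C)⟩,
    ⟨double_tensor_isCoalgHom hB hC, epi_of_comp (incl_proj H B C)⟩,
    fun ρ hρ => ⟨hatPairing_cocycleIdentity hB hC hρ, hatPairing_isTwoCocycle hB hC hρ⟩,
    fun ρ ρ' hρ h => ?_⟩
  have hu := hatPairing_isTwoCocycle hB hC hρ (isUnitalPairing_of_isConvInverse hB hC hρ h)
  have hi := hatPairing_isConvInverse hB hC (M := M) (N := N) h
  exact ⟨hu, hi, twist_isBialgebra hZ hu hi, twist_mul hB hC ρ ρ'⟩
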